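/- Let $K$ be a field of characteristic zero, let $N=\mathrm{UT}(n,K)$ be the group of lower triangular $n\times n$ matrices with units on the diagonal, and let ${\mathfrak n}$ be its Lie algebra of lower triangular matrices with zeros on the diagonal. Let $A=\{(i,j): n\ge i>j\ge 1\}$, let $y_{ij}$, $(i,j)\in A$, be the matrix units, and let ${\mathfrak m}$ be an ideal of ${\mathfrak n}$ that is spanned as a linear subspace by $\{y_{ij}:(i,j)\in M\}$ for some $M\subset A$. Put ${\cal L}={\mathfrak n}/{\mathfrak m}$ and $L=N/\exp({\mathfrak m})$, and write $y_\xi$ ($\xi\in A$) also for the image of $y_\xi$ in ${\cal L}\subset S({\cal L})=K[{\cal L}^*]$. The algebra $K[{\cal L}^*]$ carries the Poisson bracket with $\{x,y\}=[x,y]$ for $x,y\in{\cal L}$, and $K[{\cal L}^*]^L$ is the algebra of invariants of the coadjoint action $\mathrm{Ad}^*_gf(x)=f(\mathrm{Ad}_g^{-1}x)$. Order $A$ by $(n,1)\succ(n-1,1)\succ\dots\succ(2,1)\succ(n,2)\succ\dots\succ(3,2)\succ\dots\succ(n,n-1)$. The diagram ${\cal D}_{\cal L}$ is a filling of the places of $A$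 by the symbols $\otimes,\bullet,+,-$ obtained as follows. Step $0$: fill the places of $M$ by $\bullet$. Step $i\ge 1$ (carried out as long as empty places remain): put $\otimes$ on the greatest empty place $\xi_i=(k,t)$ with respect to $\succ$; then for every $a$ with $k>a>t$ such that both places $(k,a)$ and $(a,t)$ are empty, put $-$ on $(k,a)$ and $+$ on $(a,t)$. Let $S=\{\xi_1,\dots,\xi_s\}$ be the set of places filled by $\otimes$, where $\xi_i$ is filled during the $i$-th step, and $s=|S|$. **Theorem 1.** There exist $z_1,\dots,z_s\in K[{\cal L}^*]^L$ such that: 1) every $z_i$ has the form $z_i=y_{\xi_i}Q_i+P_{>i}$, where $Q_i$ is a product of powers (with exponents $\ge 0$) of $z_1,\dots,z_{i-1}$, and $P_{>i}$ is a polynomial in $\{y_\eta:\eta\succ\xi_i\}$; 2) let ${\cal Z}$ be the multiplicative subset generated by $z_1,\dots,z_s$. For some $m\ge 0$ the localization $K[{\cal L}^*]_{\cal Z}$ is isomorphic as a Poisson algebra, by an isomorphism that sends each $z_i$ to the variable $z_i\otimes 1$, to the tensor product $K[z_1^{\pm},\dots,z_s^{\pm}]\otimes{\Bbb A}_m$.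 Here $K[z_1^{\pm},\dots,z_s^{\pm}]$ is the algebra of Laurent polynomials with zero bracket, ${\Bbb A}_m=K[p_1,\dots,p_m;q_1,\dots,q_m]$ has the bracket $\{p_i,q_i\}=1$, with all other brackets of generators equal to zero, and the two factors of the tensor product Poisson-commute. -/

import Mathlib

open scoped TensorProduct

noncomputable section

/-! ## Poisson algebras -/

/-- A Poisson bracket on a commutative `K`-algebra `A` (over a field of characteristic zero,
skew-symmetry is the same as being alternating). -/
structure PoissonBracket (K A : Type*) [Field K] [CommRing A] [Algebra K A] where
  /-- the bracket `{a, b}` -/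
  bracket : A →ₗ[K] A →ₗ[K] A
  skew : ∀ a b, bracket a b = -bracket b a
  leibniz : ∀ a b c, bracket a (b * c) = bracket a b * c + b * bracket a c
  jacobi : ∀ a b c,
    bracket a (bracket b c) + bracket b (bracket c a) + bracket c (bracket a b) = 0

namespace PoissonBracket

section Construction

variable {K A : Type*} [Field K] [CommRing A] [Algebra K A]

/-- The derivation `b ↦ β a b` of a bilinear map with the Leibniz rule on the right. -/
def derivRight (β : A →ₗ[K] A →ₗ[K] A)
    (hr : ∀ a b c, β a (b * c) = β a b * c + b * β a c) (a : A) : Derivation K A A :=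
  Derivation.mk' (β a) fun b c => by rw [hr, smul_eq_mul, smul_eq_mul]; ring

/-- A bilinear map that is a derivation in each argument is a Poisson bracket as soon as it is
skew-symmetric and satisfies the Jacobi identity on a set `G` by which derivations of `A` are
determined. -/
def ofGenerators (β : A →ₗ[K] A →ₗ[K] A)
    (hr : ∀ a b c, β a (b * c) = β a b * c + b * β a c)
    (hl : ∀ a b c, β (a * b) c = β a c * b + a * β b c)
    (G : Set A) (hG : ∀ d : Derivation K A A, (∀ g ∈ G, d g = 0) → d = 0)
    (hskew : ∀ g ∈ G, ∀ h ∈ G, β g h = -β h g)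
    (hjac : ∀ g ∈ G, ∀ h ∈ G, ∀ k ∈ G, β g (β h k) + β h (β k g) + β k (β g h) = 0) :
    PoissonBracket K A :=
  have skew : ∀ a b, β a b = -β b a := by
    have key : ∀ a, (∀ g ∈ G, β a g + β g a = 0) → ∀ b, β a b + β b a = 0 := by
      intro a ha b
      have h0 := hG (Derivation.mk' (β a + β.flip a) fun b c => by
        simp only [LinearMap.add_apply, LinearMap.flip_apply, hr, hl, smul_eq_mul]; ring)
        (fun g hg => by simpa using ha g hg)
      simpa using congrArg (fun d : Derivation K A A => d b) h0
    intro a b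
    refine eq_neg_of_add_eq_zero_left (key a (fun g hg => ?_) b)
    rw [add_comm]
    refine key g (fun h hh => ?_) a
    rw [hskew g hg h hh, neg_add_cancel]
  have jac : ∀ a b c, β a (β b c) + β b (β c a) + β c (β a b) = 0 := by
    have key : ∀ a b, (∀ g ∈ G, β a (β b g) + β b (β g a) + β g (β a b) = 0) →
        ∀ c, β a (β b c) + β b (β c a) + β c (β a b) = 0 := by
      intro a b hab c
      have h0 := hG (⁅derivRight β hr a, derivRight β hr b⁆ - derivRight β hr (β a b))
        (fun g hg => by
          have h1 := hab g hg
          rw [skew g a, map_neg, skew g (β a b)] at h1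
          simp only [Derivation.sub_apply, Derivation.commutator_apply]
          change β a (β b g) - β b (β a g) - β (β a b) g = 0
          linear_combination h1)
      have h2 : β a (β b c) - β b (β a c) - β (β a b) c = 0 := by
        have := congrArg (fun d : Derivation K A A => d c) h0
        simp only [Derivation.sub_apply, Derivation.commutator_apply, Derivation.zero_apply] at this
        exact this
      rw [skew c a, map_neg, skew c (β a b)]
      linear_combination h2
    have cyc : ∀ a b c, β a (β b c) + β b (β c a) + β c (β a b) = 0 →
        β b (β c a) + β c (β a b) + β a (β b c) = 0 := by
      intro a b c h
      linear_combination h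
    have h1 : ∀ g ∈ G, ∀ h ∈ G, ∀ c, β g (β h c) + β h (β c g) + β c (β g h) = 0 :=
      fun g hg h hh => key g h fun k hk => hjac g hg h hh k hk
    have h2 : ∀ g ∈ G, ∀ c b, β c (β g b) + β g (β b c) + β b (β c g) = 0 :=
      fun g hg c => key c g fun h hh => cyc _ _ _ (cyc _ _ _ (h1 g hg h hh c))
    exact fun a b => key a b fun g hg => cyc _ _ _ (cyc _ _ _ (h2 g hg b a))
  { bracket := β
    skew := skew
    leibniz := hr
    jacobi := jac }

/-- The bilinear map underlying a derivation `A → Der(A, A)`. -/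
def bilinOfDerivation (D : Derivation K A (Derivation K A A)) : A →ₗ[K] A →ₗ[K] A :=
  LinearMap.mk₂ K (fun a b => D a b)
    (fun a a' b => by simp) (fun c a b => by simp) (fun a b b' => by simp) (fun c a b => by simp)

/-- A biderivation, given as a derivation `A → Der(A, A)`, is a Poisson bracket as soon as it is
skew-symmetric and satisfies the Jacobi identity on a set by which derivations are determined. -/
def ofDerivation (D : Derivation K A (Derivation K A A))
    (G : Set A) (hG : ∀ d : Derivation K A A, (∀ g ∈ G, d g = 0) → d = 0)
    (hskew : ∀ g ∈ G, ∀ h ∈ G, D g h = -D h g)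
    (hjac : ∀ g ∈ G, ∀ h ∈ G, ∀ k ∈ G, D g (D h k) + D h (D k g) + D k (D g h) = 0) :
    PoissonBracket K A :=
  ofGenerators (bilinOfDerivation D)
    (fun a b c => by
      simp only [bilinOfDerivation, LinearMap.mk₂_apply, Derivation.leibniz, smul_eq_mul]; ring)
    (fun a b c => by
      simp only [bilinOfDerivation, LinearMap.mk₂_apply, Derivation.leibniz, Derivation.add_apply,
        Derivation.smul_apply, smul_eq_mul]; ring)
    G hG hskew hjac

/-- The zero Poisson bracket. -/
def zero (K A : Type*) [Field K] [CommRing A] [Algebra K A] : PoissonBracket K A where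
  bracket := 0
  skew := by simp
  leibniz := by simp
  jacobi := by simp

end Construction

/-- Let `φ : A → B` be a homomorphism of algebras and `M` a `B`-module. The derivation `A → M`
given by an algebra homomorphism `A → B ⊕ M` into the square-zero extension that lifts `φ`. -/
def derivationOfLift {K A B M : Type*} [Field K] [CommRing A] [Algebra K A] [CommRing B]
    [Algebra K B] [Algebra A B] [IsScalarTower K A B] [AddCommGroup M] [Module K M] [Module B M]
    [Module Bᵐᵒᵖ M] [IsCentralScalar B M] [IsScalarTower K B M]
    [Module A M] [IsScalarTower A B M]
    (F : A →ₐ[K] TrivSqZeroExt B M) (hF : ∀ a, (F a).fst = algebraMap A B a) :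
    Derivation K A M :=
  Derivation.mk' ((TrivSqZeroExt.sndHom B M).restrictScalars K ∘ₗ F.toLinearMap) fun a b => by
    simp [TrivSqZeroExt.snd_mul, hF]


/-! ### The Lie–Poisson bracket on the symmetric algebra of a Lie algebra -/

section SymmetricAlgebra

variable {K V : Type*} [Field K] [AddCommGroup V] [Module K V]

/-- The derivation of the symmetric algebra of `V` that extends a linear map `f` on `V`. -/
def symDerivation {M : Type*} [AddCommGroup M] [Module K M] [Module (SymmetricAlgebra K V) M]
    [Module (SymmetricAlgebra K V)ᵐᵒᵖ M] [IsCentralScalar (SymmetricAlgebra K V) M]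
    [IsScalarTower K (SymmetricAlgebra K V) M] (f : V →ₗ[K] M) :
    Derivation K (SymmetricAlgebra K V) M :=
  derivationOfLift (B := SymmetricAlgebra K V)
    (SymmetricAlgebra.lift
      ((TrivSqZeroExt.inlAlgHom K (SymmetricAlgebra K V) M).toLinearMap ∘ₗ
          SymmetricAlgebra.ι K V +
        (TrivSqZeroExt.inrHom (SymmetricAlgebra K V) M).restrictScalars K ∘ₗ f))
    (fun a => by
      have h : (TrivSqZeroExt.fstHom K (SymmetricAlgebra K V) M).comp (SymmetricAlgebra.lift
          ((TrivSqZeroExt.inlAlgHom K (SymmetricAlgebra K V) M).toLinearMap ∘ₗ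
              SymmetricAlgebra.ι K V +
            (TrivSqZeroExt.inrHom (SymmetricAlgebra K V) M).restrictScalars K ∘ₗ f)) =
          AlgHom.id K _ := by
        apply SymmetricAlgebra.algHom_ext
        ext x
        simp
      exact congrArg (fun F : SymmetricAlgebra K V →ₐ[K] SymmetricAlgebra K V => F a) h)

theorem symDerivation_ι {M : Type*} [AddCommGroup M] [Module K M]
    [Module (SymmetricAlgebra K V) M] [Module (SymmetricAlgebra K V)ᵐᵒᵖ M]
    [IsCentralScalar (SymmetricAlgebra K V) M] [IsScalarTower K (SymmetricAlgebra K V) M]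
    (f : V →ₗ[K] M) (x : V) : symDerivation f (SymmetricAlgebra.ι K V x) = f x := by
  simp [symDerivation, derivationOfLift]

theorem symDerivation_ext (d : Derivation K (SymmetricAlgebra K V) (SymmetricAlgebra K V))
    (hd : ∀ g ∈ Set.range (SymmetricAlgebra.ι K V), d g = 0) : d = 0 := by
  ext a
  induction a using SymmetricAlgebra.induction with
  | algebraMap r => simp
  | ι x => simpa using hd _ ⟨x, rfl⟩
  | mul a b ha hb => simp_all
  | add a b ha hb => simp_all

end SymmetricAlgebra

section LiePoisson

variable (K 𝔤 : Type*) [Field K] [LieRing 𝔤] [LieAlgebra K 𝔤]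

/-- The biderivation of `S(𝔤)` with `(x, y) ↦ [x, y]` for `x, y ∈ 𝔤`. -/
def lieBiderivation :
    Derivation K (SymmetricAlgebra K 𝔤)
      (Derivation K (SymmetricAlgebra K 𝔤) (SymmetricAlgebra K 𝔤)) :=
  symDerivation
    { toFun := fun x => symDerivation (SymmetricAlgebra.ι K 𝔤 ∘ₗ LieAlgebra.ad K 𝔤 x)
      map_add' := fun x y => sub_eq_zero.mp <| symDerivation_ext _ <| by
        rintro _ ⟨z, rfl⟩
        simp [symDerivation_ι]
      map_smul' := fun c x => sub_eq_zero.mp <| symDerivation_ext _ <| by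
        rintro _ ⟨z, rfl⟩
        simp [symDerivation_ι] }

theorem lieBiderivation_ι (x y : 𝔤) :
    lieBiderivation K 𝔤 (SymmetricAlgebra.ι K 𝔤 x) (SymmetricAlgebra.ι K 𝔤 y) =
      SymmetricAlgebra.ι K 𝔤 ⁅x, y⁆ := by
  simp [lieBiderivation, symDerivation_ι]

/-- The Poisson bracket on `K[𝔤*] = S(𝔤)` determined by `{x, y} = [x, y]` for `x, y ∈ 𝔤`. -/
def liePoisson : PoissonBracket K (SymmetricAlgebra K 𝔤) :=
  ofDerivation (lieBiderivation K 𝔤) (Set.range (SymmetricAlgebra.ι K 𝔤)) symDerivation_ext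
    (by
      rintro _ ⟨x, rfl⟩ _ ⟨y, rfl⟩
      rw [lieBiderivation_ι, lieBiderivation_ι, ← map_neg, lie_skew])
    (by
      rintro _ ⟨x, rfl⟩ _ ⟨y, rfl⟩ _ ⟨z, rfl⟩
      simp only [lieBiderivation_ι, ← map_add, lie_jacobi, map_zero])

theorem liePoisson_ι (x y : 𝔤) :
    (liePoisson K 𝔤).bracket (SymmetricAlgebra.ι K 𝔤 x) (SymmetricAlgebra.ι K 𝔤 y) =
      SymmetricAlgebra.ι K 𝔤 ⁅x, y⁆ :=
  lieBiderivation_ι K 𝔤 x y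

end LiePoisson

/-! ### Localization -/

section Localization

variable {K A : Type*} [Field K] [CommRing A] [Algebra K A] (S : Submonoid A)

/-- The extension of a derivation `A → M` to the localization of `A` at `S`, where `M` is a module
over the localization. -/
def locDerivation {M : Type*} [AddCommGroup M] [Module K M] [Module A M]
    [Module (Localization S) M] [Module (Localization S)ᵐᵒᵖ M] [IsCentralScalar (Localization S) M]
    [IsScalarTower K (Localization S) M] [IsScalarTower A (Localization S) M]
    (d : Derivation K A M) : Derivation K (Localization S) M :=
  let F : A →ₐ[K] TrivSqZeroExt (Localization S) M :=
    { toFun := fun a => TrivSqZeroExt.inl (algebraMap A (Localization S) a) +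
        TrivSqZeroExt.inr (d a)
      map_one' := by ext <;> simp
      map_mul' := fun a b => by ext <;> simp
      map_zero' := by ext <;> simp
      map_add' := fun a b => by ext <;> simp
      commutes' := fun r => by
        ext
        · simp [TrivSqZeroExt.algebraMap_eq_inl', ← IsScalarTower.algebraMap_apply]
        · simp [TrivSqZeroExt.algebraMap_eq_inl'] }
  have hF : ∀ s : S, IsUnit (F s) := fun s => by
    rw [TrivSqZeroExt.isUnit_iff_isUnit_fst]
    simpa [F] using IsLocalization.map_units (Localization S) s
  derivationOfLift (B := Localization S) (IsLocalization.liftAlgHom (f := F) hF) fun a => by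
    have h : (TrivSqZeroExt.fstHom K (Localization S) M).comp
        (IsLocalization.liftAlgHom (f := F) hF) = AlgHom.id K (Localization S) := by
      apply IsLocalization.algHom_ext S
      ext a
      change ((IsLocalization.lift hF) (algebraMap A (Localization S) a)).fst =
        algebraMap A (Localization S) a
      rw [IsLocalization.lift_eq]
      simp [F]
    exact congrArg (fun G : Localization S →ₐ[K] Localization S => G a) h

theorem locDerivation_algebraMap {M : Type*} [AddCommGroup M] [Module K M] [Module A M]
    [Module (Localization S) M] [Module (Localization S)ᵐᵒᵖ M] [IsCentralScalar (Localization S) M]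
    [IsScalarTower K (Localization S) M] [IsScalarTower A (Localization S) M]
    (d : Derivation K A M) (a : A) :
    locDerivation S d (algebraMap A (Localization S) a) = d a := by
  simp [locDerivation, derivationOfLift]

theorem locDerivation_ext (d : Derivation K (Localization S) (Localization S))
    (hd : ∀ g ∈ Set.range (algebraMap A (Localization S)), d g = 0) : d = 0 := by
  ext x
  obtain ⟨a, s, rfl⟩ := IsLocalization.exists_mk'_eq S x
  have h1 := congrArg d (IsLocalization.mk'_spec (Localization S) a s)
  rw [Derivation.leibniz, hd _ ⟨_, rfl⟩, hd _ ⟨_, rfl⟩, smul_zero, zero_add, smul_eq_mul] at h1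
  exact (IsLocalization.map_units (Localization S) s).mul_right_eq_zero.mp h1

variable (P : PoissonBracket K A)

/-- The biderivation of the localization that extends a Poisson bracket. -/
def locBiderivation :
    Derivation K (Localization S) (Derivation K (Localization S) (Localization S)) :=
  locDerivation S <| Derivation.mk'
    { toFun := fun a => locDerivation S
        ((Algebra.linearMap A (Localization S)).compDer (derivRight P.bracket P.leibniz a))
      map_add' := fun a b => sub_eq_zero.mp <| locDerivation_ext S _ <| by
        rintro _ ⟨c, rfl⟩
        simp [locDerivation_algebraMap, derivRight]
      map_smul' := fun r a => sub_eq_zero.mp <| locDerivation_ext S _ <| by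
        rintro _ ⟨c, rfl⟩
        simp [locDerivation_algebraMap, derivRight] }
    (fun a b => sub_eq_zero.mp <| locDerivation_ext S _ <| by
      rintro _ ⟨c, rfl⟩
      simp [locDerivation_algebraMap, derivRight]
      rw [P.skew (a * b) c, P.leibniz, P.skew c a, P.skew c b]
      simp only [Algebra.smul_def, map_neg, map_add, map_mul]
      ring)

theorem locBiderivation_algebraMap (a b : A) :
    locBiderivation S P (algebraMap A (Localization S) a) (algebraMap A (Localization S) b) =
      algebraMap A (Localization S) (P.bracket a b) := by
  simp [locBiderivation, locDerivation_algebraMap, derivRight]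

/-- The unique extension of a Poisson bracket on `A` to a localization of `A`. -/
def localization : PoissonBracket K (Localization S) :=
  ofDerivation (locBiderivation S P) (Set.range (algebraMap A (Localization S)))
    (locDerivation_ext S)
    (by
      rintro _ ⟨x, rfl⟩ _ ⟨y, rfl⟩
      rw [locBiderivation_algebraMap, locBiderivation_algebraMap, ← map_neg, P.skew])
    (by
      rintro _ ⟨x, rfl⟩ _ ⟨y, rfl⟩ _ ⟨z, rfl⟩
      simp only [locBiderivation_algebraMap, ← map_add, P.jacobi, map_zero])

theorem localization_algebraMap (a b : A) :
    (P.localization S).bracket (algebraMap A (Localization S) a)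
      (algebraMap A (Localization S) b) = algebraMap A (Localization S) (P.bracket a b) :=
  locBiderivation_algebraMap S P a b

end Localization


/-! ### Tensor products and the canonical bracket -/

section Tensor

variable {K A B : Type*} [Field K] [CommRing A] [Algebra K A] [CommRing B] [Algebra K B]

theorem tensorDerivation_ext (d : Derivation K (A ⊗[K] B) (A ⊗[K] B))
    (hd : ∀ g ∈ Set.range (fun a : A => a ⊗ₜ[K] (1 : B)) ∪ Set.range (fun b : B => (1 : A) ⊗ₜ[K] b),
      d g = 0) : d = 0 := by
  ext x
  induction x using TensorProduct.induction_on with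
  | zero => simp
  | tmul a b =>
    have h : a ⊗ₜ[K] b = (a ⊗ₜ[K] (1 : B)) * ((1 : A) ⊗ₜ[K] b) := by simp
    rw [h, Derivation.leibniz, hd _ (Or.inl ⟨a, rfl⟩), hd _ (Or.inr ⟨b, rfl⟩)]
    simp
  | add x y hx hy => simp_all

/-- The bilinear map `(a ⊗ b, c ⊗ d) ↦ {a, c} ⊗ b d + a c ⊗ {b, d}`. -/
def tensorBilin (P : PoissonBracket K A) (Q : PoissonBracket K B) :
    A ⊗[K] B →ₗ[K] A ⊗[K] B →ₗ[K] A ⊗[K] B :=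
  TensorProduct.map₂ P.bracket (LinearMap.mul K B) + TensorProduct.map₂ (LinearMap.mul K A) Q.bracket

theorem tensorBilin_tmul (P : PoissonBracket K A) (Q : PoissonBracket K B) (a c : A) (b d : B) :
    tensorBilin P Q (a ⊗ₜ b) (c ⊗ₜ d) = P.bracket a c ⊗ₜ (b * d) + (a * c) ⊗ₜ Q.bracket b d := by
  simp [tensorBilin]

theorem bracket_one (P : PoissonBracket K A) (a : A) : P.bracket a 1 = 0 := by
  have := P.leibniz a 1 1
  simpa using this

theorem one_bracket (P : PoissonBracket K A) (a : A) : P.bracket 1 a = 0 := by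
  rw [P.skew, bracket_one, neg_zero]

theorem tensorBilin_skew (P : PoissonBracket K A) (Q : PoissonBracket K B) (x y : A ⊗[K] B) :
    tensorBilin P Q x y = -tensorBilin P Q y x := by
  induction x using TensorProduct.induction_on with
  | zero => simp
  | tmul a b =>
    induction y using TensorProduct.induction_on with
    | zero => simp
    | tmul c d =>
      rw [tensorBilin_tmul, tensorBilin_tmul, P.skew a c, Q.skew b d, TensorProduct.neg_tmul,
        TensorProduct.tmul_neg, mul_comm b d, mul_comm a c, neg_add]
    | add y z hy hz => rw [map_add, hy, hz, map_add, LinearMap.add_apply, neg_add]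
  | add x z hx hz => rw [map_add, LinearMap.add_apply, hx, hz, map_add, neg_add]

theorem tensorBilin_leibniz (P : PoissonBracket K A) (Q : PoissonBracket K B)
    (x y z : A ⊗[K] B) :
    tensorBilin P Q x (y * z) = tensorBilin P Q x y * z + y * tensorBilin P Q x z := by
  induction x using TensorProduct.induction_on with
  | zero => simp
  | add x x' hx hx' => simp only [map_add, LinearMap.add_apply, hx, hx']; ring
  | tmul a b =>
    induction y using TensorProduct.induction_on with
    | zero => simp
    | add y y' hy hy' => simp only [map_add, add_mul, hy, hy']; ring
    | tmul c d =>
      induction z using TensorProduct.induction_on with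
      | zero => simp
      | add z z' hz hz' => simp only [map_add, mul_add, hz, hz']; ring
      | tmul e f =>
        simp only [Algebra.TensorProduct.tmul_mul_tmul, tensorBilin_tmul, P.leibniz, Q.leibniz,
          TensorProduct.add_tmul, TensorProduct.tmul_add, add_mul, mul_add]
        have h1 : b * d * f = b * (d * f) := by ring
        have h2 : d * (b * f) = b * (d * f) := by ring
        have h3 : a * c * e = a * (c * e) := by ring
        have h4 : c * (a * e) = a * (c * e) := by ring
        rw [h1, h2, h3, h4]
        abel

/-- The Poisson bracket on the tensor product of two Poisson algebras: it restricts to the given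
brackets on the two factors, and the two factors commute. -/
def tensor (P : PoissonBracket K A) (Q : PoissonBracket K B) : PoissonBracket K (A ⊗[K] B) :=
  ofGenerators (tensorBilin P Q) (tensorBilin_leibniz P Q)
    (fun x y z => by
      rw [tensorBilin_skew P Q (x * y) z, tensorBilin_leibniz, tensorBilin_skew P Q x z,
        tensorBilin_skew P Q y z]
      ring)
    _ tensorDerivation_ext (fun x _ y _ => tensorBilin_skew P Q x y)
    (by
      rintro _ (⟨a, rfl⟩ | ⟨a, rfl⟩) _ (⟨b, rfl⟩ | ⟨b, rfl⟩) _ (⟨c, rfl⟩ | ⟨c, rfl⟩) <;>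
      simp [tensorBilin_tmul, bracket_one, one_bracket, ← TensorProduct.add_tmul,
        ← TensorProduct.tmul_add, P.jacobi, Q.jacobi])

end Tensor

/-- The Poisson algebra `𝔸_m = K[p_1, …, p_m; q_1, …, q_m]`, where `p_i = X (inl i)` and
`q_i = X (inr i)`, with `{p_i, q_i} = 1` and all other brackets of generators equal to zero:
`{f, g} = ∑ i, (∂f/∂p_i * ∂g/∂q_i - ∂f/∂q_i * ∂g/∂p_i)`. -/
def canonical (K : Type*) [Field K] (m : ℕ) :
    PoissonBracket K (MvPolynomial (Fin m ⊕ Fin m) K) :=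
  ofDerivation
    (MvPolynomial.mkDerivation K fun x : Fin m ⊕ Fin m => match x with
      | Sum.inl i => MvPolynomial.pderiv (Sum.inr i)
      | Sum.inr i => -MvPolynomial.pderiv (Sum.inl i))
    (Set.range MvPolynomial.X)
    (fun d hd => MvPolynomial.derivation_ext fun i => by simpa using hd _ ⟨i, rfl⟩)
    (by
      rintro _ ⟨i | i, rfl⟩ _ ⟨j | j, rfl⟩ <;>
      simp [MvPolynomial.mkDerivation_X, MvPolynomial.pderiv_X, Pi.single_apply, eq_comm])
    (by
      rintro _ ⟨i | i, rfl⟩ _ ⟨j | j, rfl⟩ _ ⟨k | k, rfl⟩ <;>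
      simp [MvPolynomial.mkDerivation_X, MvPolynomial.pderiv_X, Pi.single_apply, apply_ite])

/-- An isomorphism of algebras that preserves the Poisson brackets. -/
def IsPoissonIso {K A B : Type*} [Field K] [CommRing A] [Algebra K A] [CommRing B] [Algebra K B]
    (P : PoissonBracket K A) (Q : PoissonBracket K B) (φ : A ≃ₐ[K] B) : Prop :=
  ∀ a b, φ (P.bracket a b) = Q.bracket (φ a) (φ b)

end PoissonBracket

/-! ## The unitriangular group and its Lie algebra -/

/-- The set `A` of places `(i, j)` of an `n × n` matrix with `i > j`. -/
abbrev Place (n : ℕ) : Type := {p : Fin n × Fin n // p.2 < p.1}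

namespace Place

variable {n : ℕ}

/-- The row of a place. -/
abbrev row (ξ : Place n) : Fin n := ξ.1.1

/-- The column of a place. -/
abbrev col (ξ : Place n) : Fin n := ξ.1.2

/-- The order `η ≻ ξ` on places:
`(n,1) ≻ (n-1,1) ≻ … ≻ (2,1) ≻ (n,2) ≻ … ≻ (3,2) ≻ … ≻ (n,n-1)`. -/
def Succ (η ξ : Place n) : Prop :=
  η.col < ξ.col ∨ (η.col = ξ.col ∧ ξ.row < η.row)

instance : DecidableRel (Succ (n := n)) := fun η ξ => by
  unfold Succ
  infer_instance

end Place

section Unitriangular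

variable (K : Type*) [Field K] (n : ℕ)

/-- The group `UT(n, K)` of lower triangular `n × n` matrices with units on the diagonal. -/
def UT : Subgroup (GL (Fin n) K) where
  carrier := {g | (∀ i j, i < j → (g : Matrix (Fin n) (Fin n) K) i j = 0) ∧
    ∀ i, (g : Matrix (Fin n) (Fin n) K) i i = 1}
  one_mem' := ⟨fun i j h => by simp [h.ne], fun i => by simp⟩
  mul_mem' := by
    rintro g h ⟨hg, hg1⟩ ⟨hh, hh1⟩
    refine ⟨fun i j hij => ?_, fun i => ?_⟩
    · rw [Units.val_mul, Matrix.mul_apply]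
      refine Finset.sum_eq_zero fun k _ => ?_
      rcases lt_or_ge i k with hik | hik
      · rw [hg i k hik, zero_mul]
      · rw [hh k j (hik.trans_lt hij), mul_zero]
    · rw [Units.val_mul, Matrix.mul_apply, Finset.sum_eq_single i, hg1, hh1, one_mul]
      · intro k _ hk
        rcases lt_or_gt_of_ne hk with hik | hik
        · rw [hh k i hik, mul_zero]
        · rw [hg i k hik, zero_mul]
      · simp
  inv_mem' := by
    rintro g ⟨hg, hg1⟩
    have hinv : ∀ i j, i < j → ((g⁻¹ : GL (Fin n) K) : Matrix (Fin n) (Fin n) K) i j = 0 := by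
      have : Invertible (g : Matrix (Fin n) (Fin n) K) := g.invertible
      have h : (g : Matrix (Fin n) (Fin n) K).BlockTriangular OrderDual.toDual :=
        fun i j hij => hg i j hij
      intro i j hij
      rw [Matrix.coe_units_inv]
      exact Matrix.blockTriangular_inv_of_blockTriangular h hij
    refine ⟨hinv, fun i => ?_⟩
    have h1 : ((g : Matrix (Fin n) (Fin n) K) * ((g⁻¹ : GL (Fin n) K) :
        Matrix (Fin n) (Fin n) K)) i i = 1 := by
      rw [← Units.val_mul, mul_inv_cancel, Units.val_one, Matrix.one_apply_eq]
    rw [Matrix.mul_apply, Finset.sum_eq_single i, hg1, one_mul] at h1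
    · exact h1
    · intro k _ hk
      rcases lt_or_gt_of_ne hk with hik | hik
      · rw [hinv k i hik, mul_zero]
      · rw [hg i k hik, zero_mul]
    · simp

attribute [local instance] LieRing.ofAssociativeRing

/-- The Lie algebra `𝔫 = 𝔲𝔱(n, K)` of lower triangular `n × n` matrices with zeros on the diagonal,
with the bracket `[x, y] = x y - y x`. -/
def ut : LieSubalgebra K (Matrix (Fin n) (Fin n) K) where
  carrier := {x | ∀ i j, i ≤ j → x i j = 0}
  add_mem' := fun {x y} hx hy i j hij => by
    rw [Matrix.add_apply, hx i j hij, hy i j hij, add_zero]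
  zero_mem' := fun _ _ _ => rfl
  smul_mem' := fun c x hx i j hij => by rw [Matrix.smul_apply, hx i j hij, smul_zero]
  lie_mem' := fun {x y} hx hy i j hij => by
    have aux : ∀ u v : Matrix (Fin n) (Fin n) K, (∀ i j, i ≤ j → u i j = 0) →
        (∀ i j, i ≤ j → v i j = 0) → (u * v) i j = 0 := by
      intro u v hu hv
      rw [Matrix.mul_apply]
      refine Finset.sum_eq_zero fun k _ => ?_
      rcases le_total i k with hik | hik
      · rw [hu i k hik, zero_mul]
      · rw [hv k j (hik.trans hij), mul_zero]
    rw [LieRing.of_associative_ring_bracket, Matrix.sub_apply, aux x y hx hy, aux y x hy hx,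
      sub_zero]

variable {K n}

/-- The root vector `y_ξ ∈ 𝔫`: the matrix unit at the place `ξ`. -/
def rootVector (ξ : Place n) : ut K n :=
  ⟨Matrix.single ξ.row ξ.col 1, fun i j hij => by
    rw [Matrix.single_apply, if_neg]
    rintro ⟨rfl, rfl⟩
    exact absurd ξ.2 (not_lt.mpr hij)⟩

/-- The adjoint action `Ad_g x = g x g⁻¹` of `g ∈ UT(n, K)` on `𝔫`. -/
def adUT (g : UT K n) : ut K n →ₗ[K] ut K n where
  toFun x := ⟨(g.1 : Matrix (Fin n) (Fin n) K) * x.1 *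
      ((g⁻¹).1 : Matrix (Fin n) (Fin n) K), by
    intro i j hij
    rw [Matrix.mul_apply]
    refine Finset.sum_eq_zero fun k _ => ?_
    rcases lt_or_ge k j with hkj | hkj
    · rw [(g⁻¹).2.1 k j hkj, mul_zero]
    · rw [Matrix.mul_apply, Finset.sum_eq_zero, zero_mul]
      intro l _
      rcases lt_or_ge i l with hil | hil
      · rw [g.2.1 i l hil, zero_mul]
      · rw [x.2 l k (hil.trans (hij.trans hkj)), mul_zero]⟩
  map_add' x y := by
    apply Subtype.ext
    simp [mul_add, add_mul]
  map_smul' c x := by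
    apply Subtype.ext
    simp

end Unitriangular

/-- An ideal `𝔪` of `𝔫 = 𝔲𝔱(n, K)` that is spanned, as a linear subspace, by the root vectors at the
places of a set `M`. -/
structure RootIdeal (K : Type*) [Field K] (n : ℕ) where
  /-- the set `M` -/
  places : Finset (Place n)
  /-- the ideal `𝔪` -/
  ideal : LieIdeal K (ut K n)
  span_eq : ideal.toSubmodule = Submodule.span K (rootVector '' (places : Set (Place n)))

namespace RootIdeal

variable {K : Type*} [Field K] {n : ℕ} (I : RootIdeal K n)

/-- The Lie algebra `𝓛 = 𝔫 / 𝔪`. -/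
abbrev Quot : Type _ := ut K n ⧸ I.ideal

/-- The algebra `K[𝓛*] = S(𝓛)`. -/
abbrev Sym : Type _ := SymmetricAlgebra K I.Quot

/-- The element `y_ξ` of `K[𝓛*]`. -/
def y (ξ : Place n) : I.Sym :=
  SymmetricAlgebra.ι K I.Quot (LieSubmodule.Quotient.mk (rootVector ξ))

section

attribute [local instance] LieRing.ofAssociativeRing

theorem rootVector_mem {ξ η : Place n} (hξ : rootVector ξ ∈ I.ideal)
    (hrow : ξ.row ≤ η.row) (hcol : η.col ≤ ξ.col) : (rootVector η : ut K n) ∈ I.ideal := by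
  have step1 : ∀ (a : Fin n) (h : ξ.col < a), ξ.row ≤ a →
      (rootVector ⟨(a, ξ.col), h⟩ : ut K n) ∈ I.ideal := by
    intro a h ha
    rcases ha.eq_or_lt with rfl | ha
    · exact hξ
    · have h1 := lie_mem_right K (ut K n) I.ideal (rootVector ⟨(a, ξ.row), ha⟩) _ hξ
      convert h1 using 1
      apply Subtype.ext
      rw [LieSubalgebra.coe_bracket, LieRing.of_associative_ring_bracket]
      have hne : ξ.col ≠ a := h.ne
      simp [rootVector, hne]
  have h2 := step1 η.row (lt_of_lt_of_le ξ.2 hrow) hrow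
  rcases hcol.eq_or_lt with hc | hc
  · convert h2 using 2
    exact Subtype.ext (Prod.ext rfl hc)
  · have h3 := lie_mem_left K (ut K n) I.ideal _ (rootVector ⟨(ξ.col, η.col), hc⟩) h2
    convert h3 using 1
    apply Subtype.ext
    rw [LieSubalgebra.coe_bracket, LieRing.of_associative_ring_bracket]
    have hne : η.col ≠ η.row := η.2.ne
    simp [rootVector, hne]

/-- The ideal `𝔪` is stable under the adjoint action. -/
theorem adUT_mem (g : UT K n) : I.ideal.toSubmodule ≤ I.ideal.toSubmodule.comap (adUT g) := by
  conv_lhs => rw [I.span_eq]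
  rw [Submodule.span_le]
  rintro _ ⟨ξ, hξ, rfl⟩
  have hmem : (rootVector ξ : ut K n) ∈ I.ideal := by
    have : (rootVector ξ : ut K n) ∈ I.ideal.toSubmodule := by
      rw [I.span_eq]
      exact Submodule.subset_span ⟨ξ, hξ, rfl⟩
    exact this
  have hexp : ∀ x : ut K n, x = ∑ η : Place n, x.1 η.row η.col • rootVector η := by
    intro x
    apply Subtype.ext
    ext i j
    rw [AddSubmonoidClass.coe_finsetSum, Matrix.sum_apply]
    rcases lt_or_ge j i with hij | hij
    · rw [Finset.sum_eq_single ⟨(i, j), hij⟩]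
      · simp [rootVector]
      · intro η _ hη
        have : ¬(η.row = i ∧ η.col = j) := by
          rintro ⟨rfl, rfl⟩
          exact hη rfl
        simp [rootVector, this]
      · simp
    · rw [x.2 i j hij, Finset.sum_eq_zero]
      intro η _
      have : ¬(η.row = i ∧ η.col = j) := by
        rintro ⟨rfl, rfl⟩
        exact absurd η.2 (not_lt.mpr hij)
      simp [rootVector, this]
  change adUT g (rootVector ξ) ∈ I.ideal.toSubmodule
  rw [hexp (adUT g (rootVector ξ))]
  refine Submodule.sum_mem _ fun η _ => ?_
  by_cases h : ξ.row ≤ η.row ∧ η.col ≤ ξ.col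
  · exact Submodule.smul_mem _ _ (I.rootVector_mem hmem h.1 h.2)
  · have h0 : (adUT g (rootVector ξ)).1 η.row η.col = 0 := by
      have h1 : (adUT g (rootVector ξ)).1 η.row η.col =
          (g.1 : Matrix (Fin n) (Fin n) K) η.row ξ.row *
            ((g⁻¹).1 : Matrix (Fin n) (Fin n) K) ξ.col η.col := by
        simp only [adUT, rootVector, LinearMap.coe_mk, AddHom.coe_mk]
        rw [Matrix.mul_apply, Finset.sum_eq_single ξ.col]
        · simp
        · intro k _ hk
          simp [Matrix.mul_apply, hk.symm]
        · simp
      rw [h1]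
      rcases not_and_or.mp h with h | h
      · rw [g.2.1 _ _ (not_le.mp h), zero_mul]
      · rw [(g⁻¹).2.1 _ _ (not_le.mp h), mul_zero]
    rw [h0, zero_smul]
    exact Submodule.zero_mem _

end

/-- The action `Ad_g` of `g ∈ N = UT(n, K)` on `𝓛 = 𝔫 / 𝔪`. It depends only on the image of `g` in
the factor group `L = N / exp 𝔪`. -/
def Ad (g : UT K n) : I.Quot →ₗ[K] I.Quot :=
  I.ideal.toSubmodule.mapQ I.ideal.toSubmodule (adUT g) (I.adUT_mem g)

/-- The coadjoint action `Ad*_g f (x) = f (Ad_g⁻¹ x)` on `𝓛*`. -/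
def coAd (g : UT K n) (f : Module.Dual K I.Quot) : Module.Dual K I.Quot :=
  f ∘ₗ I.Ad g⁻¹

/-- The value at `f ∈ 𝓛*` of an element of `K[𝓛*] = S(𝓛)`, viewed as a function on `𝓛*`. -/
def evalAt (f : Module.Dual K I.Quot) : I.Sym →ₐ[K] K :=
  SymmetricAlgebra.lift f

/-- `F ∈ K[𝓛*]^L`: the function `F` is invariant under the coadjoint action. -/
def IsInvariant (F : I.Sym) : Prop :=
  ∀ (g : UT K n) (f : Module.Dual K I.Quot), I.evalAt (I.coAd g f) F = I.evalAt f F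

end RootIdeal

/-! ## The diagram -/

/-- The symbols `⊗`, `•`, `+`, `-` of a diagram. -/
inductive DiagramSymbol
  | tensor
  | bullet
  | plus
  | minus
  deriving DecidableEq

/-- A diagram, possibly unfinished; `none` stands for an empty place. -/
abbrev Diagram (n : ℕ) : Type := Place n → Option DiagramSymbol

namespace Diagram

variable {n : ℕ}

/-- `ξ` is the greatest empty place of `D` with respect to `≻`. -/
def IsGreatestEmpty (D : Diagram n) (ξ : Place n) : Prop :=
  D ξ = none ∧ ∀ η, D η = none → η ≠ ξ → ξ.Succ η

instance (D : Diagram n) : DecidablePred D.IsGreatestEmpty := fun ξ => by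
  unfold IsGreatestEmpty
  infer_instance

/-- The zero step: the places of `M` are filled by `•`. -/
def start (M : Finset (Place n)) : Diagram n := fun η =>
  if η ∈ M then some DiagramSymbol.bullet else none

/-- One step. The symbol `⊗` is put on the greatest empty place `ξ = (k, t)`. Then for every `a`
with `k > a > t` such that the places `(k, a)` and `(a, t)` are both empty, the symbol `-` is put
on `(k, a)` and the symbol `+` is put on `(a, t)`. If there is no empty place, nothing happens. -/
def step (D : Diagram n) : Diagram n := fun η =>
  if D.IsGreatestEmpty η then some DiagramSymbol.tensor
  else if ∃ ξ ζ : Place n, D.IsGreatestEmpty ξ ∧ η.row = ξ.row ∧ η.col = ζ.row ∧ ζ.col = ξ.col ∧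
      D η = none ∧ D ζ = none then some DiagramSymbol.minus
  else if ∃ ξ ζ : Place n, D.IsGreatestEmpty ξ ∧ ζ.row = ξ.row ∧ ζ.col = η.row ∧ η.col = ξ.col ∧
      D ζ = none ∧ D η = none then some DiagramSymbol.plus
  else D η

/-- The diagram after the `i`-th step. -/
def stage (M : Finset (Place n)) (i : ℕ) : Diagram n := step^[i] (start M)

/-- The final diagram. Each step fills at least one empty place, so that after as many steps as
there are places no place is empty. -/
def final (M : Finset (Place n)) : Diagram n := stage M (Fintype.card (Place n))

/-- The set `S` of the places filled by `⊗` in the final diagram. -/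
def tensorPlaces (M : Finset (Place n)) : Finset (Place n) :=
  Finset.univ.filter fun ξ => final M ξ = some DiagramSymbol.tensor

end Diagram

/-- The algebra `K[z_1^±, …, z_s^±]` of Laurent polynomials. -/
abbrev MvLaurent (K : Type*) [Field K] (s : ℕ) : Type _ := AddMonoidAlgebra K (Fin s → ℤ)

/-- The variable `z_i` of the Laurent polynomial algebra. -/
def MvLaurent.Z {K : Type*} [Field K] {s : ℕ} (i : Fin s) : MvLaurent K s :=
  AddMonoidAlgebra.single (Pi.single i 1) 1

end

/-!
The proof reduces the Poisson algebra `S(𝓛)` one place `⊗` at a time, inside its field of fractions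
`F` with the extended bracket.

A stage of the reduction consists of the relation `E` of empty places, a family `Y` of elements of
`F` that is supported on `E` and satisfies the bracket relations of matrix units there
(`IsRootFamily`), and canonical pairs `p`, `q` that commute with `Y` and with the invariants found so
far. Let `(k, t)` be the greatest empty place. Then `w = Y_{kt}` commutes with everything. For every
`a` such that `(k, a)` and `(a, t)` are both empty, `Y_{ka} / w` and `Y_{at}` form a new canonical
pair. The elements at the remaining places are corrected so that they commute with the new pairs:
`Y_{ab}` becomes `Y_{ab} - Y_{kb} Y_{at} / w`, and in column `k` it becomes
`(1 / w) ∑ e, Y_{ae} Y_{et}` (`reduceFamily`). The corrected family satisfies the relations of matrix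
units on the places that are still empty (`IsRootFamily.reduce`). This rests on combinatorial
properties of the relation of empty places, which hold at the beginning because `𝔪` is an ideal and
are inherited by each step (`IsEmptyPattern`, `IsEmptyPattern.reduce`).

The corrections at a place involve only greater places and inverses of earlier invariants, so `w` is
`y_{kt}` plus a polynomial in greater variables divided by a product of powers of earlier invariants.
Clearing this denominator gives the next invariant, in triangular form; it is not zero since `y_{kt}`
is transcendental over the greater variables (`ReductionState.step`).

When no empty place is left, `S(𝓛) ⊆ K[z^±, p, q] ⊆ S(𝓛)_𝓩` inside `F`, hence the last two algebras
are equal. Each step removes as many places as it produces invariants and canonical coordinates, so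
there are `dim 𝓛 = trdeg F` elements `z`, `p`, `q` in all, and `F` is algebraic over the field that
they generate. Therefore they are algebraically independent (`algebraicIndependent_of_card_le_trdeg`),
and `K[z^±, p, q]` is the tensor product of the Laurent polynomials with the canonical Poisson algebra
(`exists_isPoissonIso`).

Finally, the `z_i` are Poisson-central, and central elements are invariant under the coadjoint action
(`RootIdeal.isInvariant_of_bracket_eq_zero`): the group is generated by the elements `1 + C`, where
`C` is concentrated in one column; for these `Ad_{1+C} = 1 + ad C`, and the derivative of a central
function along the line `T ↦ f ∘ (1 + T ad C)` vanishes.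
-/

noncomputable section

/-! ### The combinatorics of the empty places -/

/-- The combinatorial properties of the relation `E` of empty places that hold at every stage of the
reduction. Here `M` is the relation of the places filled by `•`, and a place is given by its row and
its column. -/
structure IsEmptyPattern {α : Type*} [LinearOrder α] (M E : α → α → Prop) : Prop where
  lt : ∀ {a b}, E a b → b < a
  mono : ∀ {a b a' b'}, M a b → a ≤ a' → b' ≤ b → M a' b'
  disj : ∀ {a b}, E a b → ¬ M a b
  split : ∀ {a b c}, E a c → b < a → c < b → E a b ∨ E b c
  quad : ∀ {a b c d}, E a b → E b c → E c d → E a d → (E a c ↔ E b d)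
  /-- `E` is transitive modulo `M`. -/
  trans : ∀ {a b c}, E a b → E b c → E a c ∨ M a c
  /-- If a step has filled a place of row `a`, then `(a, t)` is not in `M` for any column `t` that still
  contains an empty place. -/
  removed : ∀ {a c e t}, c < a → ¬ E a c → ¬ M a c → E e t → ¬ M a t

/-- `(k, t)` is the greatest of the places of `E`, where a place is greater if its column is smaller,
or if the columns are equal and its row is greater. -/
structure IsGreatestIn {α : Type*} [LinearOrder α] (E : α → α → Prop) (k t : α) : Prop where
  mem : E k t
  le_col : ∀ {a b}, E a b → t ≤ b
  row_le : ∀ {a}, E a t → a ≤ k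

theorem IsGreatestIn.unique {α : Type*} [LinearOrder α] {E : α → α → Prop} {k t k' t' : α}
    (h : IsGreatestIn E k t) (h' : IsGreatestIn E k' t') : k = k' ∧ t = t' := by
  obtain rfl : t = t' := le_antisymm (h.le_col h'.mem) (h'.le_col h.mem)
  exact ⟨le_antisymm (h'.row_le h.mem) (h.row_le h'.mem), rfl⟩

/-- The places of `E` that stay empty after the step at `(k, t)`: the place `(k, t)` and the places
`(k, c)`, `(c, t)`, where both of them are in `E`, are removed. -/
def reduce {α : Type*} (E : α → α → Prop) (k t : α) (a b : α) : Prop :=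
  E a b ∧ ¬ (a = k ∧ b = t) ∧ ¬ (a = k ∧ E b t) ∧ ¬ (b = t ∧ E k a)

theorem reduce_iff_of_ne {α : Type*} {E : α → α → Prop} {k t a b : α} (ha : a ≠ k) (hb : b ≠ t) :
    reduce E k t a b ↔ E a b := by
  simp [reduce, ha, hb]

namespace IsEmptyPattern

variable {α : Type*} [LinearOrder α] {M E : α → α → Prop} {k t : α}

/-- If the filled places form an ideal, their complement has all the properties required. -/
theorem of_compl (hM : ∀ {a b a' b'}, M a b → a ≤ a' → b' ≤ b → M a' b') :
    IsEmptyPattern M (fun a b => b < a ∧ ¬ M a b) where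
  lt h := h.1
  mono := hM
  disj h := h.2
  split {a b c} h h1 h2 := Or.inl ⟨h1, fun h3 => h.2 (hM h3 le_rfl h2.le)⟩
  quad {a b c d} h1 h2 h3 h4 := by
    have h5 : ¬ M a c := fun h => h4.2 (hM h le_rfl h3.1.le)
    have h6 : ¬ M b d := fun h => h4.2 (hM h h1.1.le le_rfl)
    exact ⟨fun _ => ⟨h3.1.trans h2.1, h6⟩, fun _ => ⟨h2.1.trans h1.1, h5⟩⟩
  trans {a b c} h1 h2 := by
    by_cases h : M a c
    · exact Or.inr h
    · exact Or.inl ⟨h2.1.trans h1.1, h⟩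
  removed h1 h2 h3 := absurd ⟨h1, h3⟩ h2

theorem row_iff_col (h : IsEmptyPattern M E) (hg : IsGreatestIn E k t) {a b : α} (h1 : E k a) (h2 : E a b)
    (h3 : E b t) : E k b ↔ E a t :=
  h.quad h1 h2 h3 hg.mem

/-- If `(a, k)` is empty, where `(k, t)` is the greatest empty place, then all places of row `a`
outside of `M` are still empty. -/
theorem row_full (h : IsEmptyPattern M E) (hg : IsGreatestIn E k t) {a c : α} (h1 : E a k)
    (hc : c < a) (hM : ¬ M a c) : E a c := by
  by_contra hE
  have h2 := h.removed hc hE hM hg.mem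
  rcases h.trans h1 hg.mem with h3 | h3
  · exact absurd (hg.row_le h3) (not_le.mpr (h.lt h1))
  · exact h2 h3

theorem mem_pivot_col (h : IsEmptyPattern M E) (hg : IsGreatestIn E k t) {a c : α} (hka : k < a)
    (h1 : E a c) (hck : c < k) (h2 : E c t) : E a k := by
  by_contra hE
  have h3 := h.removed hka hE (fun h' => h.disj h1 (h.mono h' le_rfl hck.le)) hg.mem
  rcases h.trans h1 h2 with h4 | h4
  · exact absurd (hg.row_le h4) (not_le.mpr hka)
  · exact h3 h4

/-- The combinatorial properties are inherited by the set of places left empty by a step. -/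
protected theorem reduce (h : IsEmptyPattern M E) (hg : IsGreatestIn E k t) :
    IsEmptyPattern M (reduce E k t) where
  lt h' := h.lt h'.1
  mono := h.mono
  disj h' := h.disj h'.1
  split {a b c} h' h1 h2 := by
    have hq := @h.row_iff_col _ _ _ _ _ _ hg
    have ht := @hg.le_col
    have hk := @hg.row_le
    have := h.split h'.1 h1 h2
    have := @h.split
    have := @h.mem_pivot_col _ _ _ _ _ _ hg
    have := hg.mem
    unfold reduce at *
    grind
  quad {a b c d} h1 h2 h3 h4 := by
    have hq := @h.row_iff_col _ _ _ _ _ _ hg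
    have ht := @hg.le_col
    have hk := @hg.row_le
    have := h.quad h1.1 h2.1 h3.1 h4.1
    have := hg.mem
    unfold reduce at *
    grind
  trans {a b c} h1 h2 := by
    have hq := @h.row_iff_col _ _ _ _ _ _ hg
    have := h.trans h1.1 h2.1
    have := hg.mem
    unfold reduce at *
    grind
  removed {a c e s} h1 h2 h3 h4 := by
    have ht := hg.le_col h4.1
    intro hM
    by_cases hE : E a c
    · have h5 : E a t → ¬ M a s := fun h6 h7 => h.disj h6 (h.mono h7 le_rfl ht)
      have h8 : a = k → ¬ M a s := fun h6 h7 =>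
        h.disj hg.mem (h.mono h7 h6.le ht)
      unfold reduce at *
      grind
    · exact h.removed h1 hE h3 h4.1 hM

end IsEmptyPattern

/-! ### The reduction of a family of matrix units -/

namespace PoissonBracket

variable {K A : Type*} [Field K] [CommRing A] [Algebra K A] (P : PoissonBracket K A)

theorem leibniz_left (a b c : A) :
    P.bracket (a * b) c = a * P.bracket b c + b * P.bracket a c := by
  rw [P.skew, P.leibniz, P.skew c a, P.skew c b]
  ring

theorem bracket_comm_eq_zero {a b : A} (h : P.bracket a b = 0) : P.bracket b a = 0 := by
  rw [P.skew, h, neg_zero]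

theorem bracket_eq_zero_of_mul_eq_one {x a b : A} (hab : a * b = 1) (h : P.bracket x a = 0) :
    P.bracket x b = 0 := by
  have h1 : P.bracket x (a * b) = 0 := by rw [hab, P.bracket_one]
  rw [P.leibniz, h, zero_mul, zero_add] at h1
  calc P.bracket x b = a * b * P.bracket x b := by rw [hab, one_mul]
    _ = b * (a * P.bracket x b) := by ring
    _ = 0 := by rw [h1, mul_zero]

/-- The Poisson centralizer of a set, as a subalgebra. -/
def centralizer (s : Set A) : Subalgebra K A where
  carrier := {x | ∀ y ∈ s, P.bracket y x = 0}
  mul_mem' := fun ha hb y hy => by rw [P.leibniz, ha y hy, hb y hy]; ring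
  add_mem' := fun ha hb y hy => by rw [map_add, ha y hy, hb y hy, add_zero]
  algebraMap_mem' := fun r y hy => by
    rw [Algebra.algebraMap_eq_smul_one, map_smul, P.bracket_one, smul_zero]

theorem mem_centralizer_singleton {x y : A} : x ∈ P.centralizer {y} ↔ P.bracket y x = 0 :=
  ⟨fun h => h y rfl, fun h z hz => by rw [Set.mem_singleton_iff.mp hz, h]⟩

end PoissonBracket

open Classical in
/-- A family `Y` that is supported on the set `E` of places and satisfies
`{Y_{ab}, Y_{cd}} = δ_{bc} Y_{ad} - δ_{ad} Y_{cb}` for places `(a, b)`, `(c, d)` of `E`. Since `Y`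
vanishes outside of `E`, these are the relations of matrix units modulo the places outside of `E`. -/
structure IsRootFamily {K F α : Type*} [Field K] [Field F] [Algebra K F]
    (P : PoissonBracket K F) (E : α → α → Prop) (Y : α → α → F) : Prop where
  zero : ∀ {a b}, ¬ E a b → Y a b = 0
  law : ∀ {a b c d}, E a b → E c d → P.bracket (Y a b) (Y c d) =
    (if b = c then Y a d else 0) - (if a = d then Y c b else 0)

section

variable {F α : Type*} [Field F]

/-- The element `Y_{ab} - Y_{kb} Y_{at} / Y_{kt}`, a `2 × 2` minor of `Y` divided by `Y_{kt}`. -/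
def minor (Y : α → α → F) (k t a b : α) : F := Y a b - (Y k t)⁻¹ * (Y k b * Y a t)

/-- The element `(1 / Y_{kt}) ∑ e, Y_{ae} Y_{et}`; its term for `e = k` is `Y_{ak}`. -/
def colSum [Fintype α] (Y : α → α → F) (k t a : α) : F := (Y k t)⁻¹ * ∑ e, Y a e * Y e t

end

open Classical in
/-- The family that replaces `Y` after the step at `(k, t)`. On the remaining places of row `k` and of
column `t` nothing changes, column `k` is replaced by `colSum`, and the other elements by `minor`. -/
def reduceFamily {F α : Type*} [Field F] [Fintype α] (E : α → α → Prop) (Y : α → α → F) (k t : α)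
    (a b : α) : F :=
  if reduce E k t a b then
    if a = k ∨ b = t then Y a b
    else if b = k then colSum Y k t a
    else minor Y k t a b
  else 0

namespace IsRootFamily

section

variable {K F α : Type*} [Field K] [Field F] [Algebra K F]
  {P : PoissonBracket K F} {E : α → α → Prop} {Y : α → α → F}

theorem bracket_of_not_left (hY : IsRootFamily P E Y) {a b : α} (h : ¬ E a b) {x : F} :
    P.bracket (Y a b) x = 0 := by
  rw [hY.zero h, map_zero, LinearMap.zero_apply]

theorem bracket_of_not_right (hY : IsRootFamily P E Y) {a b c d : α} (h : ¬ E c d) :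
    P.bracket (Y a b) (Y c d) = 0 := by
  rw [hY.zero h, map_zero]

theorem bracket_of_ne (hY : IsRootFamily P E Y) {a b c d : α} (h1 : b ≠ c) (h2 : a ≠ d) :
    P.bracket (Y a b) (Y c d) = 0 := by
  by_cases ha : E a b
  · by_cases hc : E c d
    · rw [hY.law ha hc, if_neg h1, if_neg h2, sub_zero]
    · exact hY.bracket_of_not_right hc
  · exact hY.bracket_of_not_left ha

end

section

variable {K F α : Type*} [Field K] [Field F] [Algebra K F] [LinearOrder α]
  {P : PoissonBracket K F} {M E : α → α → Prop} {Y : α → α → F} {k t : α}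

theorem bracket_eq (hY : IsRootFamily P E Y) (hE : IsEmptyPattern M E) {a b c : α} (h1 : E a b)
    (h2 : E b c) : P.bracket (Y a b) (Y b c) = Y a c := by
  have : a ≠ c := ((hE.lt h2).trans (hE.lt h1)).ne'
  rw [hY.law h1 h2, if_pos rfl, if_neg this, sub_zero]

theorem bracket_eq' (hY : IsRootFamily P E Y) (hE : IsEmptyPattern M E) {a b c : α} (h1 : E a b)
    (h2 : E b c) : P.bracket (Y b c) (Y a b) = - Y a c := by
  rw [P.skew, hY.bracket_eq hE h1 h2]

/-- The element at the greatest empty place commutes with the family. -/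
theorem bracket_pivot (hY : IsRootFamily P E Y) (hE : IsEmptyPattern M E)
    (hg : IsGreatestIn E k t) (a b : α) : P.bracket (Y a b) (Y k t) = 0 := by
  by_cases h : E a b
  · rw [hY.law h hg.mem]
    have h1 : b = k → Y a t = 0 := fun h1 => hY.zero fun h2 => by
      subst h1
      exact absurd (hg.row_le h2) (not_le.mpr (hE.lt h))
    have h2 : a ≠ t := fun h2 => by
      subst h2
      exact absurd (hg.le_col h) (not_le.mpr (hE.lt h))
    rw [if_neg h2, sub_zero]
    split_ifs with h3
    · exact h1 h3
    · rfl
  · exact hY.bracket_of_not_left h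

theorem bracket_inv_pivot (hY : IsRootFamily P E Y) (hE : IsEmptyPattern M E)
    (hg : IsGreatestIn E k t) (hw : Y k t ≠ 0) (a b : α) : P.bracket (Y a b) (Y k t)⁻¹ = 0 :=
  P.bracket_eq_zero_of_mul_eq_one (mul_inv_cancel₀ hw) (hY.bracket_pivot hE hg a b)

theorem bracket_smul_inv_pivot (hY : IsRootFamily P E Y) (hE : IsEmptyPattern M E)
    (hg : IsGreatestIn E k t) (hw : Y k t ≠ 0) (a b : α) (x : F) :
    P.bracket (Y a b) ((Y k t)⁻¹ * x) = (Y k t)⁻¹ * P.bracket (Y a b) x := by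
  rw [P.leibniz, hY.bracket_inv_pivot hE hg hw, zero_mul, zero_add]

theorem bracket_minor (hY : IsRootFamily P E Y) (hE : IsEmptyPattern M E)
    (hg : IsGreatestIn E k t) (hw : Y k t ≠ 0) (a b c d : α) :
    P.bracket (Y a b) (minor Y k t c d) = P.bracket (Y a b) (Y c d) -
      (Y k t)⁻¹ * (P.bracket (Y a b) (Y k d) * Y c t + Y k d * P.bracket (Y a b) (Y c t)) := by
  rw [minor, map_sub, hY.bracket_smul_inv_pivot hE hg hw, P.leibniz]

theorem bracket_inv_pivot_minor (hY : IsRootFamily P E Y) (hE : IsEmptyPattern M E)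
    (hg : IsGreatestIn E k t) (hw : Y k t ≠ 0) (c d : α) :
    P.bracket (Y k t)⁻¹ (minor Y k t c d) = 0 := by
  have h : ∀ a b, P.bracket (Y k t)⁻¹ (Y a b) = 0 := fun a b =>
    P.bracket_comm_eq_zero (hY.bracket_inv_pivot hE hg hw a b)
  have h2 : P.bracket (Y k t)⁻¹ (Y k t)⁻¹ = 0 :=
    P.bracket_eq_zero_of_mul_eq_one (mul_inv_cancel₀ hw) (h _ _)
  rw [minor, map_sub, P.leibniz, P.leibniz]
  simp [h, h2]

theorem bracket_minor_minor_chain (hY : IsRootFamily P E Y) (hE : IsEmptyPattern M E)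
    (hg : IsGreatestIn E k t) (hw : Y k t ≠ 0) {a b d : α} (hab : E a b) (hbd : E b d)
    (hbk : b ≠ k) (hd : d ≠ t) (hdk : d ≠ k) :
    P.bracket (minor Y k t a b) (minor Y k t b d) = minor Y k t a d := by
  have htd := lt_of_le_of_ne (hg.le_col hbd) hd.symm
  have hdb := hE.lt hbd
  have hba := hE.lt hab
  have hX : ∀ x y, P.bracket (Y x y) (minor Y k t b d) = _ := fun x y =>
    hY.bracket_minor hE hg hw x y b d
  have htk := hE.lt hg.mem
  rw [show minor Y k t a b = Y a b - (Y k t)⁻¹ * (Y k b * Y a t) from rfl, map_sub,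
    LinearMap.sub_apply, P.leibniz_left, P.leibniz_left, hY.bracket_inv_pivot_minor hE hg hw,
    hX, hX, hX]
  rw [hY.bracket_eq hE hab hbd, hY.bracket_of_ne hbk (hdb.trans hba).ne',
    hY.bracket_of_ne (a := k) (c := k) hbk hdk.symm,
    hY.bracket_of_ne (a := a) (d := d) (htd.trans hdb).ne (hdb.trans hba).ne',
    hY.bracket_of_ne (a := a) (b := t) (c := k) (d := d) htk.ne (hdb.trans hba).ne',
    hY.bracket_of_ne (a := a) (b := t) (c := b) (d := t) (htd.trans hdb).ne
      (htd.trans (hdb.trans hba)).ne']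
  have h0 : ¬ E k b → ¬ E b t → Y a t * Y k d = 0 := by
    intro h1 h2
    by_cases h3 : E a t
    · rcases hE.split hg.mem (hba.trans_le (hg.row_le h3)) (htd.trans hdb) with h4 | h4
      · exact absurd h4 h1
      · exact absurd h4 h2
    · rw [hY.zero h3, zero_mul]
  rw [minor]
  by_cases hkb : E k b <;> by_cases hbt : E b t
  · rw [hY.bracket_eq hE hab hbt, hY.bracket_eq hE hkb hbd, hY.bracket_eq hE hkb hbt]
    field_simp
    ring
  · rw [hY.bracket_of_not_right hbt, hY.bracket_eq hE hkb hbd, hY.bracket_of_not_right hbt]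
    ring
  · rw [hY.bracket_eq hE hab hbt, hY.bracket_of_not_left hkb, hY.bracket_of_not_left hkb]
    ring
  · rw [hY.bracket_of_not_right hbt, hY.bracket_of_not_left hkb, hY.bracket_of_not_right hbt]
    linear_combination (Y k t)⁻¹ * h0 hkb hbt

theorem bracket_minor_minor_ne (hY : IsRootFamily P E Y) (hE : IsEmptyPattern M E)
    (hg : IsGreatestIn E k t) (hw : Y k t ≠ 0) {a b c d : α} (hab : E a b) (hcd : E c d)
    (hbk : b ≠ k) (hdk : d ≠ k) (hbc : b ≠ c) (had : a ≠ d) :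
    P.bracket (minor Y k t a b) (minor Y k t c d) = 0 := by
  have htc : t ≠ c := ((hg.le_col hcd).trans_lt (hE.lt hcd)).ne
  have hta : a ≠ t := ((hg.le_col hab).trans_lt (hE.lt hab)).ne'
  have hX : ∀ x y, P.bracket (Y x y) (minor Y k t c d) = _ := fun x y =>
    hY.bracket_minor hE hg hw x y c d
  have htk := hE.lt hg.mem
  rw [show minor Y k t a b = Y a b - (Y k t)⁻¹ * (Y k b * Y a t) from rfl, map_sub,
    LinearMap.sub_apply, P.leibniz_left, P.leibniz_left, hY.bracket_inv_pivot_minor hE hg hw,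
    hX, hX, hX]
  simp [hY.bracket_of_ne, hbk, hdk.symm, hbc, had, htc, hta, htk.ne, htk.ne']

theorem bracket_row_minor (hY : IsRootFamily P E Y) (hE : IsEmptyPattern M E)
    (hg : IsGreatestIn E k t) (hw : Y k t ≠ 0) {b d : α} (hkb : E k b) (hbd : E b d)
    (hbt : ¬ E b t) :
    P.bracket (Y k b) (minor Y k t b d) = Y k d := by
  rw [hY.bracket_minor hE hg hw, hY.bracket_eq hE hkb hbd, hY.zero hbt]
  simp

theorem bracket_row_minor_ne (hY : IsRootFamily P E Y) (hE : IsEmptyPattern M E)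
    (hg : IsGreatestIn E k t) (hw : Y k t ≠ 0) {b c d : α} (hbk : b ≠ k) (hdk : d ≠ k)
    (hbc : b ≠ c) :
    P.bracket (Y k b) (minor Y k t c d) = 0 := by
  have htk := hE.lt hg.mem
  rw [hY.bracket_minor hE hg hw]
  simp [hY.bracket_of_ne, hbk, hdk.symm, hbc, htk.ne']

theorem bracket_col_minor_ne (hY : IsRootFamily P E Y) (hE : IsEmptyPattern M E)
    (hg : IsGreatestIn E k t) (hw : Y k t ≠ 0) {a c d : α} (hat : a ≠ t) (htc : t ≠ c)
    (had : a ≠ d) :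
    P.bracket (Y a t) (minor Y k t c d) = 0 := by
  have htk := hE.lt hg.mem
  rw [hY.bracket_minor hE hg hw]
  simp [hY.bracket_of_ne, hat, htc, had, htk.ne]

theorem bracket_col_minor (hY : IsRootFamily P E Y) (hE : IsEmptyPattern M E)
    (hg : IsGreatestIn E k t) (hw : Y k t ≠ 0) {a b : α} (hab : E a b) (hbt : E b t)
    (hkb : ¬ E k b) :
    P.bracket (minor Y k t a b) (Y b t) = Y a t := by
  rw [P.skew, hY.bracket_minor hE hg hw, hY.bracket_of_not_right hkb, hY.zero hkb,
    hY.bracket_eq' hE hab hbt]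
  simp

theorem bracket_pair_minor (hY : IsRootFamily P E Y) (hE : IsEmptyPattern M E)
    (hg : IsGreatestIn E k t) (hw : Y k t ≠ 0) {c : α} (hkc : E k c) (hct : E c t) {a b : α}
    (hab : E a b) (hbk : b ≠ k) :
    P.bracket (Y k c) (minor Y k t a b) = 0 ∧ P.bracket (Y c t) (minor Y k t a b) = 0 := by
  have htc := hE.lt hct
  have hck := hE.lt hkc
  have hta : t ≠ a := ((hg.le_col hab).trans_lt (hE.lt hab)).ne
  constructor
  · by_cases hac : c = a
    · subst hac
      rw [hY.bracket_minor hE hg hw, hY.bracket_eq hE hkc hab, hY.bracket_eq hE hkc hct,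
        hY.bracket_of_ne hck.ne hbk.symm]
      field_simp
      ring
    · exact hY.bracket_row_minor_ne hE hg hw hck.ne hbk hac
  · by_cases hbc : c = b
    · subst hbc
      rw [hY.bracket_minor hE hg hw, hY.bracket_eq' hE hab hct, hY.bracket_eq' hE hkc hct,
        hY.bracket_of_ne hta htc.ne']
      field_simp
      ring
    · exact hY.bracket_col_minor_ne hE hg hw htc.ne' hta hbc

theorem not_col_of_lt (hE : IsEmptyPattern M E) (hg : IsGreatestIn E k t) {a : α} (h : E a k) :
    ¬ E a t := fun h' => absurd (hg.row_le h') (not_le.mpr (hE.lt h))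

variable [Fintype α]

theorem bracket_colSum (hY : IsRootFamily P E Y) (hE : IsEmptyPattern M E)
    (hg : IsGreatestIn E k t) (hw : Y k t ≠ 0) (a b c : α) :
    P.bracket (Y a b) (colSum Y k t c) =
      (Y k t)⁻¹ * ∑ e, (P.bracket (Y a b) (Y c e) * Y e t + Y c e * P.bracket (Y a b) (Y e t)) := by
  rw [colSum, hY.bracket_smul_inv_pivot hE hg hw, map_sum]
  simp only [P.leibniz]

theorem bracket_inv_pivot_colSum (hY : IsRootFamily P E Y) (hE : IsEmptyPattern M E)
    (hg : IsGreatestIn E k t) (hw : Y k t ≠ 0) (c : α) :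
    P.bracket (Y k t)⁻¹ (colSum Y k t c) = 0 := by
  have h : ∀ a b, P.bracket (Y k t)⁻¹ (Y a b) = 0 := fun a b =>
    P.bracket_comm_eq_zero (hY.bracket_inv_pivot hE hg hw a b)
  have h2 : P.bracket (Y k t)⁻¹ (Y k t)⁻¹ = 0 :=
    P.bracket_eq_zero_of_mul_eq_one (mul_inv_cancel₀ hw) (h _ _)
  rw [colSum, P.leibniz, map_sum]
  simp only [P.leibniz]
  simp [h, h2]

theorem bracket_row_colSum (hY : IsRootFamily P E Y) (hE : IsEmptyPattern M E)
    (hg : IsGreatestIn E k t) (hw : Y k t ≠ 0) {a d : α} (hak : E a k) (hkd : E k d)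
    (hdt : ¬ E d t) :
    P.bracket (colSum Y k t a) (Y k d) = Y a d := by
  have htk := hE.lt hg.mem
  have hdk := hE.lt hkd
  have hka := hE.lt hak
  rw [P.skew, hY.bracket_colSum hE hg hw, Finset.sum_eq_single k]
  · rw [hY.bracket_eq' hE hak hkd, hY.bracket_of_ne hdk.ne htk.ne']
    field_simp
    ring
  · intro e _ hek
    rw [hY.bracket_of_ne (hdk.trans hka).ne hek.symm, zero_mul, zero_add]
    by_cases hde : d = e
    · rw [hY.bracket_of_not_right (hde ▸ hdt), mul_zero]
    · rw [hY.bracket_of_ne hde htk.ne', mul_zero]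
  · simp

theorem bracket_colSum_row (hY : IsRootFamily P E Y) (hE : IsEmptyPattern M E)
    (hg : IsGreatestIn E k t) (hw : Y k t ≠ 0) {a b : α} (hab : E a b) (hbk : E b k) :
    P.bracket (Y a b) (colSum Y k t b) = colSum Y k t a := by
  rw [hY.bracket_colSum hE hg hw, colSum]
  congr 1
  refine Finset.sum_congr rfl fun e _ => ?_
  have hkb := hE.lt hbk
  have hba := hE.lt hab
  have htk := hE.lt hg.mem
  have hz : Y a e * Y e t = P.bracket (Y a b) (Y b e) * Y e t := by
    by_cases hbe : E b e
    · rw [hY.bracket_eq hE hab hbe]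
    · rw [hY.bracket_of_not_right hbe, zero_mul]
      by_cases het : E e t
      · have heb := (hg.row_le het).trans_lt hkb
        by_cases hM : M b e
        · rw [hY.zero fun h => hE.disj h (hE.mono hM hba.le le_rfl), zero_mul]
        · exact absurd (hE.row_full hg hbk heb hM) hbe
      · rw [hY.zero het, mul_zero]
  rw [hz, add_eq_left]
  by_cases hbe : b = e
  · rw [hY.zero (a := b) fun h => (hE.lt h).ne hbe.symm, zero_mul]
  · rw [hY.bracket_of_ne hbe (htk.trans (hkb.trans hba)).ne', mul_zero]

theorem colSum_eq_zero (hY : IsRootFamily P E Y) (hE : IsEmptyPattern M E)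
    (hg : IsGreatestIn E k t) {a b : α} (hab : E a b) (hbk : E b k) (hak : ¬ E a k) :
    colSum Y k t a = 0 := by
  rw [colSum, Finset.sum_eq_zero, mul_zero]
  intro e _
  by_cases hae : E a e
  · by_cases het : E e t
    · rcases hE.trans hab hbk with h | h
      · exact absurd h hak
      · exact absurd (hE.mono h le_rfl (hg.row_le het)) (hE.disj hae)
    · rw [hY.zero het, mul_zero]
  · rw [hY.zero hae, zero_mul]

theorem bracket_col_colSum (hY : IsRootFamily P E Y) (hE : IsEmptyPattern M E)
    (hg : IsGreatestIn E k t) (hw : Y k t ≠ 0) {a c : α} (hta : a ≠ t) (hck : E c k) :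
    P.bracket (Y a t) (colSum Y k t c) = 0 := by
  have htk := hE.lt hg.mem
  have hct : t ≠ c := (htk.trans (hE.lt hck)).ne
  rw [hY.bracket_colSum hE hg hw, Finset.sum_eq_zero, mul_zero]
  intro e _
  have h1 : P.bracket (Y a t) (Y e t) = 0 := by
    by_cases hte : t = e
    · exact hY.bracket_of_not_right fun h => (hE.lt h).ne hte
    · exact hY.bracket_of_ne hte hta
  have h2 : P.bracket (Y a t) (Y c e) = 0 := by
    by_cases hae : a = e
    · subst hae
      by_cases h3 : E c a
      · by_cases h4 : E a t
        · rw [hY.bracket_eq' hE h3 h4, hY.zero (not_col_of_lt hE hg hck), neg_zero]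
        · exact hY.bracket_of_not_left h4
      · exact hY.bracket_of_not_right h3
    · exact hY.bracket_of_ne hct hae
  rw [h1, h2]
  ring

theorem bracket_colSum_colSum (hY : IsRootFamily P E Y) (hE : IsEmptyPattern M E)
    (hg : IsGreatestIn E k t) (hw : Y k t ≠ 0) {a c : α} (hak : E a k) (hck : E c k) :
    P.bracket (colSum Y k t a) (colSum Y k t c) = 0 := by
  have htk := hE.lt hg.mem
  have hc := not_col_of_lt hE hg hck
  have hct : t ≠ c := (htk.trans (hE.lt hck)).ne
  have ha := not_col_of_lt hE hg hak
  have hat : a ≠ t := (htk.trans (hE.lt hak)).ne'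
  have h1 : ∀ e, P.bracket (Y e t) (colSum Y k t c) = 0 := by
    intro e
    by_cases het : e = t
    · rw [hY.zero fun h => (hE.lt h).ne het.symm, map_zero, LinearMap.zero_apply]
    · exact hY.bracket_col_colSum hE hg hw het hck
  rw [show colSum Y k t a = (Y k t)⁻¹ * ∑ e, Y a e * Y e t from rfl, P.leibniz_left,
    hY.bracket_inv_pivot_colSum hE hg hw, mul_zero, add_zero, map_sum, LinearMap.sum_apply,
    Finset.sum_eq_zero, mul_zero]
  intro e _
  rw [P.leibniz_left, h1, mul_zero, zero_add]
  by_cases het : E e t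
  swap
  · rw [hY.zero het, zero_mul]
  rw [hY.bracket_colSum hE hg hw, Finset.sum_eq_zero, mul_zero, mul_zero]
  intro f _
  have hec : e ≠ c := fun h => hc (h ▸ het)
  by_cases hft : E f t
  · have hfa : f ≠ a := fun h => ha (h ▸ hft)
    rw [hY.bracket_of_ne hec hfa.symm, zero_mul, zero_add]
    by_cases hef : e = f
    · subst hef
      by_cases hae : E a e
      · rw [hY.bracket_eq hE hae hft, hY.zero ha, mul_zero]
      · rw [hY.bracket_of_not_left hae, mul_zero]
    · rw [hY.bracket_of_ne hef hat, mul_zero]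
  · rw [hY.zero hft, mul_zero, zero_add, map_zero, mul_zero]

theorem bracket_colSum_minor_ne (hY : IsRootFamily P E Y) (hE : IsEmptyPattern M E)
    (hg : IsGreatestIn E k t) (hw : Y k t ≠ 0) {a c d : α} (hak : E a k) (hcd : E c d)
    (hck : c ≠ k) (hdt : d ≠ t) (hdk : d ≠ k) (had : a ≠ d) :
    P.bracket (colSum Y k t a) (minor Y k t c d) = 0 := by
  classical
  have htk := hE.lt hg.mem
  have hka := hE.lt hak
  have hdc := hE.lt hcd
  have ha := not_col_of_lt hE hg hak
  have hat : a ≠ t := (htk.trans hka).ne'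
  have htd := lt_of_le_of_ne (hg.le_col hcd) hdt.symm
  have htc : t ≠ c := (htd.trans hdc).ne
  rw [show colSum Y k t a = (Y k t)⁻¹ * ∑ e, Y a e * Y e t from rfl, P.leibniz_left,
    hY.bracket_inv_pivot_minor hE hg hw, mul_zero, add_zero, map_sum, LinearMap.sum_apply]
  -- The bracket of `∑ e, Y_{ae} Y_{et}` with the minor has two sums; each has at most two terms that
  -- do not vanish.
  have hA : ∀ e, Y a e * P.bracket (Y e t) (minor Y k t c d) =
      if e = d then (if E k d then 0 else if E d t then -(Y a d * Y c t) else 0) else 0 := by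
    intro e
    by_cases het : E e t
    · have hte := (hE.lt het).ne'
      by_cases hed : e = d
      · subst hed
        rw [if_pos rfl, if_pos het, hY.bracket_minor hE hg hw, hY.bracket_eq' hE hcd het,
          hY.bracket_of_ne (c := c) (d := t) htc hte]
        split_ifs with hke
        · rw [hY.bracket_eq' hE hke het]
          field_simp
          ring
        · rw [hY.bracket_of_not_right hke]
          ring
      · rw [if_neg hed, hY.bracket_col_minor_ne hE hg hw hte htc hed, mul_zero]
    · rw [hY.bracket_of_not_left het]
      split_ifs with h1 h2 h3
      · simp
      · exact absurd (h1 ▸ h3) het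
      · simp
      · simp
  have hB : ∀ e, Y e t * P.bracket (Y a e) (minor Y k t c d) =
      (if e = c then Y a d * Y c t else 0) -
        (if e = k then (if E k d then Y a d * Y c t else 0) else 0) := by
    intro e
    rw [hY.bracket_minor hE hg hw]
    by_cases hec : e = c
    · subst hec
      have h1 : Y k d * P.bracket (Y a e) (Y e t) = 0 := by
        by_cases hae : E a e
        · by_cases het : E e t
          · rw [hY.bracket_eq hE hae het, hY.zero ha, mul_zero]
          · rw [hY.bracket_of_not_right het, mul_zero]
        · rw [hY.bracket_of_not_left hae, mul_zero]
      have h2 : Y e t * P.bracket (Y a e) (Y e d) = Y a d * Y e t := by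
        by_cases hae : E a e
        · rw [hY.bracket_eq hE hae hcd, mul_comm]
        · rw [hY.bracket_of_not_left hae, mul_zero]
          by_cases het : E e t
          · by_cases had' : E a d
            · refine absurd (hE.row_full hg hak ((hg.row_le het).trans_lt hka) ?_) hae
              exact fun h => hE.disj had' (hE.mono h le_rfl hdc.le)
            · rw [hY.zero had', zero_mul]
          · rw [hY.zero het, mul_zero]
      rw [if_pos rfl, if_neg hck, hY.bracket_of_ne (c := k) hck had, h1]
      linear_combination h2
    · rw [hY.bracket_of_ne hec had, hY.bracket_of_ne hec hat, if_neg hec]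
      by_cases hek : e = k
      · subst hek
        rw [if_pos rfl]
        split_ifs with hkd
        · rw [hY.bracket_eq hE hak hkd]
          field_simp
          ring
        · rw [hY.bracket_of_not_right hkd]
          ring
      · rw [hY.bracket_of_ne hek had, if_neg hek]
        ring
  -- If `(c, t)` is empty, then `d < c ≤ k`, so one of the places `(k, d)`, `(d, t)` is empty.
  have hX : ¬ E k d → ¬ E d t → Y a d * Y c t = 0 := by
    intro h1 h2
    by_cases hct : E c t
    · rcases hE.split hg.mem (hdc.trans_le (hg.row_le hct)) htd with h | h
      · exact absurd h h1
      · exact absurd h h2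
    · rw [hY.zero hct, mul_zero]
  simp only [P.leibniz_left, hA, hB, Finset.sum_add_distrib, Finset.sum_sub_distrib,
    Finset.sum_ite_eq', Finset.mem_univ, if_true]
  split_ifs with h1 h2
  · ring
  · ring
  · rw [hX h1 h2]
    ring

theorem bracket_pair_colSum (hY : IsRootFamily P E Y) (hE : IsEmptyPattern M E)
    (hg : IsGreatestIn E k t) (hw : Y k t ≠ 0) {c : α} (hkc : E k c) (hct : E c t) {a : α}
    (hak : E a k) : P.bracket (Y k c) (colSum Y k t a) = 0 := by
  classical
  have htc := hE.lt hct
  have hck := hE.lt hkc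
  have hka := hE.lt hak
  rw [hY.bracket_colSum hE hg hw]
  have key : ∀ e, P.bracket (Y k c) (Y a e) * Y e t + Y a e * P.bracket (Y k c) (Y e t) =
      (if e = c then Y a c * Y k t else 0) - (if e = k then Y a c * Y k t else 0) := by
    intro e
    have h1 : P.bracket (Y k c) (Y a e) * Y e t = -(if e = k then Y a c * Y k t else 0) := by
      split_ifs with hek
      · subst hek
        rw [hY.bracket_eq' hE hak hkc, neg_mul]
      · rw [hY.bracket_of_ne (hck.trans hka).ne (Ne.symm hek), zero_mul, neg_zero]
    have h2 : Y a e * P.bracket (Y k c) (Y e t) = if e = c then Y a c * Y k t else 0 := by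
      split_ifs with hec
      · subst hec
        rw [hY.bracket_eq hE hkc hct]
      · rw [hY.bracket_of_ne (Ne.symm hec) (htc.trans hck).ne', mul_zero]
    rw [h1, h2]
    ring
  simp [key, Finset.sum_sub_distrib]

/-- The reduced family commutes with the elements of the pairs that are split off. -/
theorem bracket_pair_reduceFamily (hY : IsRootFamily P E Y) (hE : IsEmptyPattern M E)
    (hg : IsGreatestIn E k t) (hw : Y k t ≠ 0) {c : α} (hkc : E k c) (hct : E c t) (a b : α) :
    P.bracket (Y k c) (reduceFamily E Y k t a b) = 0 ∧
      P.bracket (Y c t) (reduceFamily E Y k t a b) = 0 := by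
  have htc := hE.lt hct
  have hck := hE.lt hkc
  unfold reduceFamily
  split_ifs with hr h1 h2
  · obtain ⟨hab, h3, h4, h5⟩ := hr
    rcases h1 with rfl | rfl
    · exact ⟨hY.bracket_of_ne hck.ne (hE.lt hab).ne',
        hY.bracket_of_ne (htc.trans hck).ne fun h => h4 ⟨rfl, h ▸ hct⟩⟩
    · exact ⟨hY.bracket_of_ne (fun h => h5 ⟨rfl, h ▸ hkc⟩) (htc.trans hck).ne',
        hY.bracket_of_ne (hE.lt hab).ne htc.ne'⟩
  · subst h2
    exact ⟨hY.bracket_pair_colSum hE hg hw hkc hct hr.1,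
      hY.bracket_col_colSum hE hg hw htc.ne' hr.1⟩
  · exact hY.bracket_pair_minor hE hg hw hkc hct hr.1 h2
  · simp

omit [LinearOrder α] in
theorem reduceFamily_of_ne {a b : α} (ha : a ≠ k) (hb : b ≠ t)
    (hbk : b ≠ k) (h : E a b ∨ minor Y k t a b = 0) :
    reduceFamily E Y k t a b = minor Y k t a b := by
  unfold reduceFamily
  rw [reduce_iff_of_ne ha hb]
  simp only [ha, hb, hbk, or_self, if_false]
  split_ifs with h1
  · rfl
  · exact (h.resolve_left h1).symm

/-- The relation `{Y_{ab}, Y_{bc}} = Y_{ac}` for the reduced family. If the place `(a, c)` has been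
removed, the bracket vanishes. -/
theorem bracket_reduceFamily_chain (hY : IsRootFamily P E Y) (hE : IsEmptyPattern M E)
    (hg : IsGreatestIn E k t) (hw : Y k t ≠ 0) {a b c : α} (hab : reduce E k t a b)
    (hbc : reduce E k t b c) :
    P.bracket (reduceFamily E Y k t a b) (reduceFamily E Y k t b c) =
      reduceFamily E Y k t a c := by
  have htk := hE.lt hg.mem
  have hba := hE.lt hab.1
  have hcb := hE.lt hbc.1
  have htb : b ≠ t := ((hg.le_col hbc.1).trans_lt hcb).ne'
  have hq := @hE.row_iff_col _ _ _ _ _ _ hg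
  have hminor : a ≠ k → c ≠ t → c ≠ k → (E k c → E a t → E a c) →
      reduceFamily E Y k t a c = minor Y k t a c := by
    intro h1 h2 h3 h4
    refine reduceFamily_of_ne h1 h2 h3 ?_
    by_cases h5 : E a c
    · exact Or.inl h5
    · right
      rw [minor, hY.zero h5]
      by_cases h6 : E k c
      · rw [hY.zero (b := t) fun h7 => h5 (h4 h6 h7)]
        ring
      · rw [hY.zero h6]
        ring
  by_cases hak : a = k
  · subst hak
    have hbt : ¬ E b t := fun h => hab.2.2.1 ⟨rfl, h⟩
    have hct : c ≠ t := fun h => hbt (h ▸ hbc.1)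
    have hbk : b ≠ a := hba.ne
    have hck : c ≠ a := (hcb.trans hba).ne
    have e1 : reduceFamily E Y a t a b = Y a b := by simp [reduceFamily, hab]
    have e2 : reduceFamily E Y a t b c = minor Y a t b c := by
      simp [reduceFamily, hbc, hbk, hct, hck]
    have e3 : reduceFamily E Y a t a c = Y a c := by
      have : reduce E a t a c ↔ E a c := by
        constructor
        · exact fun h => h.1
        · intro h
          refine ⟨h, fun h' => hct h'.2, fun h' => ?_, fun h' => hct h'.1⟩
          exact hbt ((hq hab.1 hbc.1 h'.2).mp h)
      by_cases h : E a c
      · simp [reduceFamily, this, h]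
      · simp [reduceFamily, this, h, hY.zero h]
    rw [e1, e2, e3, hY.bracket_row_minor hE hg hw hab.1 hbc.1 hbt]
  by_cases hbk : b = k
  · subst hbk
    have hct : c ≠ t := fun h => hbc.2.1 ⟨rfl, h⟩
    have hct' : ¬ E c t := fun h => hbc.2.2.1 ⟨rfl, h⟩
    have hat := not_col_of_lt hE hg hab.1
    have e1 : reduceFamily E Y b t a b = colSum Y b t a := by
      simp [reduceFamily, hab, hak, htb]
    have e2 : reduceFamily E Y b t b c = Y b c := by simp [reduceFamily, hbc]
    have e3 : reduceFamily E Y b t a c = Y a c := by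
      rw [hminor hak hct hcb.ne fun _ h => absurd h hat, minor, hY.zero hat]
      ring
    rw [e1, e2, e3, hY.bracket_row_colSum hE hg hw hab.1 hbc.1 hct']
  have e1 : reduceFamily E Y k t a b = minor Y k t a b := by
    simp [reduceFamily, hab, hak, htb, hbk]
  rw [e1]
  by_cases hct : c = t
  · subst hct
    have hkb : ¬ E k b := fun h => hbc.2.2.2 ⟨rfl, h⟩
    have e2 : reduceFamily E Y k c b c = Y b c := by simp [reduceFamily, hbc]
    have e3 : reduceFamily E Y k c a c = Y a c := by
      by_cases h : E a c
      · have : reduce E k c a c := ⟨h, fun h' => hak h'.1, fun h' => hak h'.1,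
          fun h' => hkb ((hq h'.2 hab.1 hbc.1).mpr h)⟩
        simp [reduceFamily, this]
      · simp [reduceFamily, reduce, h, hY.zero h]
    rw [e2, e3, hY.bracket_col_minor hE hg hw hab.1 hbc.1 hkb]
  by_cases hck : c = k
  · subst hck
    have hat : ¬ E a t := fun h => absurd (hg.row_le h) (not_le.mpr (hcb.trans hba))
    have e2 : reduceFamily E Y c t b c = colSum Y c t b := by
      simp [reduceFamily, hbc, hbk, hct]
    have e3 : reduceFamily E Y c t a c = colSum Y c t a := by
      by_cases h : E a c
      · simp [reduceFamily, reduce_iff_of_ne hak hct, h, hak, hct]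
      · simp [reduceFamily, reduce_iff_of_ne hak hct, h,
          hY.colSum_eq_zero hE hg hab.1 hbc.1 h]
    have e4 : minor Y c t a b = Y a b := by
      rw [minor, hY.zero hat]
      ring
    rw [e2, e3, e4, hY.bracket_colSum_row hE hg hw hab.1 hbc.1]
  · have e2 : reduceFamily E Y k t b c = minor Y k t b c := by
      simp [reduceFamily, hbc, hbk, hct, hck]
    rw [e2, hminor hak hct hck, hY.bracket_minor_minor_chain hE hg hw hab.1 hbc.1 hbk hct hck]
    intro _ hat
    rcases hE.trans hab.1 hbc.1 with h | h
    · exact h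
    · exact absurd (hE.mono h le_rfl (hg.le_col hbc.1)) (hE.disj hat)

theorem bracket_reduceFamily_ne (hY : IsRootFamily P E Y) (hE : IsEmptyPattern M E)
    (hg : IsGreatestIn E k t) (hw : Y k t ≠ 0) {a b c d : α} (hab : reduce E k t a b)
    (hcd : reduce E k t c d) (hbc : b ≠ c) (had : a ≠ d) :
    P.bracket (reduceFamily E Y k t a b) (reduceFamily E Y k t c d) = 0 := by
  have htk := hE.lt hg.mem
  have hba := hE.lt hab.1
  have hdc := hE.lt hcd.1
  have htb : t ≠ a := ((hg.le_col hab.1).trans_lt hba).ne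
  have htc : t ≠ c := ((hg.le_col hcd.1).trans_lt hdc).ne
  unfold reduceFamily
  rw [if_pos hab, if_pos hcd]
  split_ifs with h1 h2 h3 h4 h5 h6 h7 h8
  · exact hY.bracket_of_ne hbc had
  · subst h3
    rcases h1 with h1 | h1
    · exact absurd h1 had
    · subst h1
      exact hY.bracket_col_colSum hE hg hw htb.symm hcd.1
  · rcases h1 with h1 | h1
    · subst h1
      exact hY.bracket_row_minor_ne hE hg hw hba.ne h3 hbc
    · subst h1
      exact hY.bracket_col_minor_ne hE hg hw htb.symm htc had
  · subst h4
    apply P.bracket_comm_eq_zero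
    rcases h5 with h5 | h5
    · exact absurd h5.symm hbc
    · subst h5
      exact hY.bracket_col_colSum hE hg hw htc.symm hab.1
  · subst h4 h6
    exact hY.bracket_colSum_colSum hE hg hw hab.1 hcd.1
  · subst h4
    rw [not_or] at h5
    exact hY.bracket_colSum_minor_ne hE hg hw hab.1 hcd.1 h5.1 h5.2 h6 had
  · apply P.bracket_comm_eq_zero
    rcases h7 with h5 | h5
    · subst h5
      exact hY.bracket_row_minor_ne hE hg hw hdc.ne h4 had.symm
    · subst h5
      exact hY.bracket_col_minor_ne hE hg hw htc.symm htb hbc.symm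
  · subst h8
    rw [not_or] at h1
    exact P.bracket_comm_eq_zero
      (hY.bracket_colSum_minor_ne hE hg hw hcd.1 hab.1 h1.1 h1.2 h4 hbc.symm)
  · exact hY.bracket_minor_minor_ne hE hg hw hab.1 hcd.1 h4 h8 hbc had

/-- The reduced family satisfies the relations of matrix units on the places left empty. -/
protected theorem reduce (hY : IsRootFamily P E Y) (hE : IsEmptyPattern M E)
    (hg : IsGreatestIn E k t) (hw : Y k t ≠ 0) :
    IsRootFamily P (reduce E k t) (reduceFamily E Y k t) where
  zero h := by rw [reduceFamily, if_neg h]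
  law {a b c d} hab hcd := by
    have hba := hE.lt hab.1
    have hdc := hE.lt hcd.1
    by_cases hbc : b = c
    · subst hbc
      rw [hY.bracket_reduceFamily_chain hE hg hw hab hcd, if_pos rfl,
        if_neg (hdc.trans hba).ne', sub_zero]
    · by_cases had : a = d
      · subst had
        rw [P.skew, hY.bracket_reduceFamily_chain hE hg hw hcd hab, if_pos rfl, if_neg hbc,
          zero_sub]
      · rw [hY.bracket_reduceFamily_ne hE hg hw hab hcd hbc had, if_neg hbc, if_neg had, sub_zero]

end

end IsRootFamily

/-! ### The state of the reduction -/

namespace PoissonBracket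

theorem bracket_eq_zero_of_fractionRing {K R F : Type*} [Field K] [CommRing R] [Nontrivial R] [Field F]
    [Algebra K F] [Algebra R F] [IsFractionRing R F] (P : PoissonBracket K F) {c : F}
    (h : ∀ r : R, P.bracket c (algebraMap R F r) = 0) (x : F) : P.bracket c x = 0 := by
  obtain ⟨a, b, hb, rfl⟩ := IsFractionRing.div_surjective (A := R) x
  have hb' : algebraMap R F b ≠ 0 := IsFractionRing.to_map_ne_zero_of_mem_nonZeroDivisors hb
  rw [div_eq_mul_inv, P.leibniz, h,
    P.bracket_eq_zero_of_mul_eq_one (mul_inv_cancel₀ hb') (h b)]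
  ring

end PoissonBracket

section ReduceFamilyMem

variable {K F α : Type*} [Field K] [Field F] [Algebra K F] [LinearOrder α] [Fintype α]
  {E : α → α → Prop} {Y : α → α → F} {k t : α}

theorem reduceFamily_mem {S : Subalgebra K F} (hY : ∀ a b, Y a b ∈ S) (hw : (Y k t)⁻¹ ∈ S)
    (a b : α) : reduceFamily E Y k t a b ∈ S := by
  unfold reduceFamily
  split_ifs
  · exact hY _ _
  · exact mul_mem hw (sum_mem fun e _ => mul_mem (hY _ _) (hY _ _))
  · exact sub_mem (hY _ _) (mul_mem hw (mul_mem (hY _ _) (hY _ _)))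
  · exact zero_mem _

omit [LinearOrder α] in
theorem colSum_sub (hw : Y k t ≠ 0) (a : α) [DecidableEq α] :
    colSum Y k t a - Y a k = (Y k t)⁻¹ * ∑ e ∈ Finset.univ.erase k, Y a e * Y e t := by
  rw [colSum, ← Finset.add_sum_erase _ _ (Finset.mem_univ k)]
  field_simp
  ring

theorem family_mem_of_reduceFamily_mem {P : PoissonBracket K F} {M : α → α → Prop}
    (hY : IsRootFamily P E Y) (hE : IsEmptyPattern M E)
    (hg : IsGreatestIn E k t) (hw : Y k t ≠ 0) {S : Subalgebra K F} (h1 : Y k t ∈ S)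
    (h2 : (Y k t)⁻¹ ∈ S) (h3 : ∀ c, E k c → E c t → Y k c ∈ S ∧ Y c t ∈ S)
    (h4 : ∀ a b, reduceFamily E Y k t a b ∈ S) (a b : α) : Y a b ∈ S := by
  classical
  -- Row `k` and column `t` are needed to recover the minors, and all other columns to recover
  -- column `k`.
  have hrow : ∀ b, Y k b ∈ S := by
    intro b
    by_cases hkb : E k b
    · by_cases hb : b = t
      · exact hb ▸ h1
      · by_cases hbt : E b t
        · exact (h3 b hkb hbt).1
        · have := h4 k b
          rwa [reduceFamily, if_pos, if_pos (Or.inl rfl)] at this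
          exact ⟨hkb, fun h => hb h.2, fun h => hbt h.2, fun h => hb h.1⟩
    · rw [hY.zero hkb]
      exact zero_mem _
  have hcol : ∀ a, Y a t ∈ S := by
    intro a
    by_cases hat : E a t
    · by_cases ha : a = k
      · exact ha ▸ h1
      · by_cases hka : E k a
        · exact (h3 a hka hat).2
        · have := h4 a t
          rwa [reduceFamily, if_pos, if_pos (Or.inr rfl)] at this
          exact ⟨hat, fun h => ha h.1, fun h => ha h.1, fun h => hka h.2⟩
    · rw [hY.zero hat]
      exact zero_mem _
  have hmin : ∀ a b, b ≠ k → Y a b ∈ S := by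
    intro a b hbk
    by_cases ha : a = k
    · exact ha ▸ hrow b
    by_cases hb : b = t
    · exact hb ▸ hcol a
    by_cases hab : E a b
    · have := h4 a b
      rw [IsRootFamily.reduceFamily_of_ne ha hb hbk (Or.inl hab), minor] at this
      have h5 := add_mem this (mul_mem h2 (mul_mem (hrow b) (hcol a)))
      rwa [sub_add_cancel] at h5
    · rw [hY.zero hab]
      exact zero_mem _
  by_cases hbk : b = k
  · subst hbk
    by_cases hab : E a b
    · have ha : a ≠ b := (hE.lt hab).ne'
      have hb : b ≠ t := (hE.lt hg.mem).ne'
      have := h4 a b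
      rw [reduceFamily, if_pos ((reduce_iff_of_ne ha hb).mpr hab), if_neg (by simp [ha, hb]),
        if_pos rfl] at this
      have h5 : ∑ e ∈ Finset.univ.erase b, Y a e * Y e t ∈ S :=
        sum_mem fun e he => mul_mem (hmin a e (Finset.ne_of_mem_erase he)) (hcol e)
      have h6 := sub_mem this (mul_mem h2 h5)
      rwa [← colSum_sub hw, sub_sub_cancel] at h6
    · rw [hY.zero hab]
      exact zero_mem _
  · exact hmin a b hbk

end ReduceFamilyMem

section State

variable (K : Type*) {R F : Type*} {α : Type} [Field K] [CommRing R] [Algebra K R] [Field F]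
  [Algebra K F] [Algebra R F] [IsScalarTower K R F] [LinearOrder α]

/-- The algebra of polynomials in the variables `y_{cd}` at the places greater than `(a, b)`. -/
def above (y : α → α → R) (a b : α) : Subalgebra K R :=
  Algebra.adjoin K {x | ∃ c d, d < c ∧ (d < b ∨ d = b ∧ a < c) ∧ x = y c d}

variable (F) in
/-- The subalgebra of `F` generated by the image of `S` and the inverses of `z_0, …, z_{i-1}`. -/
def locAlg (S : Subalgebra K R) (z : ℕ → R) (i : ℕ) : Subalgebra K F :=
  Algebra.adjoin K (algebraMap R F '' S ∪ {x | ∃ j < i, x = (algebraMap R F (z j))⁻¹})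

/-- The subalgebra of `F` generated by `z_j` and `z_j⁻¹` for `j < i`, by `p` and `q`, and by the
family `Y`. -/
def genAlg {ι : Type} (z : ℕ → R) (i : ℕ) (p q : ι → F) (Y : α → α → F) : Subalgebra K F :=
  Algebra.adjoin K ({x | ∃ j < i, x = algebraMap R F (z j) ∨ x = (algebraMap R F (z j))⁻¹} ∪
    Set.range p ∪ Set.range q ∪ {x | ∃ a b, x = Y a b})

variable {K}

theorem above_mono (y : α → α → R) {a b a' b' : α} (h : b < b' ∨ b = b' ∧ a' ≤ a) :
    above K y a b ≤ above K y a' b' := by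
  apply Algebra.adjoin_mono
  rintro x ⟨c, d, hdc, h1, rfl⟩
  refine ⟨c, d, hdc, ?_, rfl⟩
  rcases h with h | ⟨rfl, h⟩
  · rcases h1 with h1 | h1
    · exact Or.inl (h1.trans h)
    · exact Or.inl (h1.1.trans_lt h)
  · rcases h1 with h1 | h1
    · exact Or.inl h1
    · exact Or.inr ⟨h1.1, h.trans_lt h1.2⟩

theorem mem_above (y : α → α → R) {a b c d : α} (hdc : d < c) (h : d < b ∨ d = b ∧ a < c) :
    y c d ∈ above K y a b := Algebra.subset_adjoin ⟨c, d, hdc, h, rfl⟩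

omit [IsScalarTower K R F] in
theorem algebraMap_mem_locAlg {S : Subalgebra K R} {z : ℕ → R} {i : ℕ} {r : R} (hr : r ∈ S) :
    algebraMap R F r ∈ locAlg K F S z i :=
  Algebra.subset_adjoin (Or.inl ⟨r, hr, rfl⟩)

omit [IsScalarTower K R F] in
theorem inv_mem_locAlg {S : Subalgebra K R} {z : ℕ → R} {i j : ℕ} (hj : j < i) :
    (algebraMap R F (z j))⁻¹ ∈ locAlg K F S z i :=
  Algebra.subset_adjoin (Or.inr ⟨j, hj, rfl⟩)

omit [IsScalarTower K R F] in
theorem locAlg_mono {S S' : Subalgebra K R} (h : S ≤ S') {z z' : ℕ → R} {i i' : ℕ} (hi : i ≤ i')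
    (hz : ∀ j < i, z' j = z j) : locAlg K F S z i ≤ locAlg K F S' z' i' := by
  apply Algebra.adjoin_mono
  rintro x (⟨r, hr, rfl⟩ | ⟨j, hj, rfl⟩)
  · exact Or.inl ⟨r, h hr, rfl⟩
  · exact Or.inr ⟨j, hj.trans_le hi, by rw [hz j hj]⟩

/-- Every element of `locAlg` has a product of powers of `z_0, …, z_{i-1}` as a denominator. -/
theorem exists_mul_prod_pow_mem {S : Subalgebra K R} {z : ℕ → R} {i : ℕ}
    (hzS : ∀ j < i, z j ∈ S) (hz : ∀ j < i, algebraMap R F (z j) ≠ 0) {x : F}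
    (hx : x ∈ locAlg K F S z i) :
    ∃ e : ℕ → ℕ, ∃ r ∈ S, x * algebraMap R F (∏ j ∈ Finset.range i, z j ^ e j) =
      algebraMap R F r := by
  have hprod : ∀ e : ℕ → ℕ, ∏ j ∈ Finset.range i, z j ^ e j ∈ S := fun e =>
    prod_mem fun j hj => pow_mem (hzS j (Finset.mem_range.mp hj)) _
  induction hx using Algebra.adjoin_induction with
  | mem x hx =>
    rcases hx with ⟨r, hr, rfl⟩ | ⟨j, hj, rfl⟩
    · exact ⟨0, r, hr, by simp⟩
    · refine ⟨Pi.single j 1, 1, one_mem _, ?_⟩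
      rw [Finset.prod_eq_single j]
      · simp [hz j hj]
      · intro l _ hl
        simp [hl]
      · simp [hj]
  | algebraMap c =>
    exact ⟨0, algebraMap K R c, S.algebraMap_mem c, by
      simp [← IsScalarTower.algebraMap_apply]⟩
  | add x x' _ _ h h' =>
    obtain ⟨e, r, hr, h⟩ := h
    obtain ⟨e', r', hr', h'⟩ := h'
    refine ⟨e + e', r * (∏ j ∈ Finset.range i, z j ^ e' j) +
      r' * (∏ j ∈ Finset.range i, z j ^ e j),
      add_mem (mul_mem hr (hprod _)) (mul_mem hr' (hprod _)), ?_⟩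
    simp only [Pi.add_apply, pow_add, Finset.prod_mul_distrib, map_mul, map_add] at h h' ⊢
    rw [← h, ← h']
    ring
  | mul x x' _ _ h h' =>
    obtain ⟨e, r, hr, h⟩ := h
    obtain ⟨e', r', hr', h'⟩ := h'
    refine ⟨e + e', r * r', mul_mem hr hr', ?_⟩
    simp only [Pi.add_apply, pow_add, Finset.prod_mul_distrib, map_mul] at h h' ⊢
    rw [← h, ← h']
    ring

variable (P : PoissonBracket K F) (y : α → α → R) (N : ℕ) (pivot : ℕ → α → α → Prop)

open Classical in
/-- The state of the reduction after `i` steps: `E` is the relation of empty places, `z_j` for `j < i`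
are the invariants found so far (the values of `z` from `i` on are irrelevant), `p` and `q` are the
canonical pairs split off so far, and `Y` is the remaining family, which corresponds to the variables
`y`. The number `N` is the dimension of `𝓛`, and `pivot j` is the relation satisfied by the greatest
empty place before step `j` alone. -/
structure ReductionState (E : α → α → Prop) (i : ℕ) (z : ℕ → R) {ι : Type} [Fintype ι]
    (p q : ι → F) (Y : α → α → F) : Prop where
  root : IsRootFamily P E Y
  ne_zero : ∀ j < i, algebraMap R F (z j) ≠ 0
  central : ∀ j < i, ∀ x, P.bracket x (algebraMap R F (z j)) = 0
  bracket_pp : ∀ l m, P.bracket (p l) (p m) = 0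
  bracket_qq : ∀ l m, P.bracket (q l) (q m) = 0
  bracket_pq : ∀ l m, P.bracket (p l) (q m) = if l = m then 1 else 0
  bracket_pY : ∀ l a b, P.bracket (p l) (Y a b) = 0
  bracket_qY : ∀ l a b, P.bracket (q l) (Y a b) = 0
  gen : ∀ r, algebraMap R F r ∈ genAlg K z i p q Y
  le_locAlg : genAlg K z i p q Y ≤ locAlg K F ⊤ z i
  card : 2 * Fintype.card ι + i + Nat.card {x : α × α // E x.1 x.2} = N
  triangular : ∀ {a b}, E a b → Y a b - algebraMap R F (y a b) ∈ locAlg K F (above K y a b) z i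
  mem_above : ∀ {a b}, E a b → ∀ j < i, z j ∈ above K y a b
  form : ∀ j < i, ∀ {k t}, pivot j k t → ∃ e : ℕ → ℕ, ∃ r ∈ above K y k t,
    z j = y k t * ∏ l ∈ Finset.range j, z l ^ e l + r

end State

/-! ### One step of the reduction -/

namespace ReductionState

variable {K R F : Type*} {α : Type} [Field K] [CommRing R] [IsDomain R] [Algebra K R] [Field F]
  [Algebra K F] [Algebra R F] [IsScalarTower K R F] [IsFractionRing R F] [LinearOrder α]
  [Fintype α]
  {P : PoissonBracket K F} {y : α → α → R} {N : ℕ} {pivot : ℕ → α → α → Prop}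
  {M E : α → α → Prop} {i : ℕ} {z : ℕ → R} {ι : Type} [Fintype ι] {p q : ι → F} {Y : α → α → F}
  {k t : α}

omit [IsDomain R] [Algebra K R] [IsScalarTower K R F] [IsFractionRing R F] [LinearOrder α]
  [Fintype α] [Fintype ι] in
theorem family_mem_genAlg (a b : α) : Y a b ∈ genAlg K z i p q Y :=
  Algebra.subset_adjoin (Or.inr ⟨a, b, rfl⟩)

omit [IsScalarTower K R F] [Fintype α] in
/-- The bracket on `F` is determined by the elements that the state keeps track of. -/
theorem bracket_eq_zero (h : ReductionState P y N pivot E i z p q Y) {c : F}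
    (hp : ∀ l, P.bracket c (p l) = 0) (hq : ∀ l, P.bracket c (q l) = 0)
    (hY : ∀ a b, P.bracket c (Y a b) = 0) (x : F) : P.bracket c x = 0 := by
  refine P.bracket_eq_zero_of_fractionRing (R := R) (fun r => ?_) x
  have hle : genAlg K z i p q Y ≤ P.centralizer {c} := by
    apply Algebra.adjoin_le
    rintro x (((⟨j, hj, rfl | rfl⟩ | ⟨l, rfl⟩) | ⟨l, rfl⟩) | ⟨a, b, rfl⟩) c rfl
    · exact h.central j hj _
    · exact P.bracket_eq_zero_of_mul_eq_one (mul_inv_cancel₀ (h.ne_zero j hj)) (h.central j hj _)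
    · exact hp l
    · exact hq l
    · exact hY a b
  exact hle (h.gen r) c rfl

omit [IsScalarTower K R F] [Fintype α] in
theorem pivot_central (h : ReductionState P y N pivot E i z p q Y) (hE : IsEmptyPattern M E)
    (hg : IsGreatestIn E k t) (x : F) : P.bracket x (Y k t) = 0 :=
  P.bracket_comm_eq_zero <| h.bracket_eq_zero
    (fun _ => P.bracket_comm_eq_zero (h.bracket_pY _ _ _))
    (fun _ => P.bracket_comm_eq_zero (h.bracket_qY _ _ _))
    (fun _ _ => P.bracket_comm_eq_zero (h.root.bracket_pivot hE hg _ _)) x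

omit [IsFractionRing R F] [Fintype α] in
/-- The next invariant: the pivot `Y_{kt}` multiplied by its denominator. -/
theorem exists_pivot_invariant (h : ReductionState P y N pivot E i z p q Y)
    (hg : IsGreatestIn E k t)
    (hindep : ∀ u ∈ above K y k t, ∀ v ∈ above K y k t, y k t * u + v = 0 → u = 0) :
    ∃ e : ℕ → ℕ, ∃ r ∈ above K y k t, y k t * ∏ l ∈ Finset.range i, z l ^ e l + r ≠ 0 ∧
      algebraMap R F (y k t * ∏ l ∈ Finset.range i, z l ^ e l + r) =
        Y k t * algebraMap R F (∏ l ∈ Finset.range i, z l ^ e l) := by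
  have hz := h.mem_above hg.mem
  obtain ⟨e, r, hr, hre⟩ := exists_mul_prod_pow_mem hz h.ne_zero (h.triangular hg.mem)
  refine ⟨e, r, hr, fun h0 => ?_, ?_⟩
  · have h1 := hindep _ (prod_mem fun j hj => pow_mem (hz j (Finset.mem_range.mp hj)) _) r hr h0
    rw [Finset.prod_eq_zero_iff] at h1
    obtain ⟨j, hj, hj0⟩ := h1
    refine h.ne_zero j (Finset.mem_range.mp hj) ?_
    rw [eq_zero_of_pow_eq_zero hj0, map_zero]
  · rw [map_add, map_mul, ← hre]
    ring

omit [IsDomain R] [IsScalarTower K R F] [IsFractionRing R F] in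
/-- The corrections made in a step involve only greater places and the inverse of the pivot. -/
theorem reduceFamily_triangular (h : ReductionState P y N pivot E i z p q Y)
    (hE : IsEmptyPattern M E) (hg : IsGreatestIn E k t) (hw : Y k t ≠ 0) {a b : α}
    (hr : reduce E k t a b) {S : Subalgebra K F} (hS : locAlg K F (above K y a b) z i ≤ S)
    (hinv : (Y k t)⁻¹ ∈ S) :
    reduceFamily E Y k t a b - algebraMap R F (y a b) ∈ S := by
  classical
  have hmem : ∀ c d, (E c d → d < b ∨ d = b ∧ a < c) → Y c d ∈ S := by
    intro c d hcd
    by_cases hE' : E c d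
    · have h1 := hcd hE'
      have h2 := locAlg_mono (above_mono y (h1.imp id fun h => ⟨h.1, h.2.le⟩)) le_rfl
        (fun _ _ => rfl) (h.triangular hE')
      have h3 := algebraMap_mem_locAlg (F := F) (z := z) (i := i)
        (_root_.mem_above (K := K) y (hE.lt hE') h1)
      have h4 := add_mem (hS h2) (hS h3)
      rwa [sub_add_cancel] at h4
    · rw [h.root.zero hE']
      exact zero_mem _
  have hY := hS (h.triangular hr.1)
  have htk := hE.lt hg.mem
  suffices hsuff : reduceFamily E Y k t a b - Y a b ∈ S by
    have := add_mem hsuff hY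
    rwa [sub_add_sub_cancel] at this
  unfold reduceFamily
  rw [if_pos hr]
  split_ifs with h1 h2
  · rw [sub_self]
    exact zero_mem _
  · subst h2
    rw [colSum_sub hw]
    refine mul_mem hinv (sum_mem fun e he => ?_)
    have heb := Finset.ne_of_mem_erase he
    by_cases het : E e t
    · exact mul_mem (hmem _ _ fun _ => Or.inl (lt_of_le_of_ne (hg.row_le het) heb))
        (hmem _ _ fun _ => Or.inl htk)
    · rw [h.root.zero het, mul_zero]
      exact zero_mem _
  · rw [not_or] at h1
    rw [minor, sub_sub_cancel_left]
    refine neg_mem (mul_mem hinv ?_)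
    by_cases hat : E a t
    · exact mul_mem (hmem _ _ fun _ => Or.inr ⟨rfl, lt_of_le_of_ne (hg.row_le hat) h1.1⟩)
        (hmem _ _ fun _ => Or.inl (lt_of_le_of_ne (hg.le_col hr.1) (Ne.symm h1.2)))
    · rw [h.root.zero hat, mul_zero]
      exact zero_mem _

/-- A step removes the pivot and one pair of places for every canonical pair. -/
theorem card_reduce (hE : IsEmptyPattern M E) (hg : IsGreatestIn E k t) :
    Nat.card {x : α × α // E x.1 x.2} = 2 * Nat.card {c : α // E k c ∧ E c t} + 1 +
      Nat.card {x : α × α // reduce E k t x.1 x.2} := by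
  classical
  have htk := hE.lt hg.mem
  simp only [Nat.card_eq_fintype_card, Fintype.card_subtype]
  set B := Finset.univ.filter fun c => E k c ∧ E c t with hB
  have h1 : (Finset.univ.filter fun x : α × α => E x.1 x.2) =
      ((B.image fun c => (k, c)) ∪ (B.image fun c => (c, t))) ∪ {(k, t)} ∪
        Finset.univ.filter fun x : α × α => reduce E k t x.1 x.2 := by
    ext ⟨a, b⟩
    have := hg.mem
    simp only [hB, Finset.mem_filter, Finset.mem_univ, true_and, Finset.mem_union,
      Finset.mem_image, Finset.mem_singleton, Prod.mk.injEq, reduce]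
    grind
  rw [h1, Finset.card_union_of_disjoint, Finset.card_union_of_disjoint,
    Finset.card_union_of_disjoint, Finset.card_image_of_injective, Finset.card_image_of_injective,
    Finset.card_singleton]
  · ring
  · exact fun a b h => by simpa using h
  · exact fun a b h => by simpa using h
  · rw [Finset.disjoint_left]
    rintro ⟨a, b⟩ h2 h3
    simp only [hB, Finset.mem_image, Finset.mem_filter, Finset.mem_univ, true_and,
      Prod.mk.injEq] at h2 h3
    obtain ⟨c, hc, rfl, rfl⟩ := h2
    obtain ⟨d, hd, rfl, rfl⟩ := h3
    exact (hE.lt hd.1).ne rfl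
  · rw [Finset.disjoint_left]
    rintro ⟨a, b⟩ h2 h3
    have := @hE.lt
    simp only [hB, Finset.mem_filter, Finset.mem_univ, true_and, Finset.mem_union,
      Finset.mem_image, Finset.mem_singleton, Prod.mk.injEq] at h2 h3
    grind
  · rw [Finset.disjoint_left]
    rintro ⟨a, b⟩ h2 h3
    simp only [hB, Finset.mem_filter, Finset.mem_univ, true_and, Finset.mem_union,
      Finset.mem_image, Finset.mem_singleton, Prod.mk.injEq, reduce] at h2 h3
    grind

/-- One step of the reduction. The new pairs are `p_c = Y_{kc} / Y_{kt}` and `q_c = Y_{ct}` for all `c`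
such that `(k, c)` and `(c, t)` are empty. -/
theorem step (h : ReductionState P y N pivot E i z p q Y)
    (hE : IsEmptyPattern M E) (hg : IsGreatestIn E k t)
    (hpivot : ∀ {a b}, pivot i a b → a = k ∧ b = t)
    (hindep : ∀ u ∈ above K y k t, ∀ v ∈ above K y k t, y k t * u + v = 0 → u = 0) :
    ∃ (z' : ℕ → R) (ι' : Type) (_ : Fintype ι') (p' q' : ι' → F) (Y' : α → α → F),
      ReductionState P y N pivot (reduce E k t) (i + 1) z' p' q' Y' := by
  classical
  obtain ⟨e, r, hr, hne, hzi⟩ := h.exists_pivot_invariant hg hindep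
  set m := ∏ l ∈ Finset.range i, z l ^ e l with hm
  set zi := y k t * m + r with hzi'
  have hcen := h.pivot_central hE hg
  have hzi0 : algebraMap R F zi ≠ 0 := by
    rwa [Ne, FaithfulSMul.algebraMap_eq_zero_iff]
  have hw : Y k t ≠ 0 := fun h0 => hzi0 (by rw [hzi, h0, zero_mul])
  have hm0 : algebraMap R F m ≠ 0 := fun h0 => hzi0 (by rw [hzi, h0, mul_zero])
  have hcen' : ∀ x, P.bracket x (Y k t)⁻¹ = 0 := fun x =>
    P.bracket_eq_zero_of_mul_eq_one (mul_inv_cancel₀ hw) (hcen x)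
  have hwz : Y k t = algebraMap R F zi * (algebraMap R F m)⁻¹ := by
    rw [hzi, mul_inv_cancel_right₀ hm0]
  have hwz' : (Y k t)⁻¹ = algebraMap R F m * (algebraMap R F zi)⁻¹ := by
    rw [hwz, mul_inv, inv_inv, mul_comm]
  have hz : ∀ j < i, Function.update z i zi j = z j := fun j hj =>
    Function.update_of_ne hj.ne _ _
  have hz2 : Function.update z i zi i = zi := Function.update_self _ _ _
  have hlt : ∀ {j}, j < i + 1 → j < i ∨ j = i := fun hj => Nat.lt_succ_iff_lt_or_eq.mp hj
  have hmS : ∀ S : Subalgebra K R, (∀ j < i, z j ∈ S) → m ∈ S := fun S hS =>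
    prod_mem fun j hj => pow_mem (hS j (Finset.mem_range.mp hj)) _
  have hmF : ∀ S : Subalgebra K F, (∀ j < i, (algebraMap R F (z j))⁻¹ ∈ S) →
      (algebraMap R F m)⁻¹ ∈ S := by
    intro S hS
    rw [hm, map_prod, ← Finset.prod_inv_distrib]
    refine prod_mem fun j hj => ?_
    rw [map_pow, ← inv_pow]
    exact pow_mem (hS j (Finset.mem_range.mp hj)) _
  have hpY : ∀ (c : α) (x : F), P.bracket (Y k c * (Y k t)⁻¹) x =
      (Y k t)⁻¹ * P.bracket (Y k c) x := by
    intro c x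
    rw [P.leibniz_left, P.bracket_comm_eq_zero (hcen' x), mul_zero, zero_add]
  have hpY' : ∀ (c : α) (x : F), P.bracket x (Y k c * (Y k t)⁻¹) =
      P.bracket x (Y k c) * (Y k t)⁻¹ := by
    intro c x
    rw [P.leibniz, hcen', mul_zero, add_zero]
  have hrow_le : ∀ {a b}, reduce E k t a b → t < b ∨ t = b ∧ a < k := by
    intro a b hab
    rcases (hg.le_col hab.1).lt_or_eq with h1 | h1
    · exact Or.inl h1
    · refine Or.inr ⟨h1, lt_of_le_of_ne (hg.row_le (h1 ▸ hab.1)) fun h2 => hab.2.1 ⟨h2, h1.symm⟩⟩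
  have habove : ∀ {a b}, reduce E k t a b → above K y k t ≤ above K y a b := fun hab =>
    above_mono y ((hrow_le hab).imp id fun h => ⟨h.1, h.2.le⟩)
  have hz_mem : ∀ {a b}, reduce E k t a b → ∀ j < i + 1,
      Function.update z i zi j ∈ above K y a b := by
    intro a b hab j hj
    rcases hlt hj with hj | rfl
    · rw [hz j hj]
      exact h.mem_above hab.1 j hj
    · rw [hz2]
      exact add_mem (mul_mem (_root_.mem_above y (hE.lt hg.mem) (hrow_le hab))
        (hmS _ (h.mem_above hab.1))) (habove hab hr)
  refine ⟨Function.update z i zi, ι ⊕ {c : α // E k c ∧ E c t}, inferInstance,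
    Sum.elim p fun c => Y k c * (Y k t)⁻¹, Sum.elim q fun c => Y c t, reduceFamily E Y k t,
    h.root.reduce hE hg hw, ?_, ?_, ?_, ?_, ?_, ?_, ?_, ?_, ?_, ?_, ?_, hz_mem, ?_⟩
  · intro j hj
    rcases hlt hj with hj | rfl
    · rw [hz j hj]
      exact h.ne_zero j hj
    · rwa [hz2]
  · intro j hj x
    rcases hlt hj with hj | rfl
    · rw [hz j hj]
      exact h.central j hj x
    · -- The new invariant is the central pivot times a product of central elements.
      rw [hz2, hzi, P.leibniz, hcen]
      have : algebraMap R F m ∈ P.centralizer {x} := by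
        rw [hm, map_prod]
        refine prod_mem fun l hl => ?_
        rw [map_pow]
        refine pow_mem ?_ _
        rintro _ rfl
        exact h.central l (Finset.mem_range.mp hl) _
      rw [this x rfl]
      ring
  · rintro (l | ⟨c, hc⟩) (l' | ⟨c', hc'⟩)
    · exact h.bracket_pp l l'
    · simp only [Sum.elim_inl, Sum.elim_inr]
      rw [hpY', h.bracket_pY, zero_mul]
    · simp only [Sum.elim_inl, Sum.elim_inr]
      rw [hpY, P.bracket_comm_eq_zero (h.bracket_pY _ _ _), mul_zero]
    · simp only [Sum.elim_inr]
      rw [hpY, hpY', h.root.bracket_of_ne (hE.lt hc.1).ne (hE.lt hc'.1).ne']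
      ring
  · rintro (l | ⟨c, hc⟩) (l' | ⟨c', hc'⟩)
    · exact h.bracket_qq l l'
    · exact h.bracket_qY _ _ _
    · exact P.bracket_comm_eq_zero (h.bracket_qY _ _ _)
    · exact h.root.bracket_of_ne (hE.lt hc'.2).ne (hE.lt hc.2).ne'
  · rintro (l | ⟨c, hc⟩) (l' | ⟨c', hc'⟩)
    · simpa using h.bracket_pq l l'
    · simpa using h.bracket_pY _ _ _
    · simp only [Sum.elim_inl, Sum.elim_inr, reduceCtorEq, if_false]
      rw [hpY, P.bracket_comm_eq_zero (h.bracket_qY _ _ _), mul_zero]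
    · simp only [Sum.elim_inr, Sum.inr.injEq, Subtype.mk.injEq]
      rw [hpY]
      split_ifs with hcc
      · subst hcc
        rw [h.root.bracket_eq hE hc.1 hc.2, inv_mul_cancel₀ hw]
      · rw [h.root.bracket_of_ne hcc (hE.lt hg.mem).ne', mul_zero]
  · rintro (l | ⟨c, hc⟩) a b
    · have hmem : reduceFamily E Y k t a b ∈ P.centralizer {p l} :=
        reduceFamily_mem
          (fun a b => P.mem_centralizer_singleton.mpr (h.bracket_pY l a b))
          (P.mem_centralizer_singleton.mpr (hcen' _)) a b
      exact hmem _ rfl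
    · simp only [Sum.elim_inr]
      rw [hpY, (h.root.bracket_pair_reduceFamily hE hg hw hc.1 hc.2 a b).1, mul_zero]
  · rintro (l | ⟨c, hc⟩) a b
    · have hmem : reduceFamily E Y k t a b ∈ P.centralizer {q l} :=
        reduceFamily_mem
          (fun a b => P.mem_centralizer_singleton.mpr (h.bracket_qY l a b))
          (P.mem_centralizer_singleton.mpr (hcen' _)) a b
      exact hmem _ rfl
    · exact (h.root.bracket_pair_reduceFamily hE hg hw hc.1 hc.2 a b).2
  · -- The old generators are recovered from the new ones.
    intro x
    set S := genAlg K (Function.update z i zi) (i + 1)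
      (Sum.elim p fun c : {c : α // E k c ∧ E c t} => Y k c * (Y k t)⁻¹)
      (Sum.elim q fun c => Y c t) (reduceFamily E Y k t) with hS
    have hzS : ∀ j < i + 1, algebraMap R F (Function.update z i zi j) ∈ S ∧
        (algebraMap R F (Function.update z i zi j))⁻¹ ∈ S := fun j hj =>
      ⟨Algebra.subset_adjoin (Or.inl (Or.inl (Or.inl ⟨j, hj, Or.inl rfl⟩))),
        Algebra.subset_adjoin (Or.inl (Or.inl (Or.inl ⟨j, hj, Or.inr rfl⟩)))⟩
    have hpS : ∀ l, Sum.elim p (fun c : {c : α // E k c ∧ E c t} => Y k c * (Y k t)⁻¹) l ∈ S :=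
      fun l => Algebra.subset_adjoin (Or.inl (Or.inl (Or.inr ⟨l, rfl⟩)))
    have hqS : ∀ l, Sum.elim q (fun c : {c : α // E k c ∧ E c t} => Y c t) l ∈ S :=
      fun l => Algebra.subset_adjoin (Or.inl (Or.inr ⟨l, rfl⟩))
    have hzS' : ∀ j < i, algebraMap R F (z j) ∈ S ∧ (algebraMap R F (z j))⁻¹ ∈ S := by
      intro j hj
      have := hzS j (hj.trans (Nat.lt_succ_self i))
      rwa [hz j hj] at this
    have hziS := hzS i (Nat.lt_succ_self i)
    rw [hz2] at hziS
    have hw1 : Y k t ∈ S := hwz ▸ mul_mem hziS.1 (hmF S fun j hj => (hzS' j hj).2)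
    have hw2 : (Y k t)⁻¹ ∈ S := by
      rw [hwz']
      refine mul_mem ?_ hziS.2
      rw [hm, map_prod]
      refine prod_mem fun j hj => ?_
      rw [map_pow]
      exact pow_mem (hzS' j (Finset.mem_range.mp hj)).1 _
    have hle : genAlg K z i p q Y ≤ S := by
      apply Algebra.adjoin_le
      rintro x (((⟨j, hj, rfl | rfl⟩ | ⟨l, rfl⟩) | ⟨l, rfl⟩) | ⟨a, b, rfl⟩)
      · exact (hzS' j hj).1
      · exact (hzS' j hj).2
      · exact hpS (Sum.inl l)
      · exact hqS (Sum.inl l)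
      · refine family_mem_of_reduceFamily_mem h.root hE hg hw hw1 hw2 (fun c h1 h2 => ?_)
          (fun a b => family_mem_genAlg a b) a b
        have h3 := hpS (Sum.inr ⟨c, h1, h2⟩)
        have h4 := mul_mem h3 hw1
        simp only [Sum.elim_inr] at h4
        rw [inv_mul_cancel_right₀ hw] at h4
        exact ⟨h4, hqS (Sum.inr ⟨c, h1, h2⟩)⟩
    exact hle (h.gen x)
  · -- The new generators have only powers of the invariants as denominators.
    have hle : locAlg K F ⊤ z i ≤ locAlg K F ⊤ (Function.update z i zi) (i + 1) :=
      locAlg_mono le_rfl (Nat.le_succ i) hz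
    have hY : ∀ a b, Y a b ∈ locAlg K F ⊤ (Function.update z i zi) (i + 1) := fun a b =>
      hle (h.le_locAlg (family_mem_genAlg a b))
    have hinv : (Y k t)⁻¹ ∈ locAlg K F ⊤ (Function.update z i zi) (i + 1) := by
      rw [hwz']
      refine mul_mem (algebraMap_mem_locAlg (S := ⊤) trivial) ?_
      have := inv_mem_locAlg (K := K) (F := F) (S := ⊤) (z := Function.update z i zi)
        (Nat.lt_succ_self i)
      rwa [hz2] at this
    apply Algebra.adjoin_le
    rintro x (((⟨j, hj, rfl | rfl⟩ | ⟨l | c, rfl⟩) | ⟨l | c, rfl⟩) | ⟨a, b, rfl⟩)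
    · exact algebraMap_mem_locAlg (S := ⊤) trivial
    · exact inv_mem_locAlg hj
    · exact hle (h.le_locAlg (Algebra.subset_adjoin (Or.inl (Or.inl (Or.inr ⟨l, rfl⟩)))))
    · exact mul_mem (hY _ _) hinv
    · exact hle (h.le_locAlg (Algebra.subset_adjoin (Or.inl (Or.inr ⟨l, rfl⟩))))
    · exact hY _ _
    · exact reduceFamily_mem hY hinv a b
  · have h1 := h.card
    rw [card_reduce hE hg] at h1
    rw [Fintype.card_sum, ← Nat.card_eq_fintype_card (α := {c : α // E k c ∧ E c t})]
    omega
  · intro a b hab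
    -- The inverse of the pivot is `m / z_i`.
    refine h.reduceFamily_triangular hE hg hw hab
      (locAlg_mono le_rfl (Nat.le_succ i) hz) ?_
    rw [hwz']
    refine mul_mem (algebraMap_mem_locAlg (hmS _ (h.mem_above hab.1))) ?_
    have := inv_mem_locAlg (K := K) (F := F) (S := above K y a b) (z := Function.update z i zi)
      (Nat.lt_succ_self i)
    rwa [hz2] at this
  · intro j hj a b hab
    have hprod : ∀ l ≤ i, ∀ e : ℕ → ℕ, ∏ l ∈ Finset.range l, Function.update z i zi l ^ e l =
        ∏ l ∈ Finset.range l, z l ^ e l := by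
      intro l hl e
      refine Finset.prod_congr rfl fun l' hl' => ?_
      rw [hz l' ((Finset.mem_range.mp hl').trans_le hl)]
    rcases hlt hj with hj | rfl
    · obtain ⟨e', r', hr', hf⟩ := h.form j hj hab
      exact ⟨e', r', hr', by rw [hz j hj, hprod j hj.le, hf]⟩
    · obtain ⟨rfl, rfl⟩ := hpivot hab
      exact ⟨e, r, hr, by rw [hz2, hprod j le_rfl]⟩

/-- The reduction can be carried through as long as empty places remain. -/
theorem _root_.exists_reductionState {E : ℕ → α → α → Prop} {s : ℕ}
    (hE : IsEmptyPattern M (E 0)) (hg : ∀ i < s, ∃ k t, IsGreatestIn (E i) k t)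
    (hstep : ∀ i k t, IsGreatestIn (E i) k t → E (i + 1) = reduce (E i) k t)
    (hindep : ∀ k t, t < k → ¬ M k t → ∀ u ∈ above K y k t, ∀ v ∈ above K y k t,
      y k t * u + v = 0 → u = 0)
    (h0 : ReductionState P y N (fun j => IsGreatestIn (E j)) (E 0) 0 z p q Y) :
    ∀ i ≤ s, IsEmptyPattern M (E i) ∧ ∃ (z : ℕ → R) (ι : Type) (_ : Fintype ι) (p q : ι → F)
      (Y : α → α → F), ReductionState P y N (fun j => IsGreatestIn (E j)) (E i) i z p q Y := by
  intro i hi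
  induction i with
  | zero => exact ⟨hE, z, ι, inferInstance, p, q, Y, h0⟩
  | succ i ih =>
    obtain ⟨hEi, z, ι, _, p, q, Y, h⟩ := ih (Nat.le_of_succ_le hi)
    obtain ⟨k, t, hkt⟩ := hg i hi
    rw [hstep i k t hkt]
    refine ⟨hEi.reduce hkt, h.step hEi hkt (fun h' => ?_)
      (hindep k t (hEi.lt hkt.mem) (hEi.disj hkt.mem))⟩
    exact h'.unique hkt

end ReductionState

/-! ### The stages of the diagram -/

namespace Diagram

variable {n : ℕ}

/-- The empty places of a diagram, as a relation between rows and columns. -/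
def emptyRel (D : Diagram n) (a b : Fin n) : Prop := ∃ h : b < a, D ⟨(a, b), h⟩ = none

theorem emptyRel_place {D : Diagram n} {ξ : Place n} : D.emptyRel ξ.row ξ.col ↔ D ξ = none :=
  ⟨fun h => h.2, fun h => ⟨ξ.2, h⟩⟩

theorem isGreatestEmpty_iff {D : Diagram n} {ξ : Place n} :
    D.IsGreatestEmpty ξ ↔ IsGreatestIn D.emptyRel ξ.row ξ.col := by
  constructor
  · intro h
    refine ⟨⟨ξ.2, h.1⟩, ?_, ?_⟩
    · rintro a b ⟨hba, hab⟩
      by_cases hξ : (⟨(a, b), hba⟩ : Place n) = ξ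
      · rw [← hξ]
      · rcases h.2 _ hab hξ with h1 | h1
        · exact h1.le
        · exact h1.1.le
    · rintro a ⟨hba, hab⟩
      by_cases hξ : (⟨(a, ξ.col), hba⟩ : Place n) = ξ
      · rw [← hξ]
      · rcases h.2 _ hab hξ with h1 | h1
        · exact absurd h1 (lt_irrefl _)
        · exact h1.2.le
  · intro h
    refine ⟨emptyRel_place.mp h.mem, fun η hη hne => ?_⟩
    rcases (h.le_col (emptyRel_place.mpr hη)).lt_or_eq with h1 | h1
    · exact Or.inl h1
    · refine Or.inr ⟨h1, lt_of_le_of_ne (h.row_le (h1 ▸ emptyRel_place.mpr hη)) fun h2 => ?_⟩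
      exact hne (Subtype.ext (Prod.ext h2 h1.symm))

theorem exists_isGreatestEmpty {D : Diagram n} (h : ∃ η, D η = none) :
    ∃ ξ, D.IsGreatestEmpty ξ := by
  obtain ⟨ξ, hξ, hmin⟩ := Finset.exists_min_image (Finset.univ.filter fun η => D η = none)
    (fun η => toLex (η.col, OrderDual.toDual η.row)) (by simpa [Finset.Nonempty] using h)
  simp only [Finset.mem_filter, Finset.mem_univ, true_and] at hξ hmin
  refine ⟨ξ, hξ, fun η hη hne => ?_⟩
  rcases Prod.Lex.le_iff.mp (hmin η hη) with h1 | ⟨h1, h2⟩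
  · exact Or.inl h1
  · refine Or.inr ⟨h1, lt_of_le_of_ne h2 fun h3 => hne (Subtype.ext (Prod.ext h3 h1.symm))⟩

theorem step_eq_none_iff {D : Diagram n} {η : Place n} :
    D.step η = none ↔ D η = none ∧ ¬ D.IsGreatestEmpty η ∧
      (¬ ∃ ξ ζ : Place n, D.IsGreatestEmpty ξ ∧ η.row = ξ.row ∧ η.col = ζ.row ∧ ζ.col = ξ.col ∧
        D η = none ∧ D ζ = none) ∧
      ¬ ∃ ξ ζ : Place n, D.IsGreatestEmpty ξ ∧ ζ.row = ξ.row ∧ ζ.col = η.row ∧ η.col = ξ.col ∧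
        D ζ = none ∧ D η = none := by
  unfold step
  split_ifs with h1 h2 h3
  · exact ⟨fun h => (nomatch h), fun h => absurd h1 h.2.1⟩
  · exact ⟨fun h => (nomatch h), fun h => absurd h2 h.2.2.1⟩
  · exact ⟨fun h => (nomatch h), fun h => absurd h3 h.2.2.2⟩
  · exact ⟨fun h => ⟨h, h1, h2, h3⟩, fun h => h.1⟩

theorem emptyRel_step {D : Diagram n} {k t : Fin n} (h : IsGreatestIn D.emptyRel k t) :
    D.step.emptyRel = reduce D.emptyRel k t := by
  have huniq : ∀ ξ : Place n, D.IsGreatestEmpty ξ → ξ.row = k ∧ ξ.col = t := fun ξ hξ =>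
    (isGreatestEmpty_iff.mp hξ).unique h
  have hg : D.IsGreatestEmpty ⟨(k, t), h.mem.1⟩ := isGreatestEmpty_iff.mpr h
  funext a b
  apply propext
  constructor
  · rintro ⟨hba, hab⟩
    obtain ⟨h0, h1, h2, h3⟩ := step_eq_none_iff.mp hab
    refine ⟨⟨hba, h0⟩, ?_, ?_, ?_⟩
    · rintro ⟨rfl, rfl⟩
      exact h1 hg
    · rintro ⟨rfl, hbt, hb⟩
      exact h2 ⟨_, ⟨(b, t), hbt⟩, hg, rfl, rfl, rfl, h0, hb⟩
    · rintro ⟨rfl, hak, ha⟩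
      exact h3 ⟨_, ⟨(k, a), hak⟩, hg, rfl, rfl, rfl, ha, h0⟩
  · rintro ⟨⟨hba, h0⟩, h1, h2, h3⟩
    refine ⟨hba, step_eq_none_iff.mpr ⟨h0, fun h' => h1 (huniq _ h'), ?_, ?_⟩⟩
    · rintro ⟨ξ, ζ, hξ, e1, e2, e3, -, hζ⟩
      obtain ⟨rfl, rfl⟩ := huniq ξ hξ
      refine h2 ⟨e1, ?_⟩
      have := emptyRel_place.mpr hζ
      rwa [← e2, e3] at this
    · rintro ⟨ξ, ζ, hξ, e1, e2, e3, hζ, -⟩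
      obtain ⟨rfl, rfl⟩ := huniq ξ hξ
      refine h3 ⟨e3, ?_⟩
      have := emptyRel_place.mpr hζ
      rwa [e1, e2] at this

theorem stage_succ (M : Finset (Place n)) (i : ℕ) : stage M (i + 1) = (stage M i).step :=
  Function.iterate_succ_apply' _ _ _

theorem step_of_eq_some {D : Diagram n} {η : Place n} {x : DiagramSymbol} (h : D η = some x) :
    D.step η = some x := by
  have h1 : ¬ D.IsGreatestEmpty η := fun h' => by simp [h'.1] at h
  simp [step, h1, h]

theorem step_eq_tensor_iff {D : Diagram n} {η : Place n} :
    D.step η = some DiagramSymbol.tensor ↔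
      D.IsGreatestEmpty η ∨ D η = some DiagramSymbol.tensor := by
  unfold step
  split_ifs with h1 h2 h3
  · simp [h1]
  · obtain ⟨_, _, _, _, _, _, h, _⟩ := h2
    simp [h1, h]
  · obtain ⟨_, _, _, _, _, _, _, h⟩ := h3
    simp [h1, h]
  · simp [h1]

theorem stage_eq_tensor_iff (M : Finset (Place n)) (i : ℕ) (η : Place n) :
    stage M i η = some DiagramSymbol.tensor ↔ ∃ j < i, (stage M j).IsGreatestEmpty η := by
  induction i with
  | zero =>
    have : stage M 0 η ≠ some DiagramSymbol.tensor := by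
      change start M η ≠ _
      unfold start
      split_ifs <;> simp
    simp [this]
  | succ i ih =>
    rw [stage_succ, step_eq_tensor_iff, ih]
    constructor
    · rintro (h | ⟨j, hj, h⟩)
      · exact ⟨i, Nat.lt_succ_self i, h⟩
      · exact ⟨j, hj.trans (Nat.lt_succ_self i), h⟩
    · rintro ⟨j, hj, h⟩
      rcases Nat.lt_succ_iff_lt_or_eq.mp hj with hj | rfl
      · exact Or.inr ⟨j, hj, h⟩
      · exact Or.inl h

theorem IsGreatestEmpty.unique {D : Diagram n} {ξ η : Place n} (h : D.IsGreatestEmpty ξ)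
    (h' : D.IsGreatestEmpty η) : ξ = η :=
  have h1 := (isGreatestEmpty_iff.mp h).unique (isGreatestEmpty_iff.mp h')
  Subtype.ext (Prod.ext h1.1 h1.2)

theorem IsGreatestEmpty.stage_lt {M : Finset (Place n)} {i j : ℕ} {ξ : Place n}
    (h : (stage M i).IsGreatestEmpty ξ) (hj : i < j) :
    stage M j ξ = some DiagramSymbol.tensor :=
  (stage_eq_tensor_iff M j ξ).mpr ⟨i, hj, h⟩

theorem IsGreatestEmpty.stage_injective {M : Finset (Place n)} {i j : ℕ} {ξ : Place n}
    (h : (stage M i).IsGreatestEmpty ξ) (h' : (stage M j).IsGreatestEmpty ξ) : i = j := by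
  rcases lt_trichotomy i j with hij | hij | hij
  · have := h.stage_lt hij
    simp [h'.1] at this
  · exact hij
  · have := h'.stage_lt hij
    simp [h.1] at this

/-- The places filled by `⊗` in the final diagram are the greatest empty places of the successive
stages, and no place is empty after the last of them. -/
theorem exists_pivots (M : Finset (Place n)) :
    ∃ ξ : Fin (tensorPlaces M).card → Place n, Set.range ξ = ↑(tensorPlaces M) ∧
      (∀ i : Fin (tensorPlaces M).card, (stage M i).IsGreatestEmpty (ξ i)) ∧
      ∀ η, stage M (tensorPlaces M).card η ≠ none := by
  classical
  -- Distinct stages have distinct greatest empty places, so some stage has no empty place.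
  have hex : ∃ i, ∀ η, stage M i η ≠ none := by
    by_contra! hcon
    choose f hf using fun i => exists_isGreatestEmpty (hcon i)
    exact not_injective_infinite_finite f fun i j hij => (hf i).stage_injective (hij ▸ hf j)
  obtain ⟨s, hs, hmin⟩ : ∃ s, (∀ η, stage M s η ≠ none) ∧ ∀ i < s, ∃ η, stage M i η = none :=
    ⟨Nat.find hex, Nat.find_spec hex, fun i hi => by simpa using Nat.find_min hex hi⟩
  choose f hf using fun i : Fin s => exists_isGreatestEmpty (hmin i i.2)
  have hinj : Function.Injective f := fun i j hij =>
    Fin.ext ((hf i).stage_injective (hij ▸ hf j))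
  have hstable : ∀ j, stage M (s + j) = stage M s := by
    intro j
    induction j with
    | zero => rfl
    | succ j ih =>
      rw [← add_assoc, stage_succ, ih]
      funext η
      obtain ⟨x, hx⟩ := Option.ne_none_iff_exists'.mp (hs η)
      rw [hx, step_of_eq_some hx]
  have hle : s ≤ Fintype.card (Place n) := by
    simpa using Fintype.card_le_of_injective _ hinj
  have hmem : ∀ η, η ∈ tensorPlaces M ↔ ∃ i : Fin s, f i = η := by
    intro η
    have hfin : final M = stage M s := by
      rw [final, ← Nat.add_sub_cancel' hle, hstable]
    rw [tensorPlaces, Finset.mem_filter, hfin, stage_eq_tensor_iff]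
    constructor
    · rintro ⟨-, i, hi, h⟩
      exact ⟨⟨i, hi⟩, (hf ⟨i, hi⟩).unique h⟩
    · rintro ⟨i, rfl⟩
      exact ⟨Finset.mem_univ _, i, i.2, hf i⟩
  have hcard : (tensorPlaces M).card = s := by
    have : tensorPlaces M = Finset.univ.image f := by
      ext η
      simp [hmem]
    rw [this, Finset.card_image_of_injective _ hinj, Finset.card_univ, Fintype.card_fin]
  subst hcard
  exact ⟨f, Set.ext fun η => (hmem η).symm, hf, hs⟩

end Diagram

/-! ### Homomorphisms of Poisson algebras -/

namespace PoissonBracket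

variable {K A B : Type*} [Field K] [CommRing A] [Algebra K A] [CommRing B] [Algebra K B]

theorem map_bracket_of_generators (P : PoissonBracket K A) (Q : PoissonBracket K B)
    (θ : A →ₐ[K] B) {G : Set A} (hG : Algebra.adjoin K G = ⊤)
    (h : ∀ a ∈ G, ∀ b ∈ G, θ (P.bracket a b) = Q.bracket (θ a) (θ b)) (a b : A) :
    θ (P.bracket a b) = Q.bracket (θ a) (θ b) := by
  have key : ∀ a, (∀ b ∈ G, θ (P.bracket a b) = Q.bracket (θ a) (θ b)) →
      ∀ b, θ (P.bracket a b) = Q.bracket (θ a) (θ b) := by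
    intro a ha b
    have hb : b ∈ Algebra.adjoin K G := hG ▸ Algebra.mem_top
    induction hb using Algebra.adjoin_induction with
    | mem b hb => exact ha b hb
    | algebraMap r =>
      have hP : P.bracket a (algebraMap K A r) = 0 := by
        rw [Algebra.algebraMap_eq_smul_one, LinearMap.map_smul, bracket_one, smul_zero]
      have hQ : Q.bracket (θ a) (algebraMap K B r) = 0 := by
        rw [Algebra.algebraMap_eq_smul_one, LinearMap.map_smul, bracket_one, smul_zero]
      rw [hP, AlgHom.commutes, hQ, map_zero]
    | add x y _ _ hx hy => simp only [map_add, hx, hy]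
    | mul x y _ _ hx hy => simp only [map_add, map_mul, leibniz, hx, hy]
  refine key a (fun b hb => ?_) b
  rw [P.skew, Q.skew, map_neg, key b (h b hb)]

theorem map_bracket_localization {R F : Type*} [CommRing R] [Algebra K R] [Field F] [Algebra K F]
    (P : PoissonBracket K R) (Q : PoissonBracket K F) (S : Submonoid R)
    (θ : Localization S →ₐ[K] F)
    (h : ∀ a b : R, Q.bracket (θ (algebraMap R _ a)) (θ (algebraMap R _ b)) =
      θ (algebraMap R _ (P.bracket a b))) (x y : Localization S) :
    θ ((P.localization S).bracket x y) = Q.bracket (θ x) (θ y) := by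
  have key : ∀ x, (∀ a : R, θ ((P.localization S).bracket x (algebraMap R _ a)) =
      Q.bracket (θ x) (θ (algebraMap R _ a))) →
      ∀ y, θ ((P.localization S).bracket x y) = Q.bracket (θ x) (θ y) := by
    intro x hx y
    obtain ⟨a, s, rfl⟩ := IsLocalization.exists_mk'_eq S y
    set y := IsLocalization.mk' (Localization S) a s
    have hy : y * algebraMap R _ s = algebraMap R _ a := IsLocalization.mk'_spec _ a s
    have hs : θ (algebraMap R _ s) ≠ 0 :=
      ((IsLocalization.map_units (Localization S) s).map θ).ne_zero
    have h1 := congrArg (fun w => θ ((P.localization S).bracket x w)) hy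
    have h2 := congrArg (fun w => Q.bracket (θ x) (θ w)) hy
    simp only [leibniz, map_add, map_mul, hx] at h1 h2
    rw [← h2] at h1
    exact mul_right_cancel₀ hs (add_right_cancel h1)
  refine key x (fun a => ?_) y
  rw [skew, Q.skew, map_neg, key (algebraMap R _ a)]
  intro b
  rw [localization_algebraMap, h]

theorem tensor_bracket_tmul_one (P : PoissonBracket K A) (x : B ⊗[K] A) (b : B) :
    ((zero K B).tensor P).bracket (b ⊗ₜ 1) x = 0 := by
  change tensorBilin _ _ _ _ = 0
  induction x using TensorProduct.induction_on with
  | zero => simp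
  | tmul c d => simp [tensorBilin_tmul, one_bracket, zero]
  | add x y hx hy => rw [map_add, hx, hy, add_zero]

theorem tensor_bracket_one_tmul (P : PoissonBracket K A) (Q : PoissonBracket K B) (a b : A) :
    (Q.tensor P).bracket (1 ⊗ₜ a) (1 ⊗ₜ b) = 1 ⊗ₜ P.bracket a b := by
  change tensorBilin _ _ _ _ = _
  simp [tensorBilin_tmul, one_bracket]

theorem canonical_bracket_X (m : ℕ) (l l' : Fin m ⊕ Fin m) :
    (canonical K m).bracket (MvPolynomial.X l) (MvPolynomial.X l') =
      match l, l' with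
      | Sum.inl i, Sum.inr j => if i = j then 1 else 0
      | Sum.inr i, Sum.inl j => if i = j then -1 else 0
      | _, _ => 0 := by
  change (MvPolynomial.mkDerivation K (fun x : Fin m ⊕ Fin m => match x with
      | Sum.inl i => MvPolynomial.pderiv (Sum.inr i)
      | Sum.inr i => -MvPolynomial.pderiv (Sum.inl i)) (MvPolynomial.X l) :
    Derivation K (MvPolynomial (Fin m ⊕ Fin m) K) (MvPolynomial (Fin m ⊕ Fin m) K))
      (MvPolynomial.X l') = _
  rcases l with i | i <;> rcases l' with j | j <;>
    simp [MvPolynomial.mkDerivation_X, MvPolynomial.pderiv_X, Pi.single_apply, eq_comm, apply_ite]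

end PoissonBracket

/-! ### Laurent polynomials -/

namespace MvLaurent

variable {K : Type*} [Field K] {s : ℕ}

/-- The inverse `z_i⁻¹` of the variable of the Laurent polynomial algebra. -/
def Zinv (i : Fin s) : MvLaurent K s := AddMonoidAlgebra.single (-Pi.single i 1) 1

theorem Z_mul_Zinv (i : Fin s) : Z i * Zinv i = (1 : MvLaurent K s) := by
  simp [Z, Zinv, AddMonoidAlgebra.single_mul_single, AddMonoidAlgebra.one_def]

theorem adjoin_eq_top :
    Algebra.adjoin K (Set.range (Z (K := K) (s := s)) ∪ Set.range Zinv) = ⊤ := by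
  set S := Algebra.adjoin K (Set.range (Z (K := K) (s := s)) ∪ Set.range Zinv)
  let G : AddSubgroup (Fin s → ℤ) :=
    { carrier := {v | (AddMonoidAlgebra.single v 1 : MvLaurent K s) ∈ S ∧
        (AddMonoidAlgebra.single (-v) 1 : MvLaurent K s) ∈ S}
      zero_mem' := by
        have : (AddMonoidAlgebra.single 0 1 : MvLaurent K s) ∈ S := one_mem S
        exact ⟨this, by simpa using this⟩
      add_mem' := by
        rintro v w ⟨h1, h2⟩ ⟨h3, h4⟩
        have h5 := mul_mem h1 h3
        have h6 := mul_mem h2 h4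
        rw [AddMonoidAlgebra.single_mul_single, one_mul] at h5 h6
        exact ⟨h5, by rwa [neg_add]⟩
      neg_mem' := by
        rintro v ⟨h1, h2⟩
        exact ⟨h2, by rwa [neg_neg]⟩ }
  have hG : ∀ v : Fin s → ℤ, v ∈ G := by
    intro v
    have hv : v = ∑ i, v i • Pi.single i 1 := by
      ext j
      simp [Finset.sum_apply, Pi.single_apply]
    rw [hv]
    refine sum_mem fun i _ => zsmul_mem ?_ _
    exact ⟨Algebra.subset_adjoin (Or.inl ⟨i, rfl⟩), Algebra.subset_adjoin (Or.inr ⟨i, rfl⟩)⟩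
  rw [eq_top_iff]
  rintro f -
  induction f using AddMonoidAlgebra.induction_linear with
  | zero => exact zero_mem _
  | add f g hf hg => exact add_mem hf hg
  | single v c =>
    have := S.smul_mem (hG v).1 c
    rwa [AddMonoidAlgebra.smul_single, smul_eq_mul, mul_one] at this

variable {F : Type*} [Field F] [Algebra K F]

/-- Evaluation of Laurent polynomials at nonzero elements of a field. -/
def eval (z : Fin s → F) (hz : ∀ i, z i ≠ 0) : MvLaurent K s →ₐ[K] F :=
  AddMonoidAlgebra.lift K F (Fin s → ℤ)
    { toFun := fun v => ∏ i, z i ^ (Multiplicative.toAdd v i)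
      map_one' := by simp
      map_mul' := fun v w => by
        simp [zpow_add₀ (hz _), Finset.prod_mul_distrib] }

theorem eval_Z (z : Fin s → F) (hz : ∀ i, z i ≠ 0) (i : Fin s) :
    eval (K := K) z hz (Z i) = z i := by
  rw [eval, Z, AddMonoidAlgebra.lift_single, one_smul]
  change ∏ j, z j ^ ((Pi.single i 1 : Fin s → ℤ) j) = z i
  rw [Finset.prod_eq_single i]
  · simp
  · intro j _ hj
    simp [hj]
  · simp

theorem eval_Zinv (z : Fin s → F) (hz : ∀ i, z i ≠ 0) (i : Fin s) :
    eval (K := K) z hz (Zinv i) = (z i)⁻¹ := by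
  have h := congrArg (eval (K := K) z hz) (Z_mul_Zinv i)
  rw [map_mul, map_one, eval_Z] at h
  exact eq_inv_of_mul_eq_one_right h

variable {τ : Type*}

theorem adjoin_tensor_eq_top :
    Algebra.adjoin K (Set.range (fun a : MvLaurent K s => a ⊗ₜ[K] (1 : MvPolynomial τ K)) ∪
      Set.range fun l : τ => (1 : MvLaurent K s) ⊗ₜ[K] (MvPolynomial.X l : MvPolynomial τ K)) =
      ⊤ := by
  set S := Algebra.adjoin K (Set.range (fun a : MvLaurent K s => a ⊗ₜ[K] (1 : MvPolynomial τ K)) ∪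
      Set.range fun l : τ => (1 : MvLaurent K s) ⊗ₜ[K] (MvPolynomial.X l : MvPolynomial τ K))
  have h2 : ∀ f : MvPolynomial τ K, (1 : MvLaurent K s) ⊗ₜ[K] f ∈ S := by
    intro f
    have hle : (⊤ : Subalgebra K (MvPolynomial τ K)) ≤ S.comap
        (Algebra.TensorProduct.includeRight : MvPolynomial τ K →ₐ[K] MvLaurent K s ⊗[K] _) := by
      rw [← MvPolynomial.adjoin_range_X, Algebra.adjoin_le_iff]
      rintro _ ⟨l, rfl⟩
      exact Algebra.subset_adjoin (Or.inr ⟨l, rfl⟩)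
    exact hle (Algebra.mem_top (x := f))
  rw [eq_top_iff]
  rintro x -
  induction x using TensorProduct.induction_on with
  | zero => exact zero_mem _
  | tmul a f =>
    have := mul_mem (Algebra.subset_adjoin (Or.inl ⟨a, rfl⟩) : a ⊗ₜ[K] (1 : MvPolynomial τ K) ∈ S)
      (h2 f)
    simpa using this
  | add x y hx hy => exact add_mem hx hy

theorem adjoin_tensor_eq_top' :
    Algebra.adjoin K ((Set.range (fun i => Z i ⊗ₜ[K] (1 : MvPolynomial τ K)) ∪
      Set.range (fun i => Zinv i ⊗ₜ[K] (1 : MvPolynomial τ K))) ∪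
      Set.range fun l : τ => (1 : MvLaurent K s) ⊗ₜ[K] (MvPolynomial.X l : MvPolynomial τ K)) =
      ⊤ := by
  set S := Algebra.adjoin K ((Set.range (fun i => Z i ⊗ₜ[K] (1 : MvPolynomial τ K)) ∪
      Set.range (fun i => Zinv i ⊗ₜ[K] (1 : MvPolynomial τ K))) ∪
      Set.range fun l : τ => (1 : MvLaurent K s) ⊗ₜ[K] (MvPolynomial.X l : MvPolynomial τ K))
  have hle : (⊤ : Subalgebra K (MvLaurent K s)) ≤ S.comap
      (Algebra.TensorProduct.includeLeft : MvLaurent K s →ₐ[K] _ ⊗[K] MvPolynomial τ K) := by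
    rw [← adjoin_eq_top, Algebra.adjoin_le_iff]
    rintro _ (⟨i, rfl⟩ | ⟨i, rfl⟩)
    · exact Algebra.subset_adjoin (Or.inl (Or.inl ⟨i, rfl⟩))
    · exact Algebra.subset_adjoin (Or.inl (Or.inr ⟨i, rfl⟩))
  rw [eq_top_iff, ← adjoin_tensor_eq_top, Algebra.adjoin_le_iff]
  rintro _ (⟨a, rfl⟩ | ⟨l, rfl⟩)
  · exact hle (Algebra.mem_top (x := a))
  · exact Algebra.subset_adjoin (Or.inr ⟨l, rfl⟩)

/-- The homomorphism to a field that sends the Laurent variables to `z` and the polynomial variables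
to `x`. -/
def evalTensor (z : Fin s → F) (hz : ∀ i, z i ≠ 0) (x : τ → F) :
    MvLaurent K s ⊗[K] MvPolynomial τ K →ₐ[K] F :=
  Algebra.TensorProduct.lift (eval z hz) (MvPolynomial.aeval x) fun _ _ => Commute.all _ _

theorem evalTensor_tmul (z : Fin s → F) (hz : ∀ i, z i ≠ 0) (x : τ → F) (a : MvLaurent K s)
    (f : MvPolynomial τ K) :
    evalTensor (K := K) z hz x (a ⊗ₜ f) = eval (K := K) z hz a * MvPolynomial.aeval x f :=
  Algebra.TensorProduct.lift_tmul _ _ _ _ _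

theorem evalTensor_range (z : Fin s → F) (hz : ∀ i, z i ≠ 0) (x : τ → F) :
    (evalTensor (K := K) z hz x).range =
      Algebra.adjoin K ((Set.range z ∪ Set.range fun i => (z i)⁻¹) ∪ Set.range x) := by
  rw [← Algebra.map_top, ← adjoin_tensor_eq_top', AlgHom.map_adjoin, Set.image_union,
    Set.image_union, ← Set.range_comp, ← Set.range_comp, ← Set.range_comp]
  simp [Function.comp_def, evalTensor_tmul, eval_Z, eval_Zinv]

theorem exists_mul_eq_aeval (a : MvLaurent K s ⊗[K] MvPolynomial τ K) :
    ∃ N : ℕ, ∃ f : MvPolynomial (Fin s ⊕ τ) K,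
      a * (∏ i, Z (K := K) i ⊗ₜ[K] (1 : MvPolynomial τ K)) ^ N =
        MvPolynomial.aeval (Sum.elim (fun i => Z (K := K) i ⊗ₜ[K] (1 : MvPolynomial τ K))
          fun l => (1 : MvLaurent K s) ⊗ₜ[K] (MvPolynomial.X l : MvPolynomial τ K)) f := by
  classical
  have ha : a ∈ (⊤ : Subalgebra K (MvLaurent K s ⊗[K] MvPolynomial τ K)) := Algebra.mem_top
  set ψ := MvPolynomial.aeval (R := K) (Sum.elim (fun i => Z (K := K) i ⊗ₜ[K] (1 : MvPolynomial τ K))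
          fun l => (1 : MvLaurent K s) ⊗ₜ[K] (MvPolynomial.X l : MvPolynomial τ K)) with hψ
  have hZ : ∀ i, ψ (MvPolynomial.X (Sum.inl i)) = Z (K := K) i ⊗ₜ[K] (1 : MvPolynomial τ K) := by
    simp [hψ]
  set u := ∏ i, Z (K := K) i ⊗ₜ[K] (1 : MvPolynomial τ K) with hu
  have hψu : ψ (∏ i, MvPolynomial.X (Sum.inl i)) = u := by
    rw [map_prod, hu]
    exact Finset.prod_congr rfl fun i _ => hZ i
  rw [← adjoin_tensor_eq_top'] at ha
  induction ha using Algebra.adjoin_induction with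
  | mem x hx =>
    rcases hx with (⟨i, rfl⟩ | ⟨i, rfl⟩) | ⟨l, rfl⟩
    · exact ⟨0, MvPolynomial.X (Sum.inl i), by simp [hZ]⟩
    · refine ⟨1, ∏ j ∈ Finset.univ.erase i, MvPolynomial.X (Sum.inl j), ?_⟩
      rw [map_prod, pow_one, hu, ← Finset.mul_prod_erase _ _ (Finset.mem_univ i), ← mul_assoc]
      simp only [Algebra.TensorProduct.tmul_mul_tmul, mul_comm (Zinv (K := K) i), Z_mul_Zinv, mul_one,
        ← Algebra.TensorProduct.one_def, one_mul]
      exact Finset.prod_congr rfl fun i _ => (hZ i).symm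
    · exact ⟨0, MvPolynomial.X (Sum.inr l), by simp [hψ]⟩
  | algebraMap r => exact ⟨0, MvPolynomial.C r, by simp [← MvPolynomial.algebraMap_eq]⟩
  | add x y _ _ hx hy =>
    obtain ⟨N, f, hf⟩ := hx
    obtain ⟨N', f', hf'⟩ := hy
    refine ⟨N + N', f * (∏ i, MvPolynomial.X (Sum.inl i)) ^ N' +
      f' * (∏ i, MvPolynomial.X (Sum.inl i)) ^ N, ?_⟩
    rw [map_add, map_mul, map_mul, map_pow, map_pow, hψu, ← hf, ← hf']
    ring
  | mul x y _ _ hx hy =>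
    obtain ⟨N, f, hf⟩ := hx
    obtain ⟨N', f', hf'⟩ := hy
    refine ⟨N + N', f * f', ?_⟩
    rw [map_mul, ← hf, ← hf']
    ring

theorem evalTensor_injective {z : Fin s → F} (hz : ∀ i, z i ≠ 0) {x : τ → F}
    (h : AlgebraicIndependent K (Sum.elim z x)) :
    Function.Injective (evalTensor (K := K) z hz x) := by
  rw [injective_iff_map_eq_zero]
  intro a ha
  obtain ⟨N, f, hf⟩ := exists_mul_eq_aeval a
  have h1 : MvPolynomial.aeval (Sum.elim z x) f = 0 := by
    have h2 := congrArg (evalTensor (K := K) z hz x) hf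
    rw [map_mul, ha, zero_mul, MvPolynomial.comp_aeval_apply] at h2
    rw [h2]
    congr 2
    funext l
    rcases l with i | l <;> simp [evalTensor_tmul, eval_Z]
  have hf0 : f = 0 := (algebraicIndependent_iff.mp h) f h1
  rw [hf0, map_zero] at hf
  have hu : IsUnit ((∏ i, Z (K := K) i ⊗ₜ[K] (1 : MvPolynomial τ K)) ^ N :
      MvLaurent K s ⊗[K] MvPolynomial τ K) := by
    refine IsUnit.pow _ (IsUnit.prod_univ_iff.mpr fun i => ?_)
    refine IsUnit.of_mul_eq_one (Zinv (K := K) i ⊗ₜ 1) ?_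
    rw [Algebra.TensorProduct.tmul_mul_tmul, Z_mul_Zinv, mul_one, Algebra.TensorProduct.one_def]
  exact hu.mul_left_eq_zero.mp hf

end MvLaurent

/-! ### The structure of the localization -/

section AlgebraicIndependence

universe u v

variable {K : Type u} {R F : Type v} [Field K] [CommRing R] [Algebra K R] [Field F]
  [Algebra K F] [Algebra R F] [IsScalarTower K R F] [IsFractionRing R F]

/-- A finite family of at most `trdeg K R` elements of the fraction field `F` of `R` is
algebraically independent as soon as its elements and their inverses generate a subalgebra that
contains `R`: then `F` is algebraic over the subalgebra that they generate. -/
theorem algebraicIndependent_of_card_le_trdeg {τ : Type} [Finite τ] (x : τ → F)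
    (hcard : (Nat.card τ : Cardinal) ≤ Algebra.trdeg K R)
    (h : ∀ r : R, algebraMap R F r ∈ Algebra.adjoin K (Set.range x ∪ Set.range fun i => (x i)⁻¹)) :
    AlgebraicIndependent K x := by
  set A := Algebra.adjoin K (Set.range x)
  have hx : ∀ i, IsAlgebraic A (x i) := fun i =>
    isAlgebraic_algebraMap (⟨x i, Algebra.subset_adjoin ⟨i, rfl⟩⟩ : A)
  have hR : ∀ r : R, IsAlgebraic A (algebraMap R F r) := by
    have hle : Algebra.adjoin K (Set.range x ∪ Set.range fun i => (x i)⁻¹) ≤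
        (Subalgebra.algebraicClosure A F).restrictScalars K := by
      rw [Algebra.adjoin_le_iff]
      rintro _ (⟨i, rfl⟩ | ⟨i, rfl⟩)
      · exact hx i
      · exact (hx i).inv
    exact fun r => hle (h r)
  have : Algebra.IsAlgebraic A F := by
    refine ⟨fun w => ?_⟩
    obtain ⟨a, b, -, rfl⟩ := IsFractionRing.div_surjective (A := R) w
    rw [div_eq_mul_inv]
    exact (hR a).mul (hR b).inv
  refine (Algebra.IsAlgebraic.isTranscendenceBasis_of_lift_le_trdeg_of_finite K x ?_).1
  have h1 : Algebra.trdeg K R ≤ Algebra.trdeg K F :=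
    trdeg_le_of_injective (IsScalarTower.toAlgHom K R F) (IsFractionRing.injective R F)
  rw [← Nat.cast_card, Cardinal.lift_natCast, Cardinal.lift_uzero]
  exact hcard.trans h1

end AlgebraicIndependence

section LocalizationIso

open PoissonBracket

variable {K R F : Type*} [Field K] [CommRing R] [IsDomain R] [Algebra K R] [Field F]
  [Algebra K F] [Algebra R F] [IsScalarTower K R F] [IsFractionRing R F]

theorem exists_isPoissonIso (Q : PoissonBracket K R) (P : PoissonBracket K F)
    (hPQ : ∀ a b, P.bracket (algebraMap R F a) (algebraMap R F b) =
      algebraMap R F (Q.bracket a b))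
    {s m : ℕ} (z : Fin s → R) (hz : ∀ i, algebraMap R F (z i) ≠ 0)
    (hzc : ∀ i x, P.bracket x (algebraMap R F (z i)) = 0) (p q : Fin m → F)
    (hpp : ∀ l l', P.bracket (p l) (p l') = 0) (hqq : ∀ l l', P.bracket (q l) (q l') = 0)
    (hpq : ∀ l l', P.bracket (p l) (q l') = if l = l' then 1 else 0)
    (hind : AlgebraicIndependent K
      (Sum.elim (fun i => algebraMap R F (z i)) (Sum.elim p q)))
    (hgen : ∀ r, algebraMap R F r ∈ Algebra.adjoin K
      ((Set.range (fun i => algebraMap R F (z i)) ∪ Set.range fun i => (algebraMap R F (z i))⁻¹) ∪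
        Set.range (Sum.elim p q)))
    (hloc : ∀ l, Sum.elim p q l ∈ Algebra.adjoin K
      (Set.range (algebraMap R F) ∪ Set.range fun i => (algebraMap R F (z i))⁻¹)) :
    ∃ φ : Localization (Submonoid.closure (Set.range z)) ≃ₐ[K]
        MvLaurent K s ⊗[K] MvPolynomial (Fin m ⊕ Fin m) K,
      IsPoissonIso (Q.localization (Submonoid.closure (Set.range z)))
        ((PoissonBracket.zero K (MvLaurent K s)).tensor (canonical K m)) φ ∧
      ∀ i, φ (algebraMap R _ (z i)) = MvLaurent.Z i ⊗ₜ[K] 1 := by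
  set S := Submonoid.closure (Set.range z)
  have hS : ∀ y : S, IsUnit (IsScalarTower.toAlgHom K R F y) := by
    rintro ⟨y, hy⟩
    rw [isUnit_iff_ne_zero]
    change algebraMap R F y ≠ 0
    induction hy using Submonoid.closure_induction with
    | mem y hy =>
      obtain ⟨i, rfl⟩ := hy
      exact hz i
    | one => simp
    | mul y y' _ _ h h' => rw [map_mul]; exact mul_ne_zero h h'
  let j : Localization S →ₐ[K] F := IsLocalization.liftAlgHom (M := S) hS
  have hj : ∀ r, j (algebraMap R _ r) = algebraMap R F r := fun r => IsLocalization.lift_eq _ r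
  have hj_inj : Function.Injective j := by
    refine (IsLocalization.lift_injective_iff _).mpr fun a b => ?_
    have hSR : S ≤ nonZeroDivisors R := fun y hy => mem_nonZeroDivisors_of_ne_zero fun h0 => by
      have := hS ⟨y, hy⟩
      simp [h0] at this
    rw [(IsLocalization.injective (Localization S) hSR).eq_iff]
    exact (IsFractionRing.injective R F).eq_iff.symm
  set θ := MvLaurent.evalTensor (K := K) (fun i => algebraMap R F (z i)) hz (Sum.elim p q) with hθ
  have hθ_inj : Function.Injective θ := MvLaurent.evalTensor_injective hz hind
  have hrange : j.range = θ.range := by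
    have hθr := MvLaurent.evalTensor_range (K := K) _ hz (Sum.elim p q)
    apply le_antisymm
    · rintro _ ⟨x, rfl⟩
      obtain ⟨a, ⟨y, hy⟩, rfl⟩ := IsLocalization.exists_mk'_eq S x
      have h1 := congrArg j (IsLocalization.mk'_spec (Localization S) a ⟨y, hy⟩)
      rw [map_mul, hj, hj, ← eq_div_iff (show algebraMap R F y ≠ 0 from (hS ⟨y, hy⟩).ne_zero), div_eq_mul_inv] at h1
      change j _ ∈ θ.range
      rw [h1]
      refine mul_mem (hθr ▸ hgen a) ?_
      change (algebraMap R F y)⁻¹ ∈ θ.range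
      clear h1
      induction hy using Submonoid.closure_induction with
      | mem y hy =>
        obtain ⟨i, rfl⟩ := hy
        rw [hθr]
        exact Algebra.subset_adjoin (Or.inl (Or.inr ⟨i, rfl⟩))
      | one => simp
      | mul y y' _ _ h h' =>
        rw [map_mul, mul_inv]
        exact mul_mem h h'
    · have hinv : ∀ i, (algebraMap R F (z i))⁻¹ ∈ j.range := by
        intro i
        have hzi : z i ∈ S := Submonoid.subset_closure ⟨i, rfl⟩
        refine ⟨IsLocalization.mk' _ 1 ⟨z i, hzi⟩, ?_⟩
        have h1 := congrArg j (IsLocalization.mk'_spec (Localization S) 1 ⟨z i, hzi⟩)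
        rw [map_mul, hj, hj, map_one] at h1
        exact eq_inv_of_mul_eq_one_left h1
      rw [hθr, Algebra.adjoin_le_iff]
      rintro _ ((⟨i, rfl⟩ | ⟨i, rfl⟩) | ⟨l, rfl⟩)
      · exact ⟨_, hj (z i)⟩
      · exact hinv i
      · refine Algebra.adjoin_le_iff.mpr ?_ (hloc l)
        rintro _ (⟨r, rfl⟩ | ⟨i, rfl⟩)
        · exact ⟨_, hj r⟩
        · exact hinv i
  have hjP := fun x y => map_bracket_localization Q P S j
    (fun a b => by rw [hj, hj, hj, hPQ]) x y
  have hzc' : ∀ i x, P.bracket (algebraMap R F (z i)) x = 0 := fun i x => by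
    rw [P.skew, hzc, neg_zero]
  have heval : ∀ (a : MvLaurent K s) x, P.bracket (θ (a ⊗ₜ 1)) x = 0 := by
    intro a x
    rw [P.skew, neg_eq_zero]
    have hle : (⊤ : Subalgebra K (MvLaurent K s)) ≤
        (P.centralizer {x}).comap (MvLaurent.eval _ hz) := by
      rw [← MvLaurent.adjoin_eq_top, Algebra.adjoin_le_iff]
      rintro _ (⟨i, rfl⟩ | ⟨i, rfl⟩)
      · change MvLaurent.eval _ hz (MvLaurent.Z i) ∈ P.centralizer {x}
        rw [MvLaurent.eval_Z, mem_centralizer_singleton, hzc]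
      · change MvLaurent.eval _ hz (MvLaurent.Zinv i) ∈ P.centralizer {x}
        rw [MvLaurent.eval_Zinv, mem_centralizer_singleton]
        exact P.bracket_eq_zero_of_mul_eq_one (mul_inv_cancel₀ (hz i)) (hzc i x)
    have := hle (Algebra.mem_top (x := a))
    rw [hθ, MvLaurent.evalTensor_tmul, map_one, mul_one]
    exact P.mem_centralizer_singleton.mp this
  have hθP : ∀ a b, θ (((PoissonBracket.zero K (MvLaurent K s)).tensor (canonical K m)).bracket a b)
      = P.bracket (θ a) (θ b) := by
    intro a b
    refine map_bracket_of_generators _ P θ MvLaurent.adjoin_tensor_eq_top ?_ a b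
    have hX : ∀ l, θ (1 ⊗ₜ MvPolynomial.X l) = Sum.elim p q l := by
      intro l
      simp [hθ, MvLaurent.evalTensor_tmul]
    rintro _ (⟨a, rfl⟩ | ⟨l, rfl⟩) y hy
    · rw [tensor_bracket_tmul_one, map_zero, heval]
    · rcases hy with ⟨a, rfl⟩ | ⟨l', rfl⟩
      · simp only
        rw [skew, P.skew, tensor_bracket_tmul_one, map_neg, map_zero, heval]
      · simp only [tensor_bracket_one_tmul, canonical_bracket_X, hX]
        rcases l with l | l <;> rcases l' with l' | l'
        · simp [hpp]
        · simp only [Sum.elim_inl, Sum.elim_inr, hpq]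
          split_ifs <;> simp [← Algebra.TensorProduct.one_def]
        · simp only [Sum.elim_inl, Sum.elim_inr]
          rw [P.skew, hpq]
          simp only [eq_comm (a := l')]
          split_ifs <;> simp [← Algebra.TensorProduct.one_def, TensorProduct.tmul_neg]
        · simp [hqq]
  let φ := ((AlgEquiv.ofInjective j hj_inj).trans (Subalgebra.equivOfEq _ _ hrange)).trans
    (AlgEquiv.ofInjective θ hθ_inj).symm
  have hφ : ∀ x, θ (φ x) = j x := by
    intro x
    have := (AlgEquiv.ofInjective θ hθ_inj).apply_symm_apply
      (Subalgebra.equivOfEq _ _ hrange (AlgEquiv.ofInjective j hj_inj x))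
    exact congrArg Subtype.val this
  refine ⟨φ, fun a b => hθ_inj ?_, fun i => hθ_inj ?_⟩
  · rw [hφ, hθP, hφ, hφ, hjP]
  · rw [hφ, hj, hθ, MvLaurent.evalTensor_tmul, MvLaurent.eval_Z, map_one, mul_one]

end LocalizationIso

section

universe u v

open PoissonBracket

/-- When no empty place is left, the bookkeeping of the reduction describes the localization. -/
theorem ReductionState.exists_isPoissonIso {K : Type u} {R F : Type v} [Field K] [CommRing R]
    [IsDomain R] [Algebra K R] [Field F] [Algebra K F] [Algebra R F] [IsScalarTower K R F]
    [IsFractionRing R F] {α : Type} [LinearOrder α] {Q : PoissonBracket K R}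
    {P : PoissonBracket K F} {y : α → α → R} {N : ℕ} {pivot : ℕ → α → α → Prop}
    {E : α → α → Prop} {s : ℕ} {z : ℕ → R} {ι : Type} [Fintype ι] {p q : ι → F} {Y : α → α → F}
    (h : ReductionState P y N pivot E s z p q Y) (hE : ∀ a b, ¬ E a b)
    (hPQ : ∀ a b, P.bracket (algebraMap R F a) (algebraMap R F b) =
      algebraMap R F (Q.bracket a b))
    (hN : (N : Cardinal) ≤ Algebra.trdeg K R) {z' : Fin s → R} (hz' : ∀ i, z' i = z i) :
    ∃ (m : ℕ) (φ : Localization (Submonoid.closure (Set.range z')) ≃ₐ[K]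
        MvLaurent K s ⊗[K] MvPolynomial (Fin m ⊕ Fin m) K),
      IsPoissonIso (Q.localization (Submonoid.closure (Set.range z')))
        ((PoissonBracket.zero K (MvLaurent K s)).tensor (canonical K m)) φ ∧
      ∀ i, φ (algebraMap R _ (z' i)) = MvLaurent.Z i ⊗ₜ[K] 1 := by
  let e := Fintype.equivFin ι
  have hz0 : ∀ i, algebraMap R F (z' i) ≠ 0 := fun i => hz' i ▸ h.ne_zero i i.2
  have hp : ∀ l, p l ∈ Set.range (Sum.elim (p ∘ e.symm) (q ∘ e.symm)) := fun l =>
    ⟨Sum.inl (e l), by simp⟩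
  have hq : ∀ l, q l ∈ Set.range (Sum.elim (p ∘ e.symm) (q ∘ e.symm)) := fun l =>
    ⟨Sum.inr (e l), by simp⟩
  have hgen : ∀ r, algebraMap R F r ∈ Algebra.adjoin K
      ((Set.range (fun i => algebraMap R F (z' i)) ∪
        Set.range fun i => (algebraMap R F (z' i))⁻¹) ∪
        Set.range (Sum.elim (p ∘ e.symm) (q ∘ e.symm))) := by
    refine fun r => (?_ : genAlg K z s p q Y ≤ _) (h.gen r)
    rw [genAlg, Algebra.adjoin_le_iff]
    rintro x (((⟨j, hj, rfl | rfl⟩ | ⟨l, rfl⟩) | ⟨l, rfl⟩) | ⟨a, b, rfl⟩)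
    · exact Algebra.subset_adjoin (Or.inl (Or.inl ⟨⟨j, hj⟩, by simp [hz']⟩))
    · exact Algebra.subset_adjoin (Or.inl (Or.inr ⟨⟨j, hj⟩, by simp [hz']⟩))
    · exact Algebra.subset_adjoin (Or.inr (hp l))
    · exact Algebra.subset_adjoin (Or.inr (hq l))
    · rw [h.root.zero (hE a b)]
      exact zero_mem _
  refine ⟨Fintype.card ι, _root_.exists_isPoissonIso Q P hPQ z' hz0
    (fun i x => by rw [hz', h.central i i.2]) (p ∘ e.symm) (q ∘ e.symm)
    (fun _ _ => h.bracket_pp _ _) (fun _ _ => h.bracket_qq _ _) (fun l l' => ?_) ?_ hgen ?_⟩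
  · simp [h.bracket_pq]
  · refine algebraicIndependent_of_card_le_trdeg (R := R) _ (le_trans (Nat.cast_le.mpr ?_) hN) ?_
    · have : IsEmpty {x : α × α // E x.1 x.2} := ⟨fun x => hE _ _ x.2⟩
      have := h.card
      simp only [Nat.card_of_isEmpty, Nat.card_eq_fintype_card, Fintype.card_sum,
        Fintype.card_fin] at this ⊢
      omega
    · refine fun r => Algebra.adjoin_mono ?_ (hgen r)
      rintro x ((⟨i, rfl⟩ | ⟨i, rfl⟩) | ⟨l, rfl⟩)
      · exact Or.inl ⟨Sum.inl i, rfl⟩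
      · exact Or.inr ⟨Sum.inl i, rfl⟩
      · exact Or.inl ⟨Sum.inr l, rfl⟩
  · intro l
    have hl : Sum.elim (p ∘ e.symm) (q ∘ e.symm) l ∈ genAlg K z s p q Y := by
      apply Algebra.subset_adjoin
      rcases l with l | l
      · exact Or.inl (Or.inl (Or.inr ⟨_, rfl⟩))
      · exact Or.inl (Or.inr ⟨_, rfl⟩)
    refine Algebra.adjoin_mono ?_ (h.le_locAlg hl)
    rintro x (⟨r, -, rfl⟩ | ⟨j, hj, rfl⟩)
    · exact Or.inl ⟨r, rfl⟩
    · exact Or.inr ⟨⟨j, hj⟩, by simp [hz']⟩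

end

/-! ### The symmetric algebra of the quotient -/

section MatrixUnits

variable {K : Type*} [Field K] {n : ℕ}

attribute [local instance] LieRing.ofAssociativeRing

variable (K) in
/-- The matrix unit `e_{ab}` as an element of `𝔫`; it is zero unless `b < a`. -/
def utUnit (a b : Fin n) : ut K n := if h : b < a then rootVector ⟨(a, b), h⟩ else 0

theorem utUnit_of_lt {a b : Fin n} (h : b < a) : utUnit K a b = rootVector ⟨(a, b), h⟩ := dif_pos h

theorem coe_utUnit {a b : Fin n} (h : b < a) :
    (utUnit K a b : Matrix (Fin n) (Fin n) K) = Matrix.single a b 1 := by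
  rw [utUnit_of_lt h]
  rfl

theorem lie_utUnit {a b c d : Fin n} (hba : b < a) (hdc : d < c) :
    ⁅utUnit K a b, utUnit K c d⁆ =
      (if b = c then utUnit K a d else 0) - (if a = d then utUnit K c b else 0) := by
  apply Subtype.ext
  rw [LieSubalgebra.coe_bracket, LieRing.of_associative_ring_bracket, coe_utUnit hba,
    coe_utUnit hdc, AddSubgroupClass.coe_sub]
  congr 1
  · split_ifs with h
    · subst h
      rw [coe_utUnit (hdc.trans hba), Matrix.single_mul_single_same, mul_one]
    · rw [Matrix.single_mul_single_of_ne _ _ _ _ h]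
      rfl
  · split_ifs with h
    · subst h
      rw [coe_utUnit (hba.trans hdc), Matrix.single_mul_single_same, mul_one]
    · rw [Matrix.single_mul_single_of_ne _ _ _ _ (Ne.symm h)]
      rfl

theorem eq_sum_rootVector (x : ut K n) :
    x = ∑ η : Place n, x.1 η.row η.col • (rootVector η : ut K n) := by
  apply Subtype.ext
  ext i j
  rw [AddSubmonoidClass.coe_finsetSum, Matrix.sum_apply]
  rcases lt_or_ge j i with hij | hij
  · rw [Finset.sum_eq_single ⟨(i, j), hij⟩]
    · simp [rootVector]
    · intro η _ hη
      have : ¬(η.row = i ∧ η.col = j) := by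
        rintro ⟨rfl, rfl⟩
        exact hη rfl
      simp [rootVector, this]
    · simp
  · rw [x.2 i j hij, Finset.sum_eq_zero]
    intro η _
    have : ¬(η.row = i ∧ η.col = j) := by
      rintro ⟨rfl, rfl⟩
      exact absurd η.2 (not_lt.mpr hij)
    simp [rootVector, this]

theorem rootVector_apply (ξ η : Place n) :
    (rootVector ξ : ut K n).1 η.row η.col = if η = ξ then 1 else 0 := by
  change Matrix.single ξ.row ξ.col (1 : K) η.row η.col = _
  rw [Matrix.single_apply]
  refine if_congr ⟨fun h => Subtype.ext (Prod.ext h.1.symm h.2.symm), ?_⟩ rfl rfl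
  rintro rfl
  exact ⟨rfl, rfl⟩

end MatrixUnits

namespace RootIdeal

variable {K : Type*} [Field K] {n : ℕ} (I : RootIdeal K n)

theorem rootVector_mem_of_mem {ξ : Place n} (h : ξ ∈ I.places) : rootVector ξ ∈ I.ideal := by
  have : (rootVector ξ : ut K n) ∈ I.ideal.toSubmodule := by
    rw [I.span_eq]
    exact Submodule.subset_span ⟨ξ, h, rfl⟩
  exact this

theorem apply_eq_zero_of_mem {x : ut K n} (hx : x ∈ I.ideal) {η : Place n} (hη : η ∉ I.places) :
    x.1 η.row η.col = 0 := by
  have hx' : x ∈ Submodule.span K (rootVector '' (I.places : Set (Place n))) := I.span_eq ▸ hx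
  clear hx
  induction hx' using Submodule.span_induction with
  | mem x h =>
    obtain ⟨ξ, hξ, rfl⟩ := h
    rw [rootVector_apply, if_neg]
    rintro rfl
    exact hη hξ
  | zero => rfl
  | add x y hx hy h1 h2 =>
    change x.1 _ _ + y.1 _ _ = 0
    rw [h1, h2, add_zero]
  | smul c x hx h1 =>
    change c * x.1 _ _ = 0
    rw [h1, mul_zero]

theorem mem_places_iff {ξ : Place n} : ξ ∈ I.places ↔ (rootVector ξ : ut K n) ∈ I.ideal := by
  refine ⟨I.rootVector_mem_of_mem, fun h => ?_⟩
  by_contra hξ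
  have := I.apply_eq_zero_of_mem h hξ
  rw [rootVector_apply, if_pos rfl] at this
  exact one_ne_zero this

/-- The quotient map `𝔫 → 𝓛`, as a linear map. -/
def mkQuot : ut K n →ₗ[K] I.Quot := I.ideal.toSubmodule.mkQ

theorem mkQuot_surjective : Function.Surjective I.mkQuot := I.ideal.toSubmodule.mkQ_surjective

theorem mkQuot_eq_zero {x : ut K n} : I.mkQuot x = 0 ↔ x ∈ I.ideal :=
  Submodule.Quotient.mk_eq_zero _

theorem y_eq (ξ : Place n) : I.y ξ = SymmetricAlgebra.ι K I.Quot (I.mkQuot (rootVector ξ)) := rfl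

theorem y_eq_zero {ξ : Place n} (h : ξ ∈ I.places) : I.y ξ = 0 := by
  rw [y_eq, I.mkQuot_eq_zero.mpr (I.rootVector_mem_of_mem h), map_zero]

/-- The matrix entry at a place outside of `M`, as a linear function on `𝓛`. -/
def entry (η : {η : Place n // η ∉ I.places}) : I.Quot →ₗ[K] K :=
  I.ideal.toSubmodule.liftQ
    { toFun := fun x => x.1 η.1.row η.1.col
      map_add' := fun _ _ => rfl
      map_smul' := fun _ _ => rfl }
    fun _ hx => I.apply_eq_zero_of_mem hx η.2

theorem entry_mkQuot (η : {η : Place n // η ∉ I.places}) (x : ut K n) :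
    I.entry η (I.mkQuot x) = x.1 η.1.row η.1.col :=
  Submodule.liftQ_apply _ _ _

theorem sum_entry_smul (x : I.Quot) : ∑ η, I.entry η x • I.mkQuot (rootVector η.1) = x := by
  obtain ⟨x, rfl⟩ := I.mkQuot_surjective x
  conv_rhs => rw [eq_sum_rootVector x, map_sum]
  have h : ∀ η : Place n, I.mkQuot (x.1 η.row η.col • rootVector η) =
      x.1 η.row η.col • I.mkQuot (rootVector η) := fun η => map_smul _ _ _
  simp only [h, entry_mkQuot]
  rw [← Finset.sum_filter_of_ne (p := fun η => η ∉ I.places) fun η _ hη hM =>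
    hη (by rw [I.mkQuot_eq_zero.mpr (I.rootVector_mem_of_mem hM), smul_zero])]
  have hp : ∀ η, η ∈ Finset.univ.filter (fun η => η ∉ I.places) ↔ η ∉ I.places := by simp
  rw [Finset.sum_subtype _ hp]

/-- The basis of `𝓛` formed by the images of the root vectors at the places outside of `M`. -/
def basis : Module.Basis {η : Place n // η ∉ I.places} K I.Quot :=
  Module.Basis.ofEquivFun
    { toFun := fun x η => I.entry η x
      map_add' := fun x y => by ext; simp
      map_smul' := fun c x => by ext; simp
      invFun := fun f => ∑ η, f η • I.mkQuot (rootVector η.1)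
      left_inv := I.sum_entry_smul
      right_inv := fun f => by
        ext η
        simp only [map_sum, map_smul, entry_mkQuot, rootVector_apply, smul_eq_mul, mul_ite, mul_one,
          mul_zero]
        rw [Finset.sum_eq_single η]
        · simp
        · intro ζ _ hζ
          exact if_neg fun h => hζ (Subtype.ext h.symm)
        · simp }

theorem basis_apply (η : {η : Place n // η ∉ I.places}) :
    I.basis η = I.mkQuot (rootVector η.1) := by
  classical
  rw [basis, Module.Basis.coe_ofEquivFun]
  change ∑ ζ, (Pi.single η 1 : _ → K) ζ • I.mkQuot (rootVector ζ.1) = _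
  rw [Finset.sum_eq_single η]
  · simp
  · intro ζ _ hζ
    simp [hζ]
  · simp

theorem card_le_trdeg :
    (Nat.card {η : Place n // η ∉ I.places} : Cardinal) ≤ Algebra.trdeg K I.Sym := by
  rw [(SymmetricAlgebra.equivMvPolynomial I.basis).trdeg_eq, MvPolynomial.trdeg_of_isDomain,
    ← Nat.cast_card, Cardinal.lift_natCast]

/-- The elements `y_{ab}` of `S(𝓛)`, extended by zero to all pairs `(a, b)`. -/
def yMatrix (a b : Fin n) : I.Sym := SymmetricAlgebra.ι K I.Quot (I.mkQuot (utUnit K a b))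

theorem yMatrix_of_lt {a b : Fin n} (h : b < a) : I.yMatrix a b = I.y ⟨(a, b), h⟩ := by
  rw [yMatrix, utUnit_of_lt h, y_eq]

theorem yMatrix_place (ξ : Place n) : I.yMatrix ξ.row ξ.col = I.y ξ := I.yMatrix_of_lt ξ.2

/-- The set `M`, as a relation between rows and columns. -/
def placeRel (a b : Fin n) : Prop := ∃ h : b < a, (⟨(a, b), h⟩ : Place n) ∈ I.places

theorem emptyRel_start :
    (Diagram.start I.places).emptyRel = fun a b => b < a ∧ ¬ I.placeRel a b := by
  funext a b
  apply propext
  simp only [Diagram.emptyRel, placeRel, Diagram.start, not_exists, ite_eq_right_iff, reduceCtorEq,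
    imp_false]
  exact ⟨fun ⟨h, h'⟩ => ⟨h, fun _ => h'⟩, fun ⟨h, h'⟩ => ⟨h, h' h⟩⟩

theorem isEmptyPattern_start :
    IsEmptyPattern I.placeRel (Diagram.start I.places).emptyRel := by
  rw [emptyRel_start]
  refine IsEmptyPattern.of_compl ?_
  rintro a b a' b' ⟨h, hM⟩ ha hb
  refine ⟨(hb.trans_lt h).trans_le ha, ?_⟩
  rw [mem_places_iff] at hM ⊢
  exact I.rootVector_mem hM ha hb

theorem yMatrix_eq_zero {a b : Fin n} (h : ¬ (Diagram.start I.places).emptyRel a b) :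
    I.yMatrix a b = 0 := by
  rw [emptyRel_start] at h
  by_cases hab : b < a
  · rw [yMatrix_of_lt _ hab]
    refine I.y_eq_zero (by_contra fun hM => h ⟨hab, fun h' => hM h'.2⟩)
  · rw [yMatrix, utUnit, dif_neg hab, map_zero, map_zero]

theorem bracket_yMatrix {a b c d : Fin n} (hba : b < a) (hdc : d < c) :
    (PoissonBracket.liePoisson K I.Quot).bracket (I.yMatrix a b) (I.yMatrix c d) =
      (if b = c then I.yMatrix a d else 0) - (if a = d then I.yMatrix c b else 0) := by
  have h : ⁅I.mkQuot (utUnit K a b), I.mkQuot (utUnit K c d)⁆ =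
      I.mkQuot ⁅utUnit K a b, utUnit K c d⁆ := by
    exact (LieSubmodule.Quotient.mk_bracket (I := I.ideal) (utUnit K a b) (utUnit K c d)).symm
  rw [yMatrix, yMatrix, PoissonBracket.liePoisson_ι, h, lie_utUnit hba hdc, map_sub, map_sub]
  congr 1 <;> split_ifs <;> simp [yMatrix]

theorem adjoin_yMatrix_eq_top :
    Algebra.adjoin K {x : I.Sym | ∃ a b, x = I.yMatrix a b} = ⊤ := by
  rw [eq_top_iff]
  rintro r -
  induction r using SymmetricAlgebra.induction with
  | algebraMap c => exact Subalgebra.algebraMap_mem _ c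
  | ι x =>
    obtain ⟨x, rfl⟩ := I.mkQuot_surjective x
    rw [eq_sum_rootVector x, map_sum, map_sum]
    refine sum_mem fun η _ => ?_
    rw [map_smul, map_smul]
    exact Subalgebra.smul_mem _
      (Algebra.subset_adjoin (show _ ∈ {x : I.Sym | ∃ a b, x = I.yMatrix a b} from
        ⟨η.row, η.col, (I.yMatrix_place η).symm⟩)) _
  | mul a b ha hb => exact mul_mem ha hb
  | add a b ha hb => exact add_mem ha hb

/-- `y_{kt}` is transcendental over the variables greater than it, in the form in which
this is used. -/
theorem eq_zero_of_yMatrix_mul_add_eq_zero {k t : Fin n} (htk : t < k) (hM : ¬ I.placeRel k t)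
    {u v : I.Sym} (hu : u ∈ above K I.yMatrix k t) (hv : v ∈ above K I.yMatrix k t)
    (h : I.yMatrix k t * u + v = 0) : u = 0 := by
  classical
  set ξ : {η : Place n // η ∉ I.places} := ⟨⟨(k, t), htk⟩, fun h => hM ⟨htk, h⟩⟩
  -- The substitution `y_{kt} ↦ 0` fixes all greater variables, so it maps the relation to `v = 0`.
  let σ : I.Sym →ₐ[K] I.Sym := SymmetricAlgebra.lift
    (I.basis.constr K fun η => if η = ξ then 0 else SymmetricAlgebra.ι K I.Quot (I.basis η))
  have hσb : ∀ η, σ (I.y η.1) = if η = ξ then 0 else I.y η.1 := by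
    intro η
    simp only [σ]
    rw [y_eq, ← basis_apply, SymmetricAlgebra.lift_ι_apply, Module.Basis.constr_basis]
  have hξ : I.yMatrix k t = I.y ξ.1 := I.yMatrix_of_lt htk
  have hσ : above K I.yMatrix k t ≤ AlgHom.equalizer σ (AlgHom.id K _) := by
    rw [above, Algebra.adjoin_le_iff]
    rintro _ ⟨c, d, hdc, hcd, rfl⟩
    change σ _ = _
    rw [yMatrix_of_lt _ hdc]
    by_cases hcM : (⟨(c, d), hdc⟩ : Place n) ∈ I.places
    · rw [I.y_eq_zero hcM, map_zero, map_zero]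
    · rw [hσb ⟨_, hcM⟩, if_neg]
      · rfl
      · intro h
        have h1 : (c, d) = (k, t) := congrArg (fun η : {η : Place n // η ∉ I.places} => η.1.1) h
        obtain ⟨rfl, rfl⟩ := Prod.mk.inj h1
        rcases hcd with h | h
        · exact lt_irrefl _ h
        · exact lt_irrefl _ h.2
  have h1 := congrArg σ h
  rw [map_add, map_mul, hξ, hσb, if_pos rfl, zero_mul, zero_add, map_zero,
    show σ v = v from hσ hv] at h1
  rw [h1, add_zero, hξ] at h
  refine (mul_eq_zero.mp h).resolve_left fun h0 => ?_
  have h2 := congrArg (SymmetricAlgebra.equivMvPolynomial I.basis) h0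
  rw [y_eq, ← basis_apply, SymmetricAlgebra.equivMvPolynomial_ι_apply, map_zero] at h2
  exact MvPolynomial.X_ne_zero _ h2

/-- Before the first step, all of `S(𝓛)` is generated by the elements `y_{ab}`. -/
theorem reductionState_zero {N : ℕ} (hN : N = Nat.card {η : Place n // η ∉ I.places})
    (pivot : ℕ → Fin n → Fin n → Prop) (z : ℕ → I.Sym) :
    ReductionState ((PoissonBracket.liePoisson K I.Quot).localization (nonZeroDivisors I.Sym))
      I.yMatrix N pivot (Diagram.start I.places).emptyRel 0 z
      (Empty.elim : Empty → FractionRing I.Sym) (Empty.elim : Empty → FractionRing I.Sym)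
      (fun a b => algebraMap I.Sym (FractionRing I.Sym) (I.yMatrix a b)) where
  root :=
    { zero := fun h => by rw [I.yMatrix_eq_zero h, map_zero]
      law := fun h h' => by
        refine (PoissonBracket.localization_algebraMap _ _ _ _).trans ?_
        rw [I.bracket_yMatrix (I.isEmptyPattern_start.lt h) (I.isEmptyPattern_start.lt h'), map_sub]
        congr 1 <;> split_ifs <;> simp }
  ne_zero := fun _ h => absurd h (Nat.not_lt_zero _)
  central := fun _ h => absurd h (Nat.not_lt_zero _)
  bracket_pp := fun l => l.elim
  bracket_qq := fun l => l.elim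
  bracket_pq := fun l => l.elim
  bracket_pY := fun l => l.elim
  bracket_qY := fun l => l.elim
  gen := fun r => by
    have hle : (⊤ : Subalgebra K I.Sym) ≤ (genAlg K z 0 (Empty.elim : Empty → FractionRing I.Sym)
        (Empty.elim : Empty → FractionRing I.Sym)
        (fun a b => algebraMap I.Sym (FractionRing I.Sym) (I.yMatrix a b))).comap
        (IsScalarTower.toAlgHom K I.Sym (FractionRing I.Sym)) := by
      rw [← adjoin_yMatrix_eq_top, Algebra.adjoin_le_iff]
      rintro _ ⟨a, b, rfl⟩
      exact Algebra.subset_adjoin (Or.inr ⟨a, b, rfl⟩)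
    exact hle (Algebra.mem_top (x := r))
  le_locAlg := by
    rw [genAlg, Algebra.adjoin_le_iff]
    rintro x (((⟨j, hj, -⟩ | ⟨l, rfl⟩) | ⟨l, rfl⟩) | ⟨a, b, rfl⟩)
    · exact absurd hj (Nat.not_lt_zero _)
    · exact l.elim
    · exact l.elim
    · exact algebraMap_mem_locAlg Algebra.mem_top
  card := by
    rw [hN, Fintype.card_empty, mul_zero, zero_add, zero_add, emptyRel_start]
    refine Nat.card_congr
      { toFun := fun x => ⟨⟨x.1, x.2.1⟩, fun h => x.2.2 ⟨x.2.1, h⟩⟩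
        invFun := fun η => ⟨η.1.1, η.1.2, fun h => η.2 h.2⟩
        left_inv := fun _ => rfl
        right_inv := fun _ => rfl }
  triangular := fun _ => by
    rw [sub_self]
    exact zero_mem _
  mem_above := fun _ _ h => absurd h (Nat.not_lt_zero _)
  form := fun _ h => absurd h (Nat.not_lt_zero _)

end RootIdeal

/-! ### Central elements are invariant -/

section Exponential

open PoissonBracket Polynomial

variable {K 𝔤 : Type*} [Field K] [LieRing 𝔤] [LieAlgebra K 𝔤]

/-- The homomorphism `S(𝔤) → K[T]` that restricts a polynomial on `𝔤*` to the line
`T ↦ f + T (f ∘ ad c)`. -/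
def lineEval (f : Module.Dual K 𝔤) (c : 𝔤) : SymmetricAlgebra K 𝔤 →ₐ[K] K[X] :=
  SymmetricAlgebra.lift
    ((Algebra.linearMap K K[X]) ∘ₗ f +
      LinearMap.mulLeft K X ∘ₗ (Algebra.linearMap K K[X]) ∘ₗ f ∘ₗ
        (LieAlgebra.ad K 𝔤 c : 𝔤 →ₗ[K] 𝔤))

theorem lineEval_ι (f : Module.Dual K 𝔤) (c x : 𝔤) :
    lineEval f c (SymmetricAlgebra.ι K 𝔤 x) = C (f x) + X * C (f ⁅c, x⁆) := by
  rw [lineEval, SymmetricAlgebra.lift_ι_apply]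
  rfl

theorem derivative_lineEval {c : 𝔤} (hc : ∀ x : 𝔤, ⁅c, ⁅c, x⁆⁆ = 0) (f : Module.Dual K 𝔤)
    (F : SymmetricAlgebra K 𝔤) :
    derivative (lineEval f c F) =
      lineEval f c ((liePoisson K 𝔤).bracket (SymmetricAlgebra.ι K 𝔤 c) F) := by
  induction F using SymmetricAlgebra.induction with
  | algebraMap r =>
    rw [AlgHom.commutes, Algebra.algebraMap_eq_smul_one (A := SymmetricAlgebra K 𝔤),
      LinearMap.map_smul, bracket_one, smul_zero, map_zero]
    exact derivative_C
  | ι x => simp [liePoisson_ι, lineEval_ι, hc]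
  | mul a b ha hb => rw [map_mul, derivative_mul, ha, hb, leibniz, map_add, map_mul, map_mul]
  | add a b ha hb => rw [map_add, map_add, map_add, ha, hb, map_add]

/-- A function that Poisson-commutes with `c`, where `(ad c)² = 0`, is invariant under
`exp (ad c) = 1 + ad c`: its derivative along each line `T ↦ f + T (f ∘ ad c)` vanishes. -/
theorem lift_comp_eq_of_bracket_eq_zero [CharZero K] {c : 𝔤} (hc : ∀ x : 𝔤, ⁅c, ⁅c, x⁆⁆ = 0)
    {F : SymmetricAlgebra K 𝔤} (hF : (liePoisson K 𝔤).bracket (SymmetricAlgebra.ι K 𝔤 c) F = 0)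
    (f : Module.Dual K 𝔤) {T : 𝔤 →ₗ[K] 𝔤} (hT : ∀ x, T x = x + ⁅c, x⁆) :
    SymmetricAlgebra.lift (f ∘ₗ T) F = SymmetricAlgebra.lift f F := by
  have h0 : (aeval (0 : K)).comp (lineEval f c) = SymmetricAlgebra.lift f := by
    apply SymmetricAlgebra.algHom_ext
    ext x
    simp [lineEval_ι]
  have h1 : (aeval (1 : K)).comp (lineEval f c) = SymmetricAlgebra.lift (f ∘ₗ T) := by
    apply SymmetricAlgebra.algHom_ext
    ext x
    simp [lineEval_ι, hT]
  have hconst : derivative (lineEval f c F) = 0 := by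
    rw [derivative_lineEval hc, hF, map_zero]
  have h2 := eq_C_of_natDegree_eq_zero (derivative_eq_zero.mp hconst)
  rw [← h0, ← h1, AlgHom.comp_apply, AlgHom.comp_apply, h2, aeval_C, aeval_C]

end Exponential

section Unitriangular

attribute [local instance] LieRing.ofAssociativeRing

variable {K : Type*} [Field K] {n : ℕ}

/-- The element `1 + C` of `UT(n, K)`, where `C ∈ 𝔫` has square zero. -/
def oneAdd (C : ut K n) (hC : C.1 * C.1 = 0) : UT K n where
  val :=
    { val := 1 + C.1
      inv := 1 - C.1
      val_inv := by rw [add_mul, mul_sub, mul_sub, hC]; simp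
      inv_val := by rw [sub_mul, mul_add, mul_add, hC]; simp }
  property := ⟨fun i j h => by simp [C.2 i j h.le, h.ne], fun i => by simp [C.2 i i le_rfl]⟩

/-- The part of column `j` of a matrix below the diagonal. -/
def columnPart (g : Matrix (Fin n) (Fin n) K) (j : Fin n) : ut K n :=
  ⟨Matrix.of fun a b => if b = j ∧ j < a then g a j else 0, fun a b hab => by
    rw [Matrix.of_apply, if_neg]
    rintro ⟨rfl, h⟩
    exact absurd hab (not_le.mpr h)⟩

theorem columnPart_mul_apply (g x : Matrix (Fin n) (Fin n) K) (j a b : Fin n) :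
    ((columnPart g j).1 * x) a b = if j < a then g a j * x j b else 0 := by
  rw [Matrix.mul_apply, Finset.sum_eq_single j]
  · by_cases h : j < a <;> simp [columnPart, h]
  · intro l _ hl
    simp [columnPart, hl]
  · simp

theorem columnPart_mul_self (g : Matrix (Fin n) (Fin n) K) (j : Fin n) :
    (columnPart g j).1 * (columnPart g j).1 = 0 := by
  ext a b
  rw [columnPart_mul_apply]
  simp [columnPart]

theorem columnPart_mul_mul (g : Matrix (Fin n) (Fin n) K) (j : Fin n) (x : ut K n) :
    (columnPart g j).1 * (x.1 * (columnPart g j).1) = 0 := by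
  ext a b
  rw [columnPart_mul_apply]
  split_ifs with h
  · rw [Matrix.mul_apply, Finset.sum_eq_zero, mul_zero, Matrix.zero_apply]
    intro l _
    rcases le_or_gt j l with h1 | h1
    · rw [x.2 j l h1, zero_mul]
    · simp [columnPart, h1.not_gt]
  · rfl

theorem lie_lie_columnPart (g : Matrix (Fin n) (Fin n) K) (j : Fin n) (x : ut K n) :
    ⁅columnPart g j, ⁅columnPart g j, x⁆⁆ = 0 := by
  apply Subtype.ext
  simp only [LieSubalgebra.coe_bracket, LieRing.of_associative_ring_bracket, mul_sub, sub_mul]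
  rw [columnPart_mul_mul, ← mul_assoc, columnPart_mul_self, mul_assoc x.1, columnPart_mul_self,
    mul_assoc, columnPart_mul_mul]
  simp

theorem adUT_oneAdd (g : Matrix (Fin n) (Fin n) K) (j : Fin n) (x : ut K n) :
    adUT (oneAdd (columnPart g j) (columnPart_mul_self g j)) x = x + ⁅columnPart g j, x⁆ := by
  apply Subtype.ext
  change (1 + (columnPart g j).1) * x.1 * (1 - (columnPart g j).1) =
    x.1 + ((columnPart g j).1 * x.1 - x.1 * (columnPart g j).1)
  have h := columnPart_mul_mul g j x
  rw [mul_sub, mul_one, add_mul, one_mul, add_mul, mul_assoc, h]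
  abel

theorem adUT_mul (g h : UT K n) (x : ut K n) : adUT (g * h) x = adUT g (adUT h x) := by
  apply Subtype.ext
  simp [adUT, mul_assoc]

/-- `UT(n, K)` is generated by the elements `1 + C`, where `C` is concentrated in one column:
multiplying `g` by `(1 + C)⁻¹` on the left, where `C` is the part of the first nontrivial column of
`g` below the diagonal, clears that column. -/
theorem mem_of_oneAdd_mem {S : Submonoid (UT K n)}
    (h : ∀ g j, oneAdd (columnPart g j) (columnPart_mul_self g j) ∈ S) (g : UT K n) : g ∈ S := by
  -- Induction on the number `d` of columns, counted from the right, that may be nontrivial.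
  have key : ∀ d : ℕ, ∀ g : UT K n, (∀ a b : Fin n, b < a → (b : ℕ) + d < n →
      (g.1 : Matrix (Fin n) (Fin n) K) a b = 0) → g ∈ S := by
    intro d
    induction d with
    | zero =>
      intro g hg
      have : g = 1 := by
        apply Subtype.ext
        apply Units.ext
        ext a b
        change (g.1 : Matrix (Fin n) (Fin n) K) a b = (1 : Matrix (Fin n) (Fin n) K) a b
        rcases lt_trichotomy a b with hab | rfl | hab
        · rw [g.2.1 a b hab, Matrix.one_apply_ne hab.ne]
        · rw [g.2.2 a, Matrix.one_apply_eq]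
        · rw [hg a b hab b.2, Matrix.one_apply_ne hab.ne']
      rw [this]
      exact one_mem S
    | succ d ih =>
      intro g hg
      by_cases hd : d < n
      · set j : Fin n := ⟨n - 1 - d, by omega⟩ with hj
        set u := oneAdd (columnPart g.1.1 j) (columnPart_mul_self g.1.1 j)
        have hmul : g = u * (u⁻¹ * g) := by group
        rw [hmul]
        refine mul_mem (h _ _) (ih _ fun a b hba hb => ?_)
        change ((1 - (columnPart g.1.1 j).1) * g.1.1) a b = 0
        rw [sub_mul, one_mul, Matrix.sub_apply, columnPart_mul_apply]
        by_cases hbj : b = j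
        · subst hbj
          rw [if_pos hba, show g.1.1 j j = 1 from g.2.2 j, mul_one, sub_self]
        · have hb' : (b : ℕ) ≠ n - 1 - d := fun h' => hbj (Fin.ext h')
          have hlt : b < j := Fin.lt_def.mpr (by rw [hj]; simp only; omega)
          rw [show g.1.1 a b = 0 from hg a b hba (by omega),
            show g.1.1 j b = 0 from hg j b hlt (by omega)]
          simp
      · exact ih g fun a b hba hb => by omega
  exact key n g fun a b _ hb => by omega

end Unitriangular

namespace RootIdeal

variable {K : Type*} [Field K] {n : ℕ} (I : RootIdeal K n)

theorem Ad_mkQuot (g : UT K n) (x : ut K n) : I.Ad g (I.mkQuot x) = I.mkQuot (adUT g x) := rfl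

/-- The elements of the Poisson centre of `S(𝓛)` are invariant under the coadjoint action. -/
theorem isInvariant_of_bracket_eq_zero [CharZero K] {F : I.Sym}
    (hF : ∀ x, (PoissonBracket.liePoisson K I.Quot).bracket x F = 0) : I.IsInvariant F := by
  let S : Submonoid (UT K n) :=
    { carrier := {g | ∀ f : Module.Dual K I.Quot, I.evalAt (f ∘ₗ I.Ad g) F = I.evalAt f F}
      one_mem' := fun f => by
        congr 2
        ext x
        obtain ⟨x, rfl⟩ := I.mkQuot_surjective x
        rw [LinearMap.comp_apply, Ad_mkQuot]
        congr 2
        apply Subtype.ext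
        simp [adUT]
      mul_mem' := fun {g h} hg hh f => by
        rw [← hg f, ← hh (f ∘ₗ I.Ad g)]
        congr 2
        ext x
        obtain ⟨x, rfl⟩ := I.mkQuot_surjective x
        simp only [LinearMap.comp_apply, Ad_mkQuot, adUT_mul] }
  have hS : ∀ g, g ∈ S := by
    refine mem_of_oneAdd_mem fun g j f => ?_
    refine lift_comp_eq_of_bracket_eq_zero (c := I.mkQuot (columnPart g j)) ?_ (hF _) f ?_
    · intro x
      obtain ⟨x, rfl⟩ := I.mkQuot_surjective x
      exact (congrArg I.mkQuot (lie_lie_columnPart g j x)).trans (map_zero _)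
    · intro x
      obtain ⟨x, rfl⟩ := I.mkQuot_surjective x
      exact (congrArg I.mkQuot (adUT_oneAdd g j x)).trans (map_add _ _ _)
  exact fun g f => hS g⁻¹ f

end RootIdeal

namespace RootIdeal

variable {K : Type*} [Field K] {n : ℕ} (I : RootIdeal K n)

/-- `above` is the polynomial algebra in the variables `y_η` with `η ≻ ξ`. -/
theorem above_yMatrix (ξ : Place n) :
    above K I.yMatrix ξ.row ξ.col =
      Algebra.adjoin K {y : I.Sym | ∃ η : Place n, η.Succ ξ ∧ y = I.y η} := by
  rw [above]
  congr 1
  ext x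
  constructor
  · rintro ⟨c, d, hdc, h, rfl⟩
    exact ⟨⟨(c, d), hdc⟩, h, I.yMatrix_of_lt hdc⟩
  · rintro ⟨η, h, rfl⟩
    exact ⟨η.row, η.col, η.2, h, (I.yMatrix_place η).symm⟩

theorem exists_reductionState_stage {s : ℕ}
    (hs : ∀ i < s, ∃ ξ, (Diagram.stage I.places i).IsGreatestEmpty ξ) :
    ∃ (z : ℕ → I.Sym) (ι : Type) (_ : Fintype ι) (p q : ι → FractionRing I.Sym)
      (Y : Fin n → Fin n → FractionRing I.Sym),
      ReductionState
        ((PoissonBracket.liePoisson K I.Quot).localization (nonZeroDivisors I.Sym)) I.yMatrix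
        (Nat.card {η : Place n // η ∉ I.places})
        (fun j => IsGreatestIn (Diagram.stage I.places j).emptyRel)
        (Diagram.stage I.places s).emptyRel s z p q Y := by
  refine (exists_reductionState (R := I.Sym) (F := FractionRing I.Sym)
    (E := fun i => (Diagram.stage I.places i).emptyRel) (s := s) I.isEmptyPattern_start
    (fun i hi => ?_) (fun i k t h => ?_) (fun k t htk hM u hu v hv h => ?_)
    (I.reductionState_zero rfl _ 0) s le_rfl).2
  · obtain ⟨ξ, hξ⟩ := hs i hi
    exact ⟨ξ.row, ξ.col, Diagram.isGreatestEmpty_iff.mp hξ⟩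
  · exact (congrArg Diagram.emptyRel (Diagram.stage_succ _ _)).trans (Diagram.emptyRel_step h)
  · exact I.eq_zero_of_yMatrix_mul_add_eq_zero htk hM hu hv h

end RootIdeal

end

theorem theorem1 {K : Type*} [Field K] [CharZero K] (n : ℕ) (I : RootIdeal K n) (s : ℕ)
    (hs : s = (Diagram.tensorPlaces I.places).card) :
    ∃ (ξ : Fin s → Place n) (z : Fin s → I.Sym),
      -- `S = {ξ_1, …, ξ_s}`, where `ξ_i` is filled by `⊗` during the `i`-th step
      Set.range ξ = ↑(Diagram.tensorPlaces I.places) ∧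
      (∀ i : Fin s, (Diagram.stage I.places i).IsGreatestEmpty (ξ i)) ∧
      (∀ i, I.IsInvariant (z i)) ∧
      -- 1) the triangular form
      (∀ i : Fin s, ∃ e : Fin s → ℕ,
        ∃ P ∈ Algebra.adjoin K {y : I.Sym | ∃ η : Place n, η.Succ (ξ i) ∧ y = I.y η},
          z i = I.y (ξ i) * ∏ j ∈ Finset.Iio i, z j ^ e j + P) ∧
      -- 2) the structure of the localization
      ∃ (m : ℕ) (φ : Localization (Submonoid.closure (Set.range z)) ≃ₐ[K]
          MvLaurent K s ⊗[K] MvPolynomial (Fin m ⊕ Fin m) K),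
        PoissonBracket.IsPoissonIso
          ((PoissonBracket.liePoisson K I.Quot).localization (Submonoid.closure (Set.range z)))
          ((PoissonBracket.zero K (MvLaurent K s)).tensor (PoissonBracket.canonical K m)) φ ∧
        ∀ i, φ (algebraMap I.Sym _ (z i)) = MvLaurent.Z i ⊗ₜ[K] 1 := by
  subst hs
  obtain ⟨ξ, hrange, hξ, hfull⟩ := Diagram.exists_pivots I.places
  obtain ⟨z, ι, _, p, q, Y, h⟩ := I.exists_reductionState_stage fun i hi => ⟨ξ ⟨i, hi⟩, hξ ⟨i, hi⟩⟩
  have hloc := PoissonBracket.localization_algebraMap (nonZeroDivisors I.Sym)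
    (PoissonBracket.liePoisson K I.Quot)
  refine ⟨ξ, fun i => z i, hrange, hξ, fun i => ?_, fun i => ?_, ?_⟩
  · refine I.isInvariant_of_bracket_eq_zero fun x =>
      IsFractionRing.injective I.Sym (FractionRing I.Sym) ?_
    rw [map_zero]
    exact (hloc x (z i)).symm.trans (h.central i i.2 _)
  · obtain ⟨e, r, hr, hz⟩ := h.form i i.2 (Diagram.isGreatestEmpty_iff.mp (hξ i))
    refine ⟨fun j => e j, r, I.above_yMatrix (ξ i) ▸ hr, ?_⟩
    rw [I.yMatrix_place] at hz
    refine hz.trans ?_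
    congr 2
    refine (Finset.prod_bij (fun (j : Fin _) _ => (j : ℕ)) ?_ ?_ ?_ ?_).symm
    · intro j hj
      exact Finset.mem_range.mpr (Fin.lt_def.mp (Finset.mem_Iio.mp hj))
    · intro j _ j' _ hjj
      exact Fin.ext hjj
    · intro l hl
      have hl' := Finset.mem_range.mp hl
      exact ⟨⟨l, hl'.trans i.2⟩, Finset.mem_Iio.mpr hl', rfl⟩
    · intro j _
      rfl
  · exact h.exists_isPoissonIso (fun a b hab => hfull _ hab.2) hloc I.card_le_trdeg fun _ => rfl
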